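/- **Setting.** In \textsc{Vertex Cover} parameterized by treewidth, an instance is a finite simple graph $G$ together with a tree decomposition $\mathcal{T}$ of $G$; its parameter $\ell$ is the width of $\mathcal{T}$ (taken to be $0$ if all bags are empty). The solutions are the vertex covers of $G$, the value of a solution is its number of vertices, and $\mathrm{OPT}(G)$ is the minimum value. For a real number $c\ge 1$, a $c$-approximate oracle is a function that maps every instance to a vertex cover of its graph of size at most $c$ times the optimum. For $\alpha\ge 1$, an $\alpha$-approximate Turing kernel of size $f$ (with $f$ computable and the size of an instance measured in a given way) is an algorithm, not depending on $c$ or on the oracle, that for every $c\ge 1$, every $c$-approximate oracle and every instance $(G,\mathcal{T})$ of parameter $\ell$ runs in time polynomial in the length of the encoding of the instance plus $\ell$ (an oracle call counts as one step), queries the oracle only on instances of size at most $f(\ell)$, and outputs a vertex cover of $G$ of size at most $\alpha\cdot c\cdot \mathrm{OPT}(G)$. **Theorem.** There is a constant $C>0$ such that for every real $\varepsilon$ with $0<\varepsilon\le 1$ there are a computable function $f\colon\mathbb{N}\to\mathbb{N}$ with $f(\ell)\le C\cdot\ell/\varepsilon$ for all $\ell$ and an algorithm that is a $(1+\varepsilon)$-approximate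 Turing kernel for \textsc{Vertex Cover} parameterized by treewidth $\ell$ whose queries have at most $f(\ell)$ vertices, that is, $\mathcal{O}(\ell/\varepsilon)$ vertices. Moreover, for every fixed $\varepsilon$ the lengths of the encodings of the queries of this algorithm are bounded by a polynomial in $\ell$. -/

import Mathlib

/-! ### Machine model: while-programs over binary trees, with an oracle

Programs work on finitely many variables that hold binary trees. Every operation is charged one step
plus the size of the tree that it produces, so that the running time is, up to a polynomial (and for
a fixed program), that of a Turing machine. An oracle call is charged as a single step, in addition
to the time for writing down the query. -/

/-- The data of the machine model: unlabelled binary trees. -/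
inductive BinTree : Type where
  | nil : BinTree
  | cons : BinTree → BinTree → BinTree
  deriving DecidableEq

namespace BinTree

/-- The number of nodes of a tree (a `nil` counts as one node). -/
def size : BinTree → ℕ
  | nil => 1
  | cons a b => 1 + a.size + b.size

/-- The left subtree; `nil` for `nil`. -/
def hd : BinTree → BinTree
  | nil => nil
  | cons a _ => a

/-- The right subtree; `nil` for `nil`. -/
def tl : BinTree → BinTree
  | nil => nil
  | cons _ b => b

/-- Truth values as trees. -/
def ofBool : Bool → BinTree
  | false => nil
  | true => cons nil nil

/-- Lists of trees as trees. -/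
def ofList : List BinTree → BinTree
  | [] => nil
  | a :: l => cons a (ofList l)

open Classical in
/-- A `0/1`-vector of length `n`, as the list of its entries. -/
noncomputable def ofVector {n : ℕ} (P : Fin n → Prop) : BinTree :=
  ofList (List.ofFn fun i => ofBool (decide (P i)))

/-- An `m × n` matrix with entries in `{0, 1}`, as the list of its rows. -/
noncomputable def ofMatrix {m n : ℕ} (R : Fin m → Fin n → Prop) : BinTree :=
  ofList (List.ofFn fun i => ofVector (R i))

end BinTree

/-- The contents of the variables of a program. -/
abbrev Store : Type := ℕ → BinTree

/-- Expressions of the programming language. -/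
inductive WExpr : Type where
  | var : ℕ → WExpr
  | nil : WExpr
  | cons : WExpr → WExpr → WExpr
  | hd : WExpr → WExpr
  | tl : WExpr → WExpr
  | eq : WExpr → WExpr → WExpr

namespace WExpr

/-- The value of an expression. -/
def eval (σ : Store) : WExpr → BinTree
  | var x => σ x
  | nil => .nil
  | cons e f => .cons (e.eval σ) (f.eval σ)
  | hd e => (e.eval σ).hd
  | tl e => (e.eval σ).tl
  | eq e f => .ofBool (decide (e.eval σ = f.eval σ))

/-- The time for evaluating an expression: every node of the expression is charged
`1 +` the size of the tree that it evaluates to. -/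
def cost (σ : Store) : WExpr → ℕ
  | var x => 1 + (σ x).size
  | nil => 1 + BinTree.nil.size
  | cons e f => e.cost σ + f.cost σ + (1 + ((cons e f).eval σ).size)
  | hd e => e.cost σ + (1 + ((hd e).eval σ).size)
  | tl e => e.cost σ + (1 + ((tl e).eval σ).size)
  | eq e f => e.cost σ + f.cost σ + (1 + ((eq e f).eval σ).size)

end WExpr

/-- While-programs with an instruction `query x e`, which puts the answer of the oracle to the
query `e` into the variable `x`. In tests, `nil` means "false" and every other tree "true". -/
inductive WProg : Type where
  | skip : WProg
  | assign : ℕ → WExpr → WProg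
  | seq : WProg → WProg → WProg
  | ite : WExpr → WProg → WProg → WProg
  | loop : WExpr → WProg → WProg
  | query : ℕ → WExpr → WProg

/-- `Exec O P σ τ t qs`: with the oracle `O`, the program `P` started on the store `σ` halts with
the store `τ` after `t` steps, and `qs` is the list of the queries that it makes. -/
inductive Exec (O : BinTree → BinTree) :
    WProg → Store → Store → ℕ → List BinTree → Prop where
  | skip (σ : Store) : Exec O .skip σ σ 1 []
  | assign (x : ℕ) (e : WExpr) (σ : Store) :
      Exec O (.assign x e) σ (Function.update σ x (e.eval σ)) (1 + e.cost σ) []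
  | seq {P P' : WProg} {σ τ υ : Store} {t t' : ℕ} {qs qs' : List BinTree} :
      Exec O P σ τ t qs → Exec O P' τ υ t' qs' →
      Exec O (.seq P P') σ υ (t + t') (qs ++ qs')
  | ite_true {e : WExpr} {P P' : WProg} {σ τ : Store} {t : ℕ} {qs : List BinTree} :
      e.eval σ ≠ .nil → Exec O P σ τ t qs →
      Exec O (.ite e P P') σ τ (1 + e.cost σ + t) qs
  | ite_false {e : WExpr} {P P' : WProg} {σ τ : Store} {t : ℕ} {qs : List BinTree} :
      e.eval σ = .nil → Exec O P' σ τ t qs →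
      Exec O (.ite e P P') σ τ (1 + e.cost σ + t) qs
  | loop_done {e : WExpr} {P : WProg} {σ : Store} :
      e.eval σ = .nil → Exec O (.loop e P) σ σ (1 + e.cost σ) []
  | loop_step {e : WExpr} {P : WProg} {σ τ υ : Store} {t t' : ℕ} {qs qs' : List BinTree} :
      e.eval σ ≠ .nil → Exec O P σ τ t qs → Exec O (.loop e P) τ υ t' qs' →
      Exec O (.loop e P) σ υ (1 + e.cost σ + t + t') (qs ++ qs')
  | query (x : ℕ) (e : WExpr) (σ : Store) :
      Exec O (.query x e) σ (Function.update σ x (O (e.eval σ))) (1 + e.cost σ) [e.eval σ]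

/-- The initial store: the input is in variable `0`, all other variables are `nil`. -/
def initStore (d : BinTree) : Store := Function.update (fun _ => .nil) 0 d

/-! ### Parameterized minimization problems and approximate Turing kernels -/

/-- A parameterized minimization problem: instances and (feasible) solutions, both with an encoding
as trees, the parameter of an instance, and the value of a solution. -/
structure ParamMinProblem where
  Inst : Type
  encode : Inst → BinTree
  param : Inst → ℕ
  Sol : Inst → Type
  sol_nonempty : ∀ I, Nonempty (Sol I)
  encodeSol : (I : Inst) → Sol I → BinTree
  value : (I : Inst) → Sol I → ℕ

namespace ParamMinProblem

/-- The length of the encoding of an instance. -/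
def encSize (Q : ParamMinProblem) (I : Q.Inst) : ℕ := (Q.encode I).size

/-- The optimal value of an instance. -/
noncomputable def opt (Q : ParamMinProblem) (I : Q.Inst) : ℕ := ⨅ s : Q.Sol I, Q.value I s

/-- `d` encodes a solution of `I` of value at most `r` times the optimum. -/
def IsApproxSolution (Q : ParamMinProblem) (r : ℝ) (I : Q.Inst) (d : BinTree) : Prop :=
  ∃ s : Q.Sol I, d = Q.encodeSol I s ∧ (Q.value I s : ℝ) ≤ r * Q.opt I

/-- `O` answers every instance of `Q` with a `c`-approximate solution. -/
def IsApproxOracle (Q : ParamMinProblem) (c : ℝ) (O : BinTree → BinTree) : Prop :=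
  ∀ I : Q.Inst, Q.IsApproxSolution c I (O (Q.encode I))

/-- `P` is an `α`-approximate Turing kernel for `Q` of size `f`, where the size of an instance is
measured by `μ` (for example by the length of its encoding, or by its number of vertices). The
program and the polynomial that bounds its running time do not depend on `c` or on the oracle. -/
def IsApproxTuringKernel (Q : ParamMinProblem) (α : ℝ) (μ : Q.Inst → ℕ) (f : ℕ → ℕ)
    (P : WProg) : Prop :=
  1 ≤ α ∧ Computable f ∧
  ∃ p : Polynomial ℕ, ∀ c : ℝ, 1 ≤ c → ∀ O : BinTree → BinTree, Q.IsApproxOracle c O →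
    ∀ I : Q.Inst, ∃ (τ : Store) (t : ℕ) (qs : List BinTree),
      Exec O P (initStore (Q.encode I)) τ t qs ∧
      t ≤ p.eval (Q.encSize I + Q.param I) ∧
      Q.IsApproxSolution (α * c) I (τ 0) ∧
      ∀ q ∈ qs, ∃ J : Q.Inst, q = Q.encode J ∧ μ J ≤ f (Q.param I)

end ParamMinProblem

/-! ### Vertex cover parameterized by treewidth -/

/-- A tree decomposition of `G`, whose tree has the node set `N`. -/
structure TreeDecomposition {V : Type} (G : SimpleGraph V) (N : Type) where
  tree : SimpleGraph N
  isTree : tree.IsTree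
  bag : N → Finset V
  vertex_mem : ∀ v, ∃ t, v ∈ bag t
  edge_mem : ∀ u v, G.Adj u v → ∃ t, u ∈ bag t ∧ v ∈ bag t
  connected : ∀ v, (tree.induce {t | v ∈ bag t}).Connected

/-- The size of the largest bag minus one (`0` if all bags are empty). -/
def TreeDecomposition.width {V : Type} {G : SimpleGraph V} {N : Type} [Fintype N]
    (D : TreeDecomposition G N) : ℕ :=
  (Finset.univ.sup fun t => (D.bag t).card) - 1

/-- A finite graph that is given together with a tree decomposition. -/
structure GraphWithTD where
  n : ℕ
  graph : SimpleGraph (Fin n)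
  numNodes : ℕ
  dec : TreeDecomposition graph (Fin numNodes)

namespace GraphWithTD

/-- The adjacency matrix of the graph, the adjacency matrix of the tree, and the incidence matrix
of the bags. -/
noncomputable def encode (I : GraphWithTD) : BinTree :=
  .cons (.ofMatrix I.graph.Adj)
    (.cons (.ofMatrix I.dec.tree.Adj) (.ofMatrix fun t v => v ∈ I.dec.bag t))

end GraphWithTD

/-- Vertex cover parameterized by treewidth: the input is a graph with a tree decomposition, the
parameter is the width of that decomposition, the solutions are the vertex covers of the graph
(encoded by their characteristic vectors), and the value of a solution is its cardinality. -/
noncomputable def vertexCoverTW : ParamMinProblem where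
  Inst := GraphWithTD
  encode := GraphWithTD.encode
  param I := I.dec.width
  Sol I := {S : Finset (Fin I.n) // I.graph.IsVertexCover (S : Set (Fin I.n))}
  sol_nonempty I := ⟨⟨Finset.univ, by simp⟩⟩
  encodeSol _ S := .ofVector fun v => v ∈ S.1
  value _ S := S.1.card

/-! Let `K = ⌈1/ε⌉` and let `b` be the largest bag size. The graph is cut along the tree into pieces
`(X, U)` such that the sets `U` are pairwise disjoint, every edge meets some `X` or lies inside some
`U`, and `K * |X| ≤ |S ∩ U|` for every vertex cover `S` of the graph (`isSplitting_pieces`,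
`card_filter_separator_le`). The cover takes all of `X`, which costs at most `ε * |S ∩ U|`, and
covers the graph induced by `U` by a crown reduction followed by one query. With `S` optimal,
summing over the disjoint sets `U` gives the factor `(1 + ε) * c` (`card_pieceCover_le`,
`GraphWithTD.isApproxSolution_compose`).

The crown reduction is that of Nemhauser and Trotter: vertices of value 1 in a half-integral LP
solution are taken, those of value 0 are dropped, and those of value 1/2 form the query. The
solution comes from an auction on the bipartite double cover, in which every vertex is both a bidder
and an item. A free vertex bids for a cheapest neighbour and thereby raises its price by one. At the
end some `h` in `[1, n + 1]` is not a price. The head `A` consists of the items dearer than `h`, the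
crown `B` of the bidders that are free or hold an item of `A`. All neighbours of `B` are in `A`
(`isCrown_auction`), so the values are 1 on `A \ B`, 0 on `B \ A` and 1/2 elsewhere. The assignment
of items to holders is the matching that certifies optimality (`IsCrown.card_taken_add_le`,
`IsCrown.card_rest_le`).

For the splitting, a leaf `t` of the remaining tree is merged into its neighbour `s`. If twice the
LP value of the merged part `U` exceeds `2 * K * |bag s|`, then `(bag s, U)` is cut off as a piece.
Otherwise `U` has a cover of size at most `2 * b * K` and the merging goes on. A merged part is thus
the union of two parts with small covers; adding `bag s` for the edges between them gives a cover of
size at most `5 * b * K` (`SplitInvariant.cover_join`). The vertices of value 1/2 are at most twice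
as many, and `b ≤ 2 * ℓ` if `ℓ ≥ 1`, so a query has at most `20 * K * ℓ` vertices
(`GraphWithTD.length_rest_le`).

For the running time, the algorithm is written as a function on lists of lists of truth values. The
predicate `PT` is closed under composition, list operations and iterations with bounded intermediate
results, and `exists_queryProgram` turns the preparation of the queries and the composition of the
answers into one while-program. -/

/-! ### Polynomially bounded functions -/

/-- Functions on the natural numbers that are given by a polynomial with natural coefficients. -/
@[fun_prop]
def IsNatPoly (T : ℕ → ℕ) : Prop := ∃ p : Polynomial ℕ, ∀ n, T n = p.eval n

namespace IsNatPoly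

variable {S T : ℕ → ℕ}

@[fun_prop]
theorem id' : IsNatPoly fun n => n := ⟨.X, by simp⟩

@[fun_prop]
theorem const (c : ℕ) : IsNatPoly fun _ => c := ⟨.C c, by simp⟩

@[fun_prop]
theorem add (hS : IsNatPoly S) (hT : IsNatPoly T) : IsNatPoly fun n => S n + T n := by
  obtain ⟨p, hp⟩ := hS
  obtain ⟨q, hq⟩ := hT
  exact ⟨p + q, by simp [hp, hq]⟩

@[fun_prop]
theorem mul (hS : IsNatPoly S) (hT : IsNatPoly T) : IsNatPoly fun n => S n * T n := by
  obtain ⟨p, hp⟩ := hS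
  obtain ⟨q, hq⟩ := hT
  exact ⟨p * q, by simp [hp, hq]⟩

@[fun_prop]
theorem comp (hS : IsNatPoly S) (hT : IsNatPoly T) : IsNatPoly fun n => S (T n) := by
  obtain ⟨p, hp⟩ := hS
  obtain ⟨q, hq⟩ := hT
  exact ⟨p.comp q, by simp [hp, hq]⟩

/-- Natural coefficients make the bounds monotone, so that they survive replacing an input size by
an upper bound for it. -/
theorem mono (hT : IsNatPoly T) : Monotone T := by
  obtain ⟨p, hp⟩ := hT
  intro m n h
  rw [hp, hp, Polynomial.eval_eq_sum_range, Polynomial.eval_eq_sum_range]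
  gcongr

end IsNatPoly

/-! ### Types whose elements are encoded as trees -/

/-- An injective encoding of the elements of a type as trees. -/
class TreeEnc (α : Type) where
  enc : α → BinTree
  inj : Function.Injective enc

open TreeEnc (enc)

namespace BinTree

theorem one_le_size (d : BinTree) : 1 ≤ d.size := by
  cases d <;> simp [size]; omega

theorem size_hd_le (d : BinTree) : d.hd.size ≤ d.size := by
  cases d <;> simp [size, hd]; omega

theorem size_tl_le (d : BinTree) : d.tl.size ≤ d.size := by
  cases d <;> simp [size, tl]

theorem ofList_injective : Function.Injective ofList := by
  intro l l'
  induction l generalizing l' with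
  | nil => cases l' <;> simp [ofList]
  | cons a l ih =>
    cases l' with
    | nil => simp [ofList]
    | cons b l' => simpa [ofList] using fun h h' => ⟨h, ih h'⟩

end BinTree

instance : TreeEnc Bool where
  enc := .ofBool
  inj := by intro a b; cases a <;> cases b <;> simp [BinTree.ofBool]

instance : TreeEnc Unit where
  enc _ := .nil
  inj := by intro a b; simp

/-- Unary notation suffices, because all numbers that occur are polynomially bounded; it makes a
number the same tree as a list of units, so that loops over lists also do arithmetic. -/
instance : TreeEnc ℕ where
  enc n := .ofList (List.replicate n .nil)
  inj := BinTree.ofList_injective.comp (List.replicate_left_injective _)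

instance {α β : Type} [TreeEnc α] [TreeEnc β] : TreeEnc (α × β) where
  enc x := .cons (enc x.1) (enc x.2)
  inj := by
    rintro ⟨a, b⟩ ⟨c, d⟩ h
    simp only [BinTree.cons.injEq] at h
    rw [TreeEnc.inj h.1, TreeEnc.inj h.2]

instance {α : Type} [TreeEnc α] : TreeEnc (List α) where
  enc l := .ofList (l.map enc)
  inj := BinTree.ofList_injective.comp (List.map_injective_iff.2 TreeEnc.inj)

section enc

variable {α β : Type} [TreeEnc α] [TreeEnc β]

theorem enc_pair (a : α) (b : β) : enc (a, b) = .cons (enc a) (enc b) := rfl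
theorem enc_prod (x : α × β) : enc x = .cons (enc x.1) (enc x.2) := rfl
theorem enc_nil : enc ([] : List α) = .nil := rfl
theorem enc_cons (a : α) (l : List α) : enc (a :: l) = .cons (enc a) (enc l) := rfl
theorem enc_true : enc true = .cons .nil .nil := rfl
theorem enc_false : enc false = .nil := rfl

theorem enc_unit_list (n : ℕ) : enc (List.replicate n ()) = enc n := by
  simp [enc]

/-- The size of the encoding. -/
def encLen (a : α) : ℕ := (enc a).size

theorem one_le_encLen (a : α) : 1 ≤ encLen a := (enc a).one_le_size

theorem encLen_pair (a : α) (b : β) : encLen (a, b) = 1 + encLen a + encLen b := rfl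
theorem encLen_nil : encLen ([] : List α) = 1 := rfl
theorem encLen_cons (a : α) (l : List α) : encLen (a :: l) = 1 + encLen a + encLen l := rfl

theorem encLen_nat (n : ℕ) : encLen n = 2 * n + 1 := by
  induction n with
  | zero => rfl
  | succ n ih =>
    have : encLen (n + 1) = 1 + 1 + encLen n := rfl
    omega

theorem encLen_bool_le (b : Bool) : encLen b ≤ 3 := by
  cases b <;> simp [encLen, enc, BinTree.ofBool, BinTree.size]

theorem encLen_le_of_mem {l : List α} {a : α} (h : a ∈ l) : encLen a ≤ encLen l := by
  induction l with
  | nil => simp at h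
  | cons b l ih =>
    rw [encLen_cons]
    rcases List.mem_cons.1 h with rfl | h
    · omega
    · have := ih h; omega

theorem length_le_encLen (l : List α) : l.length ≤ encLen l := by
  induction l with
  | nil => simp
  | cons b l ih => rw [encLen_cons, List.length_cons]; omega

theorem encLen_list_le {l : List α} {B : ℕ} (h : ∀ a ∈ l, encLen a ≤ B) :
    encLen l ≤ 1 + l.length * (B + 1) := by
  induction l with
  | nil => simp [encLen_nil]
  | cons b l ih =>
    rw [encLen_cons, List.length_cons, add_mul]
    have := ih fun a ha => h a (List.mem_cons_of_mem _ ha)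
    have := h b List.mem_cons_self
    omega

theorem encLen_list_le' {l : List α} {B m : ℕ} (h : ∀ a ∈ l, encLen a ≤ B) (hl : l.length ≤ m) :
    encLen l ≤ 1 + m * (B + 1) :=
  (encLen_list_le h).trans (by gcongr)

theorem encLen_append (l l' : List α) : encLen (l ++ l') + 1 = encLen l + encLen l' := by
  induction l with
  | nil => simp [encLen_nil]; omega
  | cons a l ih => simp only [List.cons_append, encLen_cons]; omega

theorem encLen_reverse (l : List α) : encLen l.reverse = encLen l := by
  induction l with
  | nil => rfl
  | cons a l ih =>
    have := encLen_append l.reverse [a]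
    simp only [List.reverse_cons, encLen_cons, encLen_nil] at *
    omega

end enc

/-! ### Running a program without queries -/

/-- Without a query and within time `B`, the program leads from one store to another. -/
def Runs (O : BinTree → BinTree) (P : WProg) (σ τ : Store) (B : ℕ) : Prop :=
  ∃ t, Exec O P σ τ t [] ∧ t ≤ B

namespace Runs

variable {O : BinTree → BinTree} {P P' : WProg} {σ τ υ : Store} {B B' : ℕ}

theorem mono (h : Runs O P σ τ B) (hB : B ≤ B') : Runs O P σ τ B' := by
  obtain ⟨t, h, ht⟩ := h
  exact ⟨t, h, ht.trans hB⟩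

theorem assign (x : ℕ) {e : WExpr} {d : BinTree} (he : e.eval σ = d) (hB : 1 + e.cost σ ≤ B) :
    Runs O (.assign x e) σ (Function.update σ x d) B :=
  ⟨_, he ▸ .assign x e σ, hB⟩

theorem seq (h : Runs O P σ τ B) (h' : Runs O P' τ υ B') : Runs O (.seq P P') σ υ (B + B') := by
  obtain ⟨t, h, ht⟩ := h
  obtain ⟨t', h', ht'⟩ := h'
  exact ⟨_, .seq h h', by omega⟩

theorem ite_true {e : WExpr} (he : e.eval σ ≠ .nil) (h : Runs O P σ τ B) :
    Runs O (.ite e P P') σ τ (1 + e.cost σ + B) := by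
  obtain ⟨t, h, ht⟩ := h
  exact ⟨_, .ite_true he h, by omega⟩

theorem ite_false {e : WExpr} (he : e.eval σ = .nil) (h : Runs O P' σ τ B) :
    Runs O (.ite e P P') σ τ (1 + e.cost σ + B) := by
  obtain ⟨t, h, ht⟩ := h
  exact ⟨_, .ite_false he h, by omega⟩

theorem loop_done {e : WExpr} (he : e.eval σ = .nil) : Runs O (.loop e P) σ σ (1 + e.cost σ) :=
  ⟨_, .loop_done he, le_rfl⟩

theorem loop_step {e : WExpr} (he : e.eval σ ≠ .nil) (h : Runs O P σ τ B)
    (h' : Runs O (.loop e P) τ υ B') : Runs O (.loop e P) σ υ (1 + e.cost σ + B + B') := by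
  obtain ⟨t, h, ht⟩ := h
  obtain ⟨t', h', ht'⟩ := h'
  exact ⟨_, .loop_step he h h', by omega⟩

end Runs

/-! ### Functions that are computed in polynomial time -/

section PT

variable {α β γ δ ι : Type} [TreeEnc α] [TreeEnc β] [TreeEnc γ] [TreeEnc δ] [TreeEnc ι]

/-- The program `P` computes `f` on the variable `0`, in time `T` and with results of size at most
`T`, and it leaves the variables from `k` on alone. -/
def Computes (P : WProg) (k : ℕ) (T : ℕ → ℕ) (f : α → β) : Prop :=
  ∀ (a : α) (O : BinTree → BinTree) (σ : Store), σ 0 = enc a → ∃ τ,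
    Runs O P σ τ (T (encLen a)) ∧ τ 0 = enc (f a) ∧ (∀ x, k ≤ x → τ x = σ x) ∧
    encLen (f a) ≤ T (encLen a)

/-- `f` is computed without queries by a program that runs in polynomial time. -/
@[fun_prop]
def PT (f : α → β) : Prop := ∃ P k T, IsNatPoly T ∧ 1 ≤ k ∧ Computes P k T f

namespace PT

theorem encLen_le {f : α → β} (hf : PT f) : ∃ T, IsNatPoly T ∧ ∀ a, encLen (f a) ≤ T (encLen a) := by
  obtain ⟨P, k, T, hT, hk, h⟩ := hf
  refine ⟨T, hT, fun a => ?_⟩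
  obtain ⟨τ, -, -, -, h⟩ := h a id (fun _ => enc a) rfl
  exact h

/-- A function that is computed by one expression. -/
theorem of_expr {f : α → β} (e : WExpr) {T : ℕ → ℕ} (hT : IsNatPoly T)
    (he : ∀ (a : α) (σ : Store), σ 0 = enc a → e.eval σ = enc (f a))
    (hc : ∀ (a : α) (σ : Store), σ 0 = enc a → e.cost σ ≤ T (encLen a))
    (hs : ∀ a, encLen (f a) ≤ T (encLen a)) : PT f := by
  refine ⟨.assign 0 e, 1, fun n => 1 + T n, by fun_prop, le_rfl, fun a O σ ha => ?_⟩
  refine ⟨_, Runs.assign 0 (he a σ ha) (by have := hc a σ ha; dsimp; omega), by simp, ?_, ?_⟩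
  · intro x hx
    rw [Function.update_of_ne (by omega)]
  · have := hs a; dsimp; omega

@[fun_prop]
theorem id' : PT fun a : α => a :=
  of_expr (.var 0) (T := fun n => 1 + n) (by fun_prop) (fun a σ h => h)
    (fun a σ h => by simp [WExpr.cost, h, encLen]) (fun a => by omega)

/-- The expression for a fixed tree. -/
def _root_.BinTree.toExpr : BinTree → WExpr
  | .nil => .nil
  | .cons a b => .cons a.toExpr b.toExpr

@[fun_prop]
theorem const (b : β) : PT fun _ : α => b := by
  have h : ∀ (d : BinTree) (σ : Store), d.toExpr.eval σ = d := by
    intro d σ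
    induction d <;> simp_all [BinTree.toExpr, WExpr.eval]
  -- The expression contains no variables, so its cost does not depend on the store and serves as a
  -- constant time bound.
  have h' : ∀ (d : BinTree) (σ : Store), d.toExpr.cost σ = d.toExpr.cost (fun _ => .nil) := by
    intro d σ
    induction d <;> simp_all [BinTree.toExpr, WExpr.cost, WExpr.eval]
  refine of_expr (enc b).toExpr (T := fun _ => (enc b).toExpr.cost (fun _ => .nil) + encLen b)
    (by fun_prop) (fun a σ _ => h _ _) (fun a σ _ => ?_) (fun a => by omega)
  rw [h']; omega

@[fun_prop]
theorem comp {g : β → γ} {f : α → β} (hg : PT g) (hf : PT f) : PT fun a => g (f a) := by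
  obtain ⟨P, k, T, hT, hk, h⟩ := hf
  obtain ⟨P', k', T', hT', hk', h'⟩ := hg
  refine ⟨.seq P P', k + k', fun n => T n + T' (T n), by fun_prop, by omega, fun a O σ ha => ?_⟩
  obtain ⟨τ, h1, h2, h3, h4⟩ := h a O σ ha
  obtain ⟨υ, h1', h2', h3', h4'⟩ := h' (f a) O τ h2
  have := hT'.mono h4
  refine ⟨υ, (h1.seq h1').mono (by dsimp; omega), h2', fun x hx => ?_, by dsimp; omega⟩
  rw [h3' x (by omega), h3 x (by omega)]

@[fun_prop]
theorem fst {f : α → β × γ} (hf : PT f) : PT fun a => (f a).1 := by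
  refine PT.comp (g := Prod.fst) ?_ hf
  refine of_expr (.hd (.var 0)) (T := fun n => 1 + n + (1 + n)) (by fun_prop)
    (fun a σ h => by simp [WExpr.eval, h, enc_prod, BinTree.hd]) (fun a σ h => ?_) (fun a => ?_)
  · have := (enc a).size_hd_le
    simp only [WExpr.cost, WExpr.eval, h, encLen]; omega
  · have : encLen a = 1 + encLen a.1 + encLen a.2 := rfl
    omega

@[fun_prop]
theorem snd {f : α → β × γ} (hf : PT f) : PT fun a => (f a).2 := by
  refine PT.comp (g := Prod.snd) ?_ hf
  refine of_expr (.tl (.var 0)) (T := fun n => 1 + n + (1 + n)) (by fun_prop)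
    (fun a σ h => by simp [WExpr.eval, h, enc_prod, BinTree.tl]) (fun a σ h => ?_) (fun a => ?_)
  · have := (enc a).size_tl_le
    simp only [WExpr.cost, WExpr.eval, h, encLen]; omega
  · have : encLen a = 1 + encLen a.1 + encLen a.2 := rfl
    omega

-- The input and the first result are saved in the variables `k + k'` and `k + k' + 1`, which
-- neither program touches.
@[fun_prop]
theorem pair {f : α → β} {g : α → γ} (hf : PT f) (hg : PT g) : PT fun a => (f a, g a) := by
  obtain ⟨P, k, T, hT, hk, h⟩ := hf
  obtain ⟨P', k', T', hT', hk', h'⟩ := hg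
  refine ⟨.seq (.assign (k + k') (.var 0)) (.seq P (.seq (.assign (k + k' + 1) (.var 0))
    (.seq (.assign 0 (.var (k + k'))) (.seq P' (.assign 0 (.cons (.var (k + k' + 1)) (.var 0))))))),
    k + k' + 2, fun n => 4 * n + 9 * T n + 9 * T' n + 20, by fun_prop, by omega,
    fun a O σ ha => ?_⟩
  have s1 := Runs.assign (O := O) (σ := σ) (k + k') (e := .var 0) ha le_rfl
  obtain ⟨τ, s2, h2, h3, h4⟩ := h a O (Function.update σ (k + k') (enc a)) (by
    rwa [Function.update_of_ne (by omega)])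
  have hk1 : τ (k + k') = enc a := by rw [h3 _ (by omega)]; simp
  have s3 := Runs.assign (O := O) (k + k' + 1) (e := .var 0) h2 le_rfl
  have s4 := Runs.assign (O := O) (σ := Function.update τ (k + k' + 1) (enc (f a))) 0
    (e := .var (k + k')) (d := enc a) (by simp [WExpr.eval, hk1]) le_rfl
  obtain ⟨υ, s5, h2', h3', h4'⟩ := h' a O (Function.update (Function.update τ (k + k' + 1) (enc (f a)))
    0 (enc a)) (Function.update_self ..)
  have hk3 : υ (k + k' + 1) = enc (f a) := by
    rw [h3' _ (by omega), Function.update_of_ne (by omega), Function.update_self]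
  have s6 := Runs.assign (O := O) (σ := υ) 0 (e := .cons (.var (k + k' + 1)) (.var 0))
    (d := enc (f a, g a)) (by simp [WExpr.eval, hk3, h2', enc_pair]) le_rfl
  refine ⟨_, (s1.seq (s2.seq (s3.seq (s4.seq (s5.seq s6))))).mono ?_, by simp, fun x hx => ?_, ?_⟩
  · have e1 : Function.update τ (k + k' + 1) (enc (f a)) (k + k') = enc a := by simp [hk1]
    simp only [encLen] at h4 h4'
    simp only [WExpr.cost, WExpr.eval, ha, h2, e1, h2', hk3, encLen, BinTree.size]
    omega
  · rw [Function.update_of_ne (by omega), h3' x (by omega), Function.update_of_ne (by omega),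
      Function.update_of_ne (by omega), h3 x (by omega), Function.update_of_ne (by omega)]
  · rw [encLen_pair]; dsimp; omega

end PT
end PT

/-! ### Polynomial time: recoding, case distinctions and loops -/

namespace PT

section

variable {α β γ δ ι : Type} [TreeEnc α] [TreeEnc β] [TreeEnc γ] [TreeEnc δ] [TreeEnc ι]

/-- Reading the encoding of `β` as one of `γ`. -/
theorem recode {f : α → β} {g : α → γ} (hf : PT f) (h : ∀ a, enc (g a) = enc (f a)) : PT g := by
  obtain ⟨P, k, T, hT, hk, hP⟩ := hf
  refine ⟨P, k, T, hT, hk, fun a => ?_⟩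
  have := hP a
  simpa only [encLen, h] using this

@[fun_prop]
theorem cons {f : α → β} {l : α → List β} (hf : PT f) (hl : PT l) : PT fun a => f a :: l a :=
  (hf.pair hl).recode fun _ => rfl

@[fun_prop]
theorem decide_eq {f g : α → β} [∀ a, Decidable (f a = g a)] (hf : PT f) (hg : PT g) :
    PT fun a => decide (f a = g a) := by
  classical
  have : PT fun x : β × β => decide (x.1 = x.2) := by
    refine of_expr (.eq (.hd (.var 0)) (.tl (.var 0))) (T := fun n => 20 + 4 * n) (by fun_prop)
      (fun x σ h => ?_) (fun x σ h => ?_) (fun a => ?_)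
    · simp [WExpr.eval, h, BinTree.hd, BinTree.tl, TreeEnc.inj.eq_iff, enc]
    · simp only [WExpr.cost, WExpr.eval, h]
      have := (enc x).size_hd_le
      have := (enc x).size_tl_le
      have : (BinTree.ofBool (decide ((enc x).hd = (enc x).tl))).size ≤ 3 := encLen_bool_le _
      simp only [encLen]
      omega
    · have := encLen_bool_le (decide (a.1 = a.2))
      omega
  convert this.comp (hf.pair hg)

/-- A case distinction by a test that is computed in polynomial time. -/
@[fun_prop]
theorem cond {c : α → Bool} {f g : α → β} (hc : PT c) (hf : PT f) (hg : PT g) :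
    PT fun a => bif c a then f a else g a := by
  obtain ⟨P, k, T, hT, hk, h⟩ := hf
  obtain ⟨P', k', T', hT', hk', h'⟩ := hg
  obtain ⟨Q, m, S, hS, hm, hQ⟩ := hc
  refine ⟨.seq (.assign (k + k' + m) (.var 0)) (.seq Q (.seq (.assign (k + k' + m + 1) (.var 0))
    (.seq (.assign 0 (.var (k + k' + m))) (.ite (.var (k + k' + m + 1)) P P')))),
    k + k' + m + 2, fun n => S n + T n + T' n + 4 * n + 20, by fun_prop, by omega,
    fun a O σ ha => ?_⟩
  have s1 := Runs.assign (O := O) (σ := σ) (k + k' + m) (e := .var 0) ha le_rfl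
  obtain ⟨τ, s2, h2, h3, -⟩ := hQ a O (Function.update σ (k + k' + m) (enc a)) (by
    rwa [Function.update_of_ne (by omega)])
  have hk1 : τ (k + k' + m) = enc a := by rw [h3 _ (by omega)]; simp
  have s3 := Runs.assign (O := O) (k + k' + m + 1) (e := .var 0) h2 le_rfl
  have s4 := Runs.assign (O := O) (σ := Function.update τ (k + k' + m + 1) (enc (c a))) 0
    (e := .var (k + k' + m)) (d := enc a) (by simp [WExpr.eval, hk1]) le_rfl
  set υ := Function.update (Function.update τ (k + k' + m + 1) (enc (c a))) 0 (enc a) with hυ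
  have hυ0 : υ 0 = enc a := by simp [hυ]
  have hυ1 : υ (k + k' + m + 1) = enc (c a) := by simp [hυ]
  have hυ2 : ∀ x, k + k' + m + 2 ≤ x → υ x = σ x := fun x hx => by
    rw [hυ, Function.update_of_ne (by omega), Function.update_of_ne (by omega), h3 x (by omega),
      Function.update_of_ne (by omega)]
  have e1 : Function.update τ (k + k' + m + 1) (enc (c a)) (k + k' + m) = enc a := by simp [hk1]
  have e2 : (enc (c a)).size ≤ 3 := encLen_bool_le _
  have key : ∃ τ', Runs O (.ite (.var (k + k' + m + 1)) P P') υ τ'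
      (5 + T (encLen a) + T' (encLen a)) ∧ τ' 0 = enc (bif c a then f a else g a) ∧
      (∀ x, k + k' + m + 2 ≤ x → τ' x = υ x) ∧
      encLen (bif c a then f a else g a) ≤ T (encLen a) + T' (encLen a) := by
    cases hca : c a with
    | true =>
      obtain ⟨τ', s5, h2', h3', h4'⟩ := h a O υ hυ0
      refine ⟨τ', (Runs.ite_true ?_ s5).mono ?_, h2', fun x hx => h3' x (by omega), ?_⟩
      · simp [WExpr.eval, hυ1, hca, enc_true]
      · simp only [WExpr.cost, hυ1]; omega
      · simp only [cond_true]; omega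
    | false =>
      obtain ⟨τ', s5, h2', h3', h4'⟩ := h' a O υ hυ0
      refine ⟨τ', (Runs.ite_false ?_ s5).mono ?_, h2', fun x hx => h3' x (by omega), ?_⟩
      · simp [WExpr.eval, hυ1, hca, enc_false]
      · simp only [WExpr.cost, hυ1]; omega
      · simp only [cond_false]; omega
  obtain ⟨τ', s5, h2', h3', h4'⟩ := key
  refine ⟨τ', (s1.seq (s2.seq (s3.seq (s4.seq s5)))).mono ?_, h2',
    fun x hx => (h3' x hx).trans (hυ2 x hx), by dsimp; omega⟩
  simp only [WExpr.cost, ha, h2, e1, encLen]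
  omega

@[fun_prop]
theorem and {f g : α → Bool} (hf : PT f) (hg : PT g) : PT fun a => f a && g a := by
  convert hf.cond hg (const false) using 2 with a
  cases f a <;> rfl

@[fun_prop]
theorem or {f g : α → Bool} (hf : PT f) (hg : PT g) : PT fun a => f a || g a := by
  convert hf.cond (const true) hg using 2 with a
  cases f a <;> rfl

@[fun_prop]
theorem not {f : α → Bool} (hf : PT f) : PT fun a => !f a := by
  convert hf.cond (const false) (const true) using 2 with a
  cases f a <;> rfl

instance _root_.instTreeEncBinTree : TreeEnc BinTree where
  enc d := d
  inj := Function.injective_id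

theorem encode {f : α → β} (hf : PT f) : PT fun a => enc (f a) :=
  hf.recode fun _ => rfl

@[fun_prop]
theorem isEmpty {l : α → List β} (hl : PT l) : PT fun a => (l a).isEmpty := by
  convert hl.encode.decide_eq (const (.nil : BinTree)) using 2 with a
  cases l a <;> simp [enc, BinTree.ofList]

@[fun_prop]
theorem headD {l : α → List β} {d : α → β} (hl : PT l) (hd : PT d) :
    PT fun a => (l a).headD (d a) := by
  have h : PT fun t : BinTree => t.hd :=
    of_expr (.hd (.var 0)) (T := fun n => 2 + 2 * n) (by fun_prop)
      (fun t σ h => by simp [WExpr.eval, h, enc])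
      (fun t σ h => by
        have := t.size_hd_le
        simp only [WExpr.cost, WExpr.eval, h, encLen, enc]; omega)
      (fun t => by have := t.size_hd_le; simp only [encLen, enc]; omega)
  refine (hl.isEmpty.cond hd.encode (h.comp hl.encode)).recode fun a => ?_
  cases l a <;> rfl

@[fun_prop]
theorem tail {l : α → List β} (hl : PT l) : PT fun a => (l a).tail := by
  have h : PT fun t : BinTree => t.tl :=
    of_expr (.tl (.var 0)) (T := fun n => 2 + 2 * n) (by fun_prop)
      (fun t σ h => by simp [WExpr.eval, h, enc])
      (fun t σ h => by
        have := t.size_tl_le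
        simp only [WExpr.cost, WExpr.eval, h, encLen, enc]; omega)
      (fun t => by have := t.size_tl_le; simp only [encLen, enc]; omega)
  refine (h.comp hl.encode).recode fun a => ?_
  cases l a <;> rfl

/-- The loop over a list, with the environment in the variable `K`, the remaining list in the
variable `K + 1` and the accumulator in the variable `K + 2`. -/
theorem runs_foldl {O : BinTree → BinTree} {h : α → γ → β → γ} {P : WProg} {k : ℕ} {T : ℕ → ℕ}
    (hP : Computes P k T fun x : α × γ × β => h x.1 x.2.1 x.2.2) (hT : Monotone T) {K : ℕ}
    (hK : 1 ≤ K) (hkK : k ≤ K) (a : α) (l : List β) (g : γ) {B : ℕ} (hlB : encLen l ≤ B)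
    (hB : ∀ l', l' <+: l → encLen (l'.foldl (h a) g) ≤ B) (σ : Store) (ha : σ K = enc a)
    (hl : σ (K + 1) = enc l) (hg : σ (K + 2) = enc g) : ∃ τ,
    Runs O (.loop (.var (K + 1)) (.seq (.assign 0 (.cons (.var K) (.cons (.var (K + 2))
      (.hd (.var (K + 1)))))) (.seq P (.seq (.assign (K + 2) (.var 0))
      (.assign (K + 1) (.tl (.var (K + 1))))))))
      σ τ (2 + B + l.length * (3 * encLen a + 20 * B + 30 + 2 * T (2 + encLen a + 2 * B))) ∧
    τ (K + 2) = enc (l.foldl (h a) g) ∧ ∀ x, K + 3 ≤ x → τ x = σ x := by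
  induction l generalizing g σ with
  | nil =>
    refine ⟨σ, (Runs.loop_done (by simp [WExpr.eval, hl, enc_nil])).mono ?_, hg, fun _ _ => rfl⟩
    have : (enc ([] : List β)).size = 1 := rfl
    simp only [WExpr.cost, hl, this]
    simp only [encLen_nil] at hlB
    omega
  | cons b l ih =>
    have hg' : (enc g).size ≤ B := hB [] (by simp)
    have hl' : (enc b).size + (enc l).size + 1 ≤ B := by
      rw [encLen_cons] at hlB; simp only [encLen] at hlB; omega
    have hx : encLen (a, g, b) ≤ 2 + encLen a + 2 * B := by
      rw [encLen_pair, encLen_pair]; simp only [encLen]; omega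
    have s1 := Runs.assign (O := O) (σ := σ) 0
      (e := .cons (.var K) (.cons (.var (K + 2)) (.hd (.var (K + 1))))) (d := enc (a, g, b))
      (by simp [WExpr.eval, ha, hl, hg, enc_pair, enc_cons, BinTree.hd]) le_rfl
    obtain ⟨τ, s2, h2, h3, h4⟩ := hP (a, g, b) O _ (Function.update_self 0 (enc (a, g, b)) σ)
    have s3 := Runs.assign (O := O) (K + 2) (e := .var 0) h2 le_rfl
    have e1 : Function.update τ (K + 2) (enc (h a g b)) (K + 1) = enc (b :: l) := by
      rw [Function.update_of_ne (by omega), h3 _ (by omega), Function.update_of_ne (by omega), hl]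
    have s4 := Runs.assign (O := O) (σ := Function.update τ (K + 2) (enc (h a g b))) (K + 1)
      (e := .tl (.var (K + 1))) (d := enc l)
      (by simp only [WExpr.eval, e1, enc_cons, BinTree.tl]) le_rfl
    obtain ⟨υ, s5, h5, h6⟩ := ih (h a g b) (by rw [encLen_cons] at hlB; omega) (fun l' hl' => by
        simpa using hB (b :: l') (by simpa using hl'))
      (Function.update (Function.update τ (K + 2) (enc (h a g b))) (K + 1) (enc l))
      (by rw [Function.update_of_ne (by omega), Function.update_of_ne (by omega), h3 _ hkK,
        Function.update_of_ne (by omega), ha])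
      (by simp) (by simp)
    refine ⟨υ, (Runs.loop_step ?_ (s1.seq (s2.seq (s3.seq s4))) s5).mono ?_, h5, fun x hx => ?_⟩
    · simp [WExpr.eval, hl, enc_cons]
    · have e2 : (enc (h a g b)).size ≤ T (encLen (a, g, b)) := h4
      have := hT hx
      have e3 : (enc (b :: l)).size = 1 + (enc b).size + (enc l).size := rfl
      have e4 : (enc l).size ≤ B := by omega
      simp only [WExpr.cost, WExpr.eval, ha, hl, hg, h2, e1, encLen, List.length_cons, add_mul,
        one_mul, BinTree.size, enc_cons, BinTree.hd, BinTree.tl] at *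
      omega
    · rw [h6 x hx, Function.update_of_ne (by omega), Function.update_of_ne (by omega),
        h3 x (by omega), Function.update_of_ne (by omega)]

/-- A loop over a list is computed in polynomial time if its intermediate results are bounded. -/
theorem foldl {l : α → List β} {g : α → γ} {h : α → γ → β → γ} (hl : PT l) (hg : PT g)
    (hh : PT fun x : α × γ × β => h x.1 x.2.1 x.2.2) {B : ℕ → ℕ} (hB : IsNatPoly B)
    (hle : ∀ a l', l' <+: l a → encLen (l'.foldl (h a) (g a)) ≤ B (encLen a)) :
    PT fun a => (l a).foldl (h a) (g a) := by
  obtain ⟨P, k, T, hT, hk, hP⟩ := hh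
  obtain ⟨Q, m, S, hS, hm, hQ⟩ := hl.pair hg
  refine ⟨.seq (.assign (k + m) (.var 0)) (.seq Q (.seq (.assign (k + m + 1) (.hd (.var 0)))
    (.seq (.assign (k + m + 2) (.tl (.var 0))) (.seq (.loop (.var (k + m + 1)) (.seq (.assign 0
      (.cons (.var (k + m)) (.cons (.var (k + m + 2)) (.hd (.var (k + m + 1)))))) (.seq P
      (.seq (.assign (k + m + 2) (.var 0)) (.assign (k + m + 1) (.tl (.var (k + m + 1))))))))
      (.assign 0 (.var (k + m + 2))))))), k + m + 3,
    fun n => 2 + (B n + S n) + S n * (3 * n + 20 * (B n + S n) + 30 + 2 * T (2 + n + 2 * (B n + S n)))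
      + 20 + 2 * n + 10 * S n + 2 * B n, by fun_prop, by omega, fun a O σ ha => ?_⟩
  have s1 := Runs.assign (O := O) (σ := σ) (k + m) (e := .var 0) ha le_rfl
  obtain ⟨τ, s2, h2, h3, h4⟩ := hQ a O (Function.update σ (k + m) (enc a)) (by
    rwa [Function.update_of_ne (by omega)])
  have hk1 : τ (k + m) = enc a := by rw [h3 _ (by omega)]; simp
  have s3 := Runs.assign (O := O) (k + m + 1) (σ := τ) (e := .hd (.var 0)) (d := enc (l a))
    (by simp [WExpr.eval, h2, enc_pair, BinTree.hd]) le_rfl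
  have e1 : Function.update τ (k + m + 1) (enc (l a)) 0 = enc (l a, g a) := by simp [h2]
  have s4 := Runs.assign (O := O) (σ := Function.update τ (k + m + 1) (enc (l a))) (k + m + 2)
    (e := .tl (.var 0)) (d := enc (g a)) (by simp [WExpr.eval, h2, enc_pair, BinTree.tl]) le_rfl
  rw [encLen_pair] at h4
  -- The sum `B + S` bounds both the remaining list and every intermediate accumulator.
  obtain ⟨υ, s5, h5, h6⟩ := runs_foldl (O := O) hP hT.mono (K := k + m) (by omega) (by omega)
    a (l a) (g a) (B := B (encLen a) + S (encLen a)) (by omega)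
    (fun l' hl' => (hle a l' hl').trans (by omega)) (Function.update (Function.update τ (k + m + 1)
      (enc (l a))) (k + m + 2) (enc (g a))) (by simp [hk1]) (by simp) (by simp)
  have s6 := Runs.assign (O := O) (σ := υ) 0 (e := .var (k + m + 2)) h5 le_rfl
  have e2 := hle a (l a) List.prefix_rfl
  refine ⟨_, (s1.seq (s2.seq (s3.seq (s4.seq (s5.seq s6))))).mono ?_, by simp, fun x hx => ?_, ?_⟩
  · have e3 : (l a).length ≤ S (encLen a) := (length_le_encLen _).trans (by omega)
    have e4 := Nat.mul_le_mul_right (3 * encLen a + 20 * (B (encLen a) + S (encLen a)) + 30 +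
      2 * T (2 + encLen a + 2 * (B (encLen a) + S (encLen a)))) e3
    simp only [WExpr.cost, WExpr.eval, ha, h2, h5, e1, enc_pair, BinTree.hd, BinTree.tl,
      BinTree.size]
    simp only [encLen] at *
    omega
  · rw [Function.update_of_ne (by omega), h6 x (by omega), Function.update_of_ne (by omega),
      Function.update_of_ne (by omega), h3 x (by omega), Function.update_of_ne (by omega)]
  · dsimp; omega

end

end PT

/-! ### Polynomial time: list operations and unary arithmetic -/

namespace PT

section

variable {α β γ δ ι : Type} [TreeEnc α] [TreeEnc β] [TreeEnc γ] [TreeEnc δ] [TreeEnc ι]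

theorem _root_.encLen_prefix_le {l l' : List α} (h : l' <+: l) : encLen l' ≤ encLen l := by
  obtain ⟨t, rfl⟩ := h
  have := encLen_append l' t
  have := one_le_encLen t
  omega

@[fun_prop]
theorem reverse {l : α → List β} (hl : PT l) : PT fun a => (l a).reverse := by
  obtain ⟨S, hS, hSl⟩ := hl.encLen_le
  have : PT fun a => (l a).foldl (fun acc b => b :: acc) [] :=
    foldl (h := fun _ acc b => b :: acc) hl (const []) (by fun_prop) hS fun a l' h => by
      simp only [List.foldl_flip_cons_eq_append', List.append_nil, encLen_reverse]
      exact (encLen_prefix_le h).trans (hSl a)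
  simpa [List.foldl_flip_cons_eq_append'] using this

@[fun_prop]
theorem map {l : α → List β} {h : α → β → γ} (hl : PT l) (hh : PT fun x : α × β => h x.1 x.2) :
    PT fun a => (l a).map (h a) := by
  obtain ⟨S, hS, hSl⟩ := hl.encLen_le
  obtain ⟨T, hT, hTh⟩ := hh.encLen_le
  -- The loop can only push to the front and thus builds the result in reverse order; a final
  -- reversal repairs this.
  have e : ∀ a l', List.foldl (fun acc b => h a b :: acc) [] l' = (l'.map (h a)).reverse := by
    intro a l'
    rw [← List.foldl_map (f := h a) (g := fun acc c => c :: acc)]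
    simp
  have : PT fun a => (l a).foldl (fun acc b => h a b :: acc) [] := by
    refine foldl (h := fun a acc b => h a b :: acc) hl (const [])
      ((hh.comp (fst id' |>.pair (snd (snd id')))).cons (by fun_prop))
      (B := fun n => 1 + S n * (T (1 + n + S n) + 1)) (by fun_prop) fun a l' h' => ?_
    rw [e, encLen_reverse]
    refine encLen_list_le' (fun c hc => ?_) ?_
    · obtain ⟨b, hb, rfl⟩ := List.mem_map.1 hc
      refine (hTh (a, b)).trans (hT.mono ?_)
      have := encLen_le_of_mem (h'.subset hb)
      have := hSl a
      rw [encLen_pair]; omega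
    · rw [List.length_map]
      exact h'.length_le.trans ((length_le_encLen _).trans (hSl a))
  simpa [e] using this.reverse

@[fun_prop]
theorem filter {l : α → List β} {h : α → β → Bool} (hl : PT l)
    (hh : PT fun x : α × β => h x.1 x.2) : PT fun a => (l a).filter (h a) := by
  obtain ⟨S, hS, hSl⟩ := hl.encLen_le
  have e : ∀ a l', List.foldl (fun acc b => bif h a b then b :: acc else acc) [] l' =
      (l'.filter (h a)).reverse := by
    intro a l'
    induction l' using List.reverseRecOn with
    | nil => rfl
    | append_singleton l b ih => cases h' : h a b <;> simp [ih, h']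
  have : PT fun a => (l a).foldl (fun acc b => bif h a b then b :: acc else acc) [] := by
    refine foldl (h := fun a acc b => bif h a b then b :: acc else acc) hl (const [])
      ((hh.comp (fst id' |>.pair (snd (snd id')))).cond (by fun_prop) (by fun_prop))
      (B := fun n => 1 + S n * (S n + 1)) (by fun_prop) fun a l' h' => ?_
    rw [e, encLen_reverse]
    refine encLen_list_le' (fun c hc => ?_) ?_
    · exact (encLen_le_of_mem (h'.subset (List.mem_filter.1 hc).1)).trans (hSl a)
    · exact (List.length_filter_le _ _).trans
        (h'.length_le.trans ((length_le_encLen _).trans (hSl a)))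
  simpa [e] using this.reverse

@[fun_prop]
theorem any {l : α → List β} {h : α → β → Bool} (hl : PT l)
    (hh : PT fun x : α × β => h x.1 x.2) : PT fun a => (l a).any (h a) := by
  have e : ∀ a (l' : List β) c, List.foldl (fun acc b => acc || h a b) c l' = (c || l'.any (h a)) := by
    intro a l'
    induction l' with
    | nil => simp
    | cons b l ih => intro c; simp [ih, Bool.or_assoc]
  have : PT fun a => (l a).foldl (fun acc b => acc || h a b) false :=
    foldl (h := fun a acc b => acc || h a b) hl (const false)
      (or (by fun_prop) (hh.comp (fst id' |>.pair (snd (snd id')))))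
      (B := fun _ => 3) (by fun_prop) fun a l' h' => encLen_bool_le _
  simpa [e] using this

@[fun_prop]
theorem all {l : α → List β} {h : α → β → Bool} (hl : PT l)
    (hh : PT fun x : α × β => h x.1 x.2) : PT fun a => (l a).all (h a) := by
  have := (hl.any (h := fun a b => !h a b) hh.not).not
  simpa [List.not_any_eq_all_not] using this

@[fun_prop]
theorem append {l l' : α → List β} (hl : PT l) (hl' : PT l') : PT fun a => l a ++ l' a := by
  obtain ⟨S, hS, hSl⟩ := hl.encLen_le
  obtain ⟨T, hT, hTl⟩ := hl'.encLen_le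
  have : PT fun a => (l a).reverse.foldl (fun acc b => b :: acc) (l' a) := by
    refine foldl (h := fun _ acc b => b :: acc) hl.reverse hl' (by fun_prop)
      (B := fun n => S n + T n) (by fun_prop) fun a m h => ?_
    rw [List.foldl_flip_cons_eq_append']
    have := encLen_append m.reverse (l' a)
    have := encLen_prefix_le h
    rw [encLen_reverse] at *
    have := hSl a
    have := hTl a
    omega
  simpa [List.foldl_flip_cons_eq_append'] using this

@[fun_prop]
theorem flatMap {l : α → List β} {h : α → β → List γ} (hl : PT l)
    (hh : PT fun x : α × β => h x.1 x.2) : PT fun a => (l a).flatMap (h a) := by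
  obtain ⟨S, hS, hSl⟩ := hl.encLen_le
  obtain ⟨T, hT, hTh⟩ := hh.encLen_le
  have e : ∀ a (l' : List β) c, List.foldl (fun acc b => acc ++ h a b) c l' =
      c ++ l'.flatMap (h a) := by
    intro a l'
    induction l' with
    | nil => simp
    | cons b l ih => intro c; simp [ih]
  have e' : ∀ a (l' : List β) M, (∀ b ∈ l', encLen (h a b) ≤ M) →
      encLen (l'.flatMap (h a)) ≤ 1 + l'.length * M := by
    intro a l' M hM
    induction l' with
    | nil => simp [encLen_nil]
    | cons b l ih =>
      have := encLen_append (h a b) (l.flatMap (h a))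
      have := hM b List.mem_cons_self
      have := ih fun b hb => hM b (List.mem_cons_of_mem _ hb)
      rw [List.flatMap_cons, List.length_cons, add_mul]
      omega
  have : PT fun a => (l a).foldl (fun acc b => acc ++ h a b) [] := by
    refine foldl (h := fun a acc b => acc ++ h a b) hl (const [])
      (append (by fun_prop) (hh.comp (fst id' |>.pair (snd (snd id')))))
      (B := fun n => 1 + S n * T (1 + n + S n)) (by fun_prop) fun a l' h' => ?_
    rw [e, List.nil_append]
    refine (e' a l' (T (1 + encLen a + S (encLen a))) fun b hb => ?_).trans ?_
    · refine (hTh (a, b)).trans (hT.mono ?_)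
      have := encLen_le_of_mem (h'.subset hb)
      have := hSl a
      rw [encLen_pair]; omega
    · gcongr
      exact h'.length_le.trans ((length_le_encLen _).trans (hSl a))
  simpa [e] using this

-- Replacing all entries by `()` already yields the unary encoding of the length.
@[fun_prop]
theorem length {l : α → List β} (hl : PT l) : PT fun a => (l a).length :=
  (hl.map (h := fun _ _ => ()) (const ())).recode fun a => by
    rw [← enc_unit_list]; simp

theorem replicate_unit {n : α → ℕ} (hn : PT n) : PT fun a => List.replicate (n a) () :=
  hn.recode fun _ => enc_unit_list _

theorem iterate {n : α → ℕ} {g : α → γ} {h : α → γ → γ} (hn : PT n) (hg : PT g)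
    (hh : PT fun x : α × γ => h x.1 x.2) {B : ℕ → ℕ} (hB : IsNatPoly B)
    (hle : ∀ a i, i ≤ n a → encLen ((h a)^[i] (g a)) ≤ B (encLen a)) :
    PT fun a => (h a)^[n a] (g a) := by
  have e : ∀ a (l : List Unit) c, l.foldl (fun acc _ => h a acc) c = (h a)^[l.length] c := by
    intro a l
    induction l with
    | nil => simp
    | cons b l ih => intro c; simp [ih]
  have : PT fun a => (List.replicate (n a) ()).foldl (fun acc _ => h a acc) (g a) := by
    refine foldl (h := fun a acc _ => h a acc) hn.replicate_unit hg
      (hh.comp (fst id' |>.pair (fst (snd id')))) hB fun a l' h' => ?_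
    rw [e]
    exact hle a _ (by simpa using h'.length_le)
  simpa [e] using this

@[fun_prop]
theorem range {n : α → ℕ} (hn : PT n) : PT fun a => List.range (n a) := by
  obtain ⟨S, hS, hSn⟩ := hn.encLen_le
  have e : ∀ m, (fun acc : List ℕ => acc.length :: acc)^[m] [] = (List.range m).reverse := by
    intro m
    induction m with
    | zero => rfl
    | succ m ih => rw [Function.iterate_succ_apply', ih]; simp [List.range_succ]
  have : PT fun a => (fun acc : List ℕ => acc.length :: acc)^[n a] [] := by
    refine iterate (h := fun _ acc => acc.length :: acc) hn (const []) (by fun_prop)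
      (B := fun m => 1 + S m * (S m + 1)) (by fun_prop) fun a i hi => ?_
    have h1 := hSn a
    rw [encLen_nat] at h1
    rw [e, encLen_reverse]
    refine encLen_list_le' (fun c hc => ?_) (by simp; omega)
    have := List.mem_range.1 hc
    rw [encLen_nat]; omega
  simpa [e] using this.reverse

theorem succ {n : α → ℕ} (hn : PT n) : PT fun a => n a + 1 :=
  ((const ()).cons hn.replicate_unit).recode fun a => by
    rw [← enc_unit_list, List.replicate_succ]

theorem pred {n : α → ℕ} (hn : PT n) : PT fun a => n a - 1 :=
  hn.replicate_unit.tail.recode fun a => by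
    rw [← enc_unit_list, List.tail_replicate]

@[fun_prop]
theorem add {m n : α → ℕ} (hm : PT m) (hn : PT n) : PT fun a => m a + n a := by
  obtain ⟨S, hS, hSm⟩ := hm.encLen_le
  obtain ⟨T, hT, hTn⟩ := hn.encLen_le
  have e : ∀ a i, (fun x : ℕ => x + 1)^[i] (m a) = m a + i := fun a i => by simp
  have := iterate (h := fun (_ : α) (x : ℕ) => x + 1) hn hm (succ (snd id'))
    (B := fun n => S n + T n) (by fun_prop) fun a i hi => by
      have := hSm a
      have := hTn a
      rw [encLen_nat] at *
      rw [e]; omega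
  simpa [e] using this

@[fun_prop]
theorem sub {m n : α → ℕ} (hm : PT m) (hn : PT n) : PT fun a => m a - n a := by
  obtain ⟨S, hS, hSm⟩ := hm.encLen_le
  have e : ∀ a i, (fun x : ℕ => x - 1)^[i] (m a) = m a - i := fun a i => by
    induction i with
    | zero => rfl
    | succ i ih => rw [Function.iterate_succ_apply', ih, Nat.sub_sub]
  have := iterate (h := fun (_ : α) (x : ℕ) => x - 1) hn hm (pred (snd id'))
    (B := S) (by fun_prop) fun a i hi => by
      have := hSm a
      rw [encLen_nat] at *
      rw [e]; omega
  simpa [e] using this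

@[fun_prop]
theorem mul {m n : α → ℕ} (hm : PT m) (hn : PT n) : PT fun a => m a * n a := by
  obtain ⟨S, hS, hSm⟩ := hm.encLen_le
  obtain ⟨T, hT, hTn⟩ := hn.encLen_le
  have e : ∀ a i, (fun x : ℕ => x + m a)^[i] 0 = m a * i := fun a i => by
    induction i with
    | zero => rfl
    | succ i ih => rw [Function.iterate_succ_apply', ih, mul_add_one]
  have := iterate (h := fun (a : α) (x : ℕ) => x + m a) hn (const 0) (by fun_prop)
    (B := fun n => 2 * (S n * T n) + 1) (by fun_prop) fun a i hi => by
      have h1 := hSm a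
      have h2 := hTn a
      rw [encLen_nat] at *
      rw [e]
      gcongr <;> omega
  simpa [e] using this

@[fun_prop]
theorem decide_le {m n : α → ℕ} [∀ a, Decidable (m a ≤ n a)] (hm : PT m) (hn : PT n) :
    PT fun a => decide (m a ≤ n a) := by
  simpa [Nat.sub_eq_zero_iff_le] using (hm.sub hn).decide_eq (const 0)

@[fun_prop]
theorem decide_lt {m n : α → ℕ} [∀ a, Decidable (m a < n a)] (hm : PT m) (hn : PT n) :
    PT fun a => decide (m a < n a) := by
  simpa [Nat.succ_le_iff] using decide_le (hm.add (const 1)) hn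

-- Indexing is `tail`, iterated, followed by `headD`; every intermediate list is a suffix and hence
-- no larger.
@[fun_prop]
theorem getD {l : α → List β} {i : α → ℕ} {d : α → β} (hl : PT l) (hi : PT i) (hd : PT d) :
    PT fun a => (l a).getD (i a) (d a) := by
  obtain ⟨S, hS, hSl⟩ := hl.encLen_le
  have e : ∀ a i, List.tail^[i] (l a) = (l a).drop i := fun a i => by
    induction i with
    | zero => rfl
    | succ i ih => rw [Function.iterate_succ_apply', ih, List.tail_drop]
  have := iterate (h := fun (_ : α) (m : List β) => m.tail) hi hl (by fun_prop) hS fun a i _ => by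
    refine le_trans ?_ (hSl a)
    have := encLen_append ((l a).take i) ((l a).drop i)
    have h := one_le_encLen ((l a).take i)
    rw [List.take_append_drop] at this
    change encLen (List.tail^[i] (l a)) ≤ _
    rw [e]; omega
  refine (this.headD hd).recode fun a => ?_
  change enc _ = enc ((List.tail^[i a] (l a)).headD _)
  rw [e, List.headD_eq_head?_getD, List.head?_drop, List.getD_eq_getElem?_getD]

end

end PT

/-! ### The algorithm: crown reduction by an auction -/

section Algorithm

/-- A matrix of truth values, as the list of its rows. -/
abbrev BoolMatrix : Type := List (List Bool)

def bit (W : List Bool) (i : ℕ) : Bool := W.getD i false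

def entry (M : BoolMatrix) (i j : ℕ) : Bool := bit (M.getD i []) j

/-- The vector with the entries `f 0, …, f (n - 1)`. -/
def tabulate {β : Type} (n : ℕ) (f : ℕ → β) : List β := (List.range n).map f

/-- Adjacency in the subgraph induced by `W`. -/
def adjIn (M : BoolMatrix) (W : List Bool) (u v : ℕ) : Bool := bit W u && (bit W v && entry M u v)

/-- The bids for `v`, the latest one first. -/
def bidsFor (log : List (ℕ × ℕ)) (v : ℕ) : List (ℕ × ℕ) := log.filter fun b => decide (b.2 = v)

/-- The price of a vertex is the number of bids for it. -/
def price (log : List (ℕ × ℕ)) (v : ℕ) : ℕ := (bidsFor log v).length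

/-- A vertex is held by the one that made the latest bid for it. -/
def holds (log : List (ℕ × ℕ)) (u v : ℕ) : Bool :=
  -- The default `(u + 1, v)` differs from `(u, v)`, so nobody holds a vertex without bids.
  decide ((bidsFor log v).headD (u + 1, v) = (u, v))

/-- The vertices that hold nothing. -/
def isFree (n : ℕ) (log : List (ℕ × ℕ)) (u : ℕ) : Bool :=
  (List.range n).all fun v => !holds log u v

/-- A free vertex may bid for a neighbour that is cheapest, up to the price `n + 1`. -/
def canBid (M : BoolMatrix) (W : List Bool) (log : List (ℕ × ℕ)) (u v : ℕ) : Bool :=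
  -- Bidding stops only at the price `n + 2`, which lies above every gap that `priceGap` can find.
  adjIn M W u v && (isFree M.length log u && (decide (price log v < M.length + 2) &&
    (List.range M.length).all fun w => !adjIn M W u w || decide (price log v ≤ price log w)))

def possibleBids (M : BoolMatrix) (W : List Bool) (log : List (ℕ × ℕ)) : List (ℕ × ℕ) :=
  (List.range M.length).flatMap fun u =>
    ((List.range M.length).filter fun v => canBid M W log u v).map fun v => (u, v)

def bidStep (M : BoolMatrix) (W : List Bool) (log : List (ℕ × ℕ)) : List (ℕ × ℕ) :=
  bif (possibleBids M W log).isEmpty then log else (possibleBids M W log).headD (0, 0) :: log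

def auction (M : BoolMatrix) (W : List Bool) : List (ℕ × ℕ) :=
  -- This is one round more than there can be bids, so some round finds no bid.
  (bidStep M W)^[M.length * (M.length + 2) + 1] []

/-- A positive number that is not a price. -/
def priceGap (n : ℕ) (log : List (ℕ × ℕ)) : ℕ :=
  ((List.range (n + 2)).filter fun h => decide (1 ≤ h) &&
    (List.range n).all fun v => !decide (price log v = h)).headD 1

/-- The expensive vertices. -/
def inHead (n : ℕ) (log : List (ℕ × ℕ)) (v : ℕ) : Bool := decide (priceGap n log < price log v)

/-- The vertices that are free or hold an expensive one. -/
def inCrown (n : ℕ) (log : List (ℕ × ℕ)) (u : ℕ) : Bool :=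
  isFree n log u || (List.range n).any fun v => holds log u v && inHead n log v

/-- The vertices that the reduction puts into the cover. -/
def takenVertices (M : BoolMatrix) (W : List Bool) : List ℕ :=
  (List.range M.length).filter fun v =>
    inHead M.length (auction M W) v && !inCrown M.length (auction M W) v

/-- The vertices that remain after the reduction. -/
def restVertices (M : BoolMatrix) (W : List Bool) : List ℕ :=
  (List.range M.length).filter fun v =>
    decide (inHead M.length (auction M W) v = inCrown M.length (auction M W) v)

/-- Twice the value of the half-integral solution of the linear program. -/
def reductionWeight (M : BoolMatrix) (W : List Bool) : ℕ :=
  2 * (takenVertices M W).length + (restVertices M W).length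

/-! ### The algorithm: splitting along the tree -/

/-- The tree nodes that are left, their vertex sets, and the pieces that were cut off, each one with
a set of vertices that separates it from the rest. -/
abbrev SplitState : Type := List Bool × BoolMatrix × List (List Bool × List Bool)

/-- Among the nodes that are left, `t` has no other neighbour than `s`. -/
def isEar (T : BoolMatrix) (alive : List Bool) (t s : ℕ) : Bool :=
  bit alive t && (bit alive s && (!decide (t = s) && (List.range T.length).all fun r =>
    !(bit alive r && entry T t r) || decide (r = s)))

def ears (T : BoolMatrix) (alive : List Bool) : List (ℕ × ℕ) :=
  (List.range T.length).flatMap fun t =>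
    ((List.range T.length).filter fun s => isEar T alive t s).map fun s => (t, s)

def joinParts (n : ℕ) (parts : BoolMatrix) (t s : ℕ) : List Bool :=
  tabulate n fun v => entry parts t v || entry parts s v

def bagSize (n : ℕ) (B : BoolMatrix) (s : ℕ) : ℕ :=
  ((List.range n).filter fun v => entry B s v).length

def removeNode (N : ℕ) (alive : List Bool) (t : ℕ) : List Bool :=
  tabulate N fun r => bit alive r && !decide (r = t)

/-- The node `t` is merged into `s`; if the result has large covers, it is cut off. -/
def absorb (K : ℕ) (M T B : BoolMatrix) (st : SplitState) (t s : ℕ) : SplitState :=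
  -- Every cover spends at least half of the weight inside the joined part, which then pays `K`
  -- times for the bag.
  bif decide (2 * K * bagSize M.length B s <
      reductionWeight M (joinParts M.length st.2.1 t s)) then
    (removeNode T.length st.1 t,
      -- The bag of `s` goes into the cover, so its vertices can also be deleted from all other
      -- parts.
      tabulate T.length (fun r => tabulate M.length fun v => entry st.2.1 r v &&
        !(bit (joinParts M.length st.2.1 t s) v || entry B s v)),
      (B.getD s [], joinParts M.length st.2.1 t s) :: st.2.2)
  else
    (removeNode T.length st.1 t,
      tabulate T.length (fun r => tabulate M.length fun v => bif decide (r = s) then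
        bit (joinParts M.length st.2.1 t s) v else entry st.2.1 r v), st.2.2)

def splitStep (K : ℕ) (M T B : BoolMatrix) (st : SplitState) : SplitState :=
  bif (ears T st.1).isEmpty then st
  else absorb K M T B st ((ears T st.1).headD (0, 0)).1 ((ears T st.1).headD (0, 0)).2

def splitInit (M T B : BoolMatrix) : SplitState :=
  (tabulate T.length fun _ => true,
    tabulate T.length (fun t => tabulate M.length fun v => entry B t v), [])

def splitState (K : ℕ) (M T B : BoolMatrix) : SplitState :=
  (splitStep K M T B)^[T.length] (splitInit M T B)

/-- The pieces, including those that are left at the end. -/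
def pieces (K : ℕ) (M T B : BoolMatrix) : List (List Bool × List Bool) :=
  (splitState K M T B).2.2 ++ ((List.range T.length).filter fun t =>
    bit (splitState K M T B).1 t).map fun t => ([], (splitState K M T B).2.1.getD t [])

/-! ### The algorithm: queries and output -/

/-- The subgraph induced by the vertices in `R`, with a tree decomposition of one bag. -/
def makeQuery (M : BoolMatrix) (R : List ℕ) : BoolMatrix × BoolMatrix × BoolMatrix :=
  (R.map fun u => R.map fun v => entry M u v, [[false]], [R.map fun _ => true])

/-- A query, vertices that are put into the cover, and the vertices that the query is about. -/
abbrev QueryItem : Type := (BoolMatrix × BoolMatrix × BoolMatrix) × List ℕ × List ℕ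

def makeItem (M : BoolMatrix) (x : List Bool × List Bool) : QueryItem :=
  (makeQuery M (restVertices M x.2),
    ((List.range M.length).filter fun v => bit x.1 v) ++ takenVertices M x.2,
    restVertices M x.2)

def queryItems (K : ℕ) (I : BoolMatrix × BoolMatrix × BoolMatrix) : List QueryItem :=
  (pieces K I.1 I.2.1 I.2.2).map fun x => makeItem I.1 x

def coveredBy (x : QueryItem × List Bool) (v : ℕ) : Bool :=
  (x.1.2.1.any fun u => decide (u = v)) || (List.range x.1.2.2.length).any fun j =>
    decide (x.1.2.2.getD j 0 = v) && bit x.2 j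

/-- The characteristic vector of the cover that is composed of the answers. -/
def composeCover (I : BoolMatrix × BoolMatrix × BoolMatrix) (l : List (QueryItem × List Bool)) :
    List Bool :=
  tabulate I.1.length fun v => l.any fun x => coveredBy x v

end Algorithm

/-! ### The algorithm runs in polynomial time -/

namespace PT

section

variable {α β γ : Type} [TreeEnc α] [TreeEnc β] [TreeEnc γ]
  {M T B : α → BoolMatrix} {W : α → List Bool} {log : α → List (ℕ × ℕ)} {n i j : α → ℕ}

@[fun_prop]
theorem bit (hW : PT W) (hi : PT i) : PT fun a => bit (W a) (i a) := by
  unfold _root_.bit; fun_prop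

@[fun_prop]
theorem entry (hM : PT M) (hi : PT i) (hj : PT j) : PT fun a => entry (M a) (i a) (j a) := by
  unfold _root_.entry; fun_prop

@[fun_prop]
theorem tabulate {f : α → ℕ → β} (hn : PT n) (hf : PT fun x : α × ℕ => f x.1 x.2) :
    PT fun a => tabulate (n a) (f a) := by
  unfold _root_.tabulate; fun_prop

@[fun_prop]
theorem adjIn (hM : PT M) (hW : PT W) (hi : PT i) (hj : PT j) :
    PT fun a => adjIn (M a) (W a) (i a) (j a) := by
  unfold _root_.adjIn; fun_prop

@[fun_prop]
theorem bidsFor (hl : PT log) (hi : PT i) : PT fun a => bidsFor (log a) (i a) := by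
  unfold _root_.bidsFor; fun_prop

@[fun_prop]
theorem price (hl : PT log) (hi : PT i) : PT fun a => price (log a) (i a) := by
  unfold _root_.price; fun_prop

@[fun_prop]
theorem holds (hl : PT log) (hi : PT i) (hj : PT j) : PT fun a => holds (log a) (i a) (j a) := by
  unfold _root_.holds; fun_prop

@[fun_prop]
theorem isFree (hn : PT n) (hl : PT log) (hi : PT i) :
    PT fun a => isFree (n a) (log a) (i a) := by
  unfold _root_.isFree; fun_prop

@[fun_prop]
theorem canBid (hM : PT M) (hW : PT W) (hl : PT log) (hi : PT i) (hj : PT j) :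
    PT fun a => canBid (M a) (W a) (log a) (i a) (j a) := by
  unfold _root_.canBid; fun_prop

@[fun_prop]
theorem possibleBids (hM : PT M) (hW : PT W) (hl : PT log) :
    PT fun a => possibleBids (M a) (W a) (log a) := by
  unfold _root_.possibleBids; fun_prop

@[fun_prop]
theorem bidStep (hM : PT M) (hW : PT W) (hl : PT log) :
    PT fun a => bidStep (M a) (W a) (log a) := by
  unfold _root_.bidStep; fun_prop

end

end PT

/-! ### Single rounds of the auction and of the splitting, with size bounds -/

theorem mem_possibleBids {M : BoolMatrix} {W : List Bool} {log : List (ℕ × ℕ)} {b : ℕ × ℕ} :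
    b ∈ possibleBids M W log ↔ b.1 < M.length ∧ b.2 < M.length ∧ canBid M W log b.1 b.2 := by
  obtain ⟨u, v⟩ := b
  simp [possibleBids, and_assoc]

theorem bidStep_cases (M : BoolMatrix) (W : List Bool) (log : List (ℕ × ℕ)) :
    (bidStep M W log = log ∧ ∀ u < M.length, ∀ v < M.length, canBid M W log u v = false) ∨
    ∃ u v, u < M.length ∧ v < M.length ∧ canBid M W log u v ∧ bidStep M W log = (u, v) :: log := by
  cases h : possibleBids M W log with
  | nil =>
    left
    refine ⟨by simp [bidStep, h], fun u hu v hv => ?_⟩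
    by_contra hc
    have := (mem_possibleBids (b := (u, v))).2 ⟨hu, hv, by simpa using hc⟩
    simp [h] at this
  | cons b l =>
    right
    have := (mem_possibleBids (b := b) (M := M) (W := W) (log := log)).1 (by simp [h])
    exact ⟨b.1, b.2, this.1, this.2.1, this.2.2, by simp [bidStep, h]⟩

/-- Bounds the logs for `PT.iterate`, which has to work for arbitrary matrices and not only for
those of graphs. -/
theorem bidStep_iterate_bounds (M : BoolMatrix) (W : List Bool) (i : ℕ) :
    ((bidStep M W)^[i] []).length ≤ i ∧
    ∀ b ∈ (bidStep M W)^[i] [], b.1 < M.length ∧ b.2 < M.length := by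
  induction i with
  | zero => simp
  | succ i ih =>
    rw [Function.iterate_succ_apply']
    rcases bidStep_cases M W ((bidStep M W)^[i] []) with ⟨h, -⟩ | ⟨u, v, hu, hv, -, h⟩
    · rw [h]; exact ⟨by omega, ih.2⟩
    · rw [h]
      refine ⟨by simp; omega, fun b hb => ?_⟩
      rcases List.mem_cons.1 hb with rfl | hb
      · exact ⟨hu, hv⟩
      · exact ih.2 b hb

theorem mem_ears {T : BoolMatrix} {alive : List Bool} {x : ℕ × ℕ} :
    x ∈ ears T alive ↔ x.1 < T.length ∧ x.2 < T.length ∧ isEar T alive x.1 x.2 := by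
  obtain ⟨u, v⟩ := x
  simp [ears, and_assoc]

theorem splitStep_cases (K : ℕ) (M T B : BoolMatrix) (st : SplitState) :
    (splitStep K M T B st = st ∧
      ∀ t < T.length, ∀ s < T.length, isEar T st.1 t s = false) ∨
    ∃ t s, t < T.length ∧ s < T.length ∧ isEar T st.1 t s ∧
      splitStep K M T B st = absorb K M T B st t s := by
  cases h : ears T st.1 with
  | nil =>
    left
    refine ⟨by simp [splitStep, h], fun u hu v hv => ?_⟩
    by_contra hc
    have := (mem_ears (x := (u, v))).2 ⟨hu, hv, by simpa using hc⟩
    simp [h] at this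
  | cons b l =>
    right
    have := (mem_ears (x := b) (T := T) (alive := st.1)).1 (by simp [h])
    exact ⟨b.1, b.2, this.1, this.2.1, this.2.2, by simp [splitStep, h]⟩

theorem encLen_tabulate_le {β : Type} [TreeEnc β] {n m : ℕ} {f : ℕ → β}
    (h : ∀ i < n, encLen (f i) ≤ m) : encLen (tabulate n f) ≤ 1 + n * (m + 1) := by
  refine encLen_list_le' (fun a ha => ?_) (by simp [tabulate])
  obtain ⟨i, hi, rfl⟩ := List.mem_map.1 ha
  exact h i (List.mem_range.1 hi)

theorem encLen_getD_le {β : Type} [TreeEnc β] (l : List (List β)) (i : ℕ) :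
    encLen (l.getD i []) ≤ encLen l := by
  rcases lt_or_ge i l.length with h | h
  · rw [List.getD_eq_getElem _ _ h]
    exact encLen_le_of_mem (l.getElem_mem h)
  · rw [List.getD_eq_default _ _ h]
    exact one_le_encLen l

/-- The live nodes and the parts are always tabulated in a fixed format, and a step adds at most one
piece, so nothing grows faster than linearly in `i`. -/
theorem splitStep_iterate_bounds (K : ℕ) (M T B : BoolMatrix) (i : ℕ) :
    let st := (splitStep K M T B)^[i] (splitInit M T B)
    encLen st.1 ≤ 1 + T.length * 4 ∧ encLen st.2.1 ≤ 1 + T.length * (2 + M.length * 4) ∧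
      encLen st.2.2 ≤ 1 + i * (3 + encLen B + M.length * 4) := by
  have h1 : ∀ (n : ℕ) (f : ℕ → Bool), encLen (tabulate n f) ≤ 1 + n * 4 :=
    fun n f => encLen_tabulate_le fun _ _ => encLen_bool_le _
  have h2 : ∀ f : ℕ → ℕ → Bool, encLen (tabulate T.length fun t => tabulate M.length (f t)) ≤
      1 + T.length * (2 + M.length * 4) := fun f =>
    (encLen_tabulate_le fun t _ => h1 M.length (f t)).trans (le_of_eq (by ring))
  induction i with
  | zero =>
    exact ⟨h1 _ _, h2 _, by simp [splitInit, encLen_nil]⟩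
  | succ i ih =>
    rw [Function.iterate_succ_apply']
    obtain ⟨ha, hp, hc⟩ := ih
    have hi : i * (3 + encLen B + M.length * 4) ≤ (i + 1) * (3 + encLen B + M.length * 4) := by
      gcongr; omega
    rcases splitStep_cases K M T B ((splitStep K M T B)^[i] (splitInit M T B)) with
      ⟨h, -⟩ | ⟨t, s, -, -, -, h⟩
    · rw [h]; exact ⟨ha, hp, by omega⟩
    · rw [h, absorb]
      cases decide (2 * K * bagSize M.length B s < reductionWeight M (joinParts M.length
          ((splitStep K M T B)^[i] (splitInit M T B)).2.1 t s)) with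
      | false => exact ⟨h1 _ _, h2 _, hc.trans (by omega)⟩
      | true =>
        refine ⟨h1 _ _, h2 _, ?_⟩
        have := encLen_getD_le B s
        have := h1 M.length fun v => entry ((splitStep K M T B)^[i] (splitInit M T B)).2.1 t v ||
          entry ((splitStep K M T B)^[i] (splitInit M T B)).2.1 s v
        simp only [cond_true, encLen_cons, encLen_pair]
        simp only [add_mul, one_mul, joinParts] at *
        omega

/-! ### Polynomial time: the auction, the splitting and the queries -/

namespace PT

section

variable {α β γ : Type} [TreeEnc α] [TreeEnc β] [TreeEnc γ]
  {M T B : α → BoolMatrix} {W : α → List Bool} {log : α → List (ℕ × ℕ)} {n i j : α → ℕ}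

@[fun_prop]
theorem auction (hM : PT M) (hW : PT W) : PT fun a => auction (M a) (W a) := by
  have : PT fun x : BoolMatrix × List Bool => _root_.auction x.1 x.2 := by
    unfold _root_.auction
    refine iterate (n := fun x : BoolMatrix × List Bool => x.1.length * (x.1.length + 2) + 1)
      (h := fun x : BoolMatrix × List Bool => _root_.bidStep x.1 x.2) (g := fun _ => [])
      (by fun_prop) (const []) (by fun_prop) (B := fun m => 1 + (m * (m + 2) + 1) * (4 * m + 4))
      (by fun_prop) fun x i hi => ?_
    obtain ⟨hl, hb⟩ := bidStep_iterate_bounds x.1 x.2 i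
    have hx : x.1.length ≤ encLen x := by
      have := length_le_encLen x.1
      have : encLen x = 1 + encLen x.1 + encLen x.2 := rfl
      omega
    refine (encLen_list_le' (B := 4 * encLen x + 3) (fun b hb' => ?_) (hl.trans hi)).trans ?_
    · have := hb b hb'
      have : encLen b = 1 + encLen b.1 + encLen b.2 := rfl
      simp only [encLen_nat] at this
      omega
    · gcongr
  exact this.comp (f := fun a => (M a, W a)) (hM.pair hW)

@[fun_prop]
theorem priceGap (hn : PT n) (hl : PT log) : PT fun a => priceGap (n a) (log a) := by
  unfold _root_.priceGap; fun_prop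

@[fun_prop]
theorem inHead (hn : PT n) (hl : PT log) (hi : PT i) :
    PT fun a => inHead (n a) (log a) (i a) := by
  unfold _root_.inHead; fun_prop

@[fun_prop]
theorem inCrown (hn : PT n) (hl : PT log) (hi : PT i) :
    PT fun a => inCrown (n a) (log a) (i a) := by
  unfold _root_.inCrown; fun_prop

@[fun_prop]
theorem takenVertices (hM : PT M) (hW : PT W) : PT fun a => takenVertices (M a) (W a) := by
  unfold _root_.takenVertices; fun_prop

@[fun_prop]
theorem restVertices (hM : PT M) (hW : PT W) : PT fun a => restVertices (M a) (W a) := by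
  unfold _root_.restVertices; fun_prop

@[fun_prop]
theorem reductionWeight (hM : PT M) (hW : PT W) : PT fun a => reductionWeight (M a) (W a) := by
  unfold _root_.reductionWeight; fun_prop

@[fun_prop]
theorem isEar (hT : PT T) (hW : PT W) (hi : PT i) (hj : PT j) :
    PT fun a => isEar (T a) (W a) (i a) (j a) := by
  unfold _root_.isEar; fun_prop

@[fun_prop]
theorem ears (hT : PT T) (hW : PT W) : PT fun a => ears (T a) (W a) := by
  unfold _root_.ears; fun_prop

@[fun_prop]
theorem joinParts (hn : PT n) (hM : PT M) (hi : PT i) (hj : PT j) :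
    PT fun a => joinParts (n a) (M a) (i a) (j a) := by
  unfold _root_.joinParts; fun_prop

@[fun_prop]
theorem bagSize (hn : PT n) (hM : PT M) (hi : PT i) :
    PT fun a => bagSize (n a) (M a) (i a) := by
  unfold _root_.bagSize; fun_prop

@[fun_prop]
theorem removeNode (hn : PT n) (hW : PT W) (hi : PT i) :
    PT fun a => removeNode (n a) (W a) (i a) := by
  unfold _root_.removeNode; fun_prop

@[fun_prop]
theorem absorb {K : ℕ} {st : α → SplitState} (hM : PT M) (hT : PT T) (hB : PT B) (hst : PT st)
    (hi : PT i) (hj : PT j) : PT fun a => absorb K (M a) (T a) (B a) (st a) (i a) (j a) := by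
  unfold _root_.absorb; fun_prop

@[fun_prop]
theorem splitStep {K : ℕ} {st : α → SplitState} (hM : PT M) (hT : PT T) (hB : PT B)
    (hst : PT st) : PT fun a => splitStep K (M a) (T a) (B a) (st a) := by
  unfold _root_.splitStep; fun_prop

@[fun_prop]
theorem splitInit (hM : PT M) (hT : PT T) (hB : PT B) :
    PT fun a => splitInit (M a) (T a) (B a) := by
  unfold _root_.splitInit; fun_prop

@[fun_prop]
theorem splitState {K : ℕ} (hM : PT M) (hT : PT T) (hB : PT B) :
    PT fun a => splitState K (M a) (T a) (B a) := by
  have : PT fun x : BoolMatrix × BoolMatrix × BoolMatrix =>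
      _root_.splitState K x.1 x.2.1 x.2.2 := by
    unfold _root_.splitState
    refine iterate (n := fun x : BoolMatrix × BoolMatrix × BoolMatrix => x.2.1.length)
      (g := fun x : BoolMatrix × BoolMatrix × BoolMatrix => _root_.splitInit x.1 x.2.1 x.2.2)
      (h := fun x : BoolMatrix × BoolMatrix × BoolMatrix =>
      _root_.splitStep K x.1 x.2.1 x.2.2) (by fun_prop) (by fun_prop) (by fun_prop)
      (B := fun m => 2 + (1 + m * 4) + (1 + m * (2 + m * 4)) + (1 + m * (3 + m + m * 4)))
      (by fun_prop) fun x i hi => ?_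
    obtain ⟨h1, h2, h3⟩ := splitStep_iterate_bounds K x.1 x.2.1 x.2.2 i
    have e : encLen x = 1 + encLen x.1 + (1 + encLen x.2.1 + encLen x.2.2) := rfl
    have hM : x.1.length ≤ encLen x := by have := length_le_encLen x.1; omega
    have hT : x.2.1.length ≤ encLen x := by have := length_le_encLen x.2.1; omega
    have h1' : 1 + x.2.1.length * 4 ≤ 1 + encLen x * 4 := by gcongr
    have h2' : 1 + x.2.1.length * (2 + x.1.length * 4) ≤ 1 + encLen x * (2 + encLen x * 4) := by
      gcongr
    have h3' : 1 + i * (3 + encLen x.2.2 + x.1.length * 4) ≤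
        1 + encLen x * (3 + encLen x + encLen x * 4) := by
      gcongr <;> omega
    have e' : ∀ st : SplitState, encLen st = 1 + encLen st.1 + (1 + encLen st.2.1 + encLen st.2.2) :=
      fun _ => rfl
    rw [e']
    omega
  exact this.comp (f := fun a => (M a, T a, B a)) (hM.pair (hT.pair hB))

@[fun_prop]
theorem pieces {K : ℕ} (hM : PT M) (hT : PT T) (hB : PT B) :
    PT fun a => pieces K (M a) (T a) (B a) := by
  unfold _root_.pieces; fun_prop

@[fun_prop]
theorem makeQuery {R : α → List ℕ} (hM : PT M) (hR : PT R) :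
    PT fun a => makeQuery (M a) (R a) := by
  unfold _root_.makeQuery; fun_prop

@[fun_prop]
theorem makeItem {x : α → List Bool × List Bool} (hM : PT M) (hx : PT x) :
    PT fun a => makeItem (M a) (x a) := by
  unfold _root_.makeItem; fun_prop

theorem queryItems (K : ℕ) : PT (queryItems K) := by
  unfold _root_.queryItems; fun_prop

@[fun_prop]
theorem coveredBy {x : α → QueryItem × List Bool} (hx : PT x) (hi : PT i) :
    PT fun a => coveredBy (x a) (i a) := by
  unfold _root_.coveredBy; fun_prop

theorem composeCover :
    PT fun x : (BoolMatrix × BoolMatrix × BoolMatrix) × List (QueryItem × List Bool) =>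
      composeCover x.1 x.2 := by
  unfold _root_.composeCover; fun_prop

end

end PT

/-! ### Programs with non-adaptive queries -/

section

variable {α β γ δ ε : Type} [TreeEnc α] [TreeEnc β] [TreeEnc γ] [TreeEnc δ] [TreeEnc ε]

/-- The body of the loop over the queries in the variable `K`, which collects the answers in the
variable `K + 1`. -/
def queryBody (K : ℕ) : WProg :=
  .seq (.query 0 (.hd (.hd (.var K)))) (.seq (.assign (K + 1) (.cons (.cons (.hd (.var K)) (.var 0))
    (.var (K + 1)))) (.assign K (.tl (.var K))))

/-- Each round adds at most `2 + 2 * S` to the accumulated answers, so `B` bounds the accumulator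
throughout. The component in `γ` is not sent to the oracle but kept next to the answer. -/
theorem exec_queryLoop {O : BinTree → BinTree} {A : β × γ → δ} {K : ℕ} (hK : 1 ≤ K)
    (l : List (β × γ)) (acc : List ((β × γ) × δ)) {S B : ℕ} (hS : encLen l ≤ S)
    (hB : encLen acc + l.length * (2 + 2 * S) ≤ B)
    (hA : ∀ x ∈ l, O (enc x.1) = enc (A x) ∧ encLen (A x) ≤ S)
    (σ : Store) (hl : σ K = enc l) (hacc : σ (K + 1) = enc acc) : ∃ τ t,
    Exec O (.loop (.var K) (queryBody K)) σ τ t (l.map fun x => enc x.1) ∧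
    t ≤ (l.length + 1) * (40 + 20 * S + 20 * B) ∧
    τ (K + 1) = enc ((l.map fun x => (x, A x)).reverse ++ acc) ∧
    ∀ x, x ≠ 0 → x ≠ K → x ≠ K + 1 → τ x = σ x := by
  induction l generalizing acc σ with
  | nil =>
    refine ⟨σ, _, .loop_done (by simp [WExpr.eval, hl, enc_nil]), ?_, hacc, fun _ _ _ _ => rfl⟩
    have : (enc ([] : List (β × γ))).size = 1 := rfl
    simp only [WExpr.cost, hl, this, List.length_nil]
    omega
  | cons b l ih =>
    obtain ⟨b₁, b₂⟩ := b
    set b := (b₁, b₂) with hb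
    obtain ⟨hOb, hAb⟩ := hA b List.mem_cons_self
    set σ₁ := Function.update σ 0 (enc (A b)) with hσ₁
    set σ₂ := Function.update σ₁ (K + 1) (enc ((b, A b) :: acc)) with hσ₂
    set σ₃ := Function.update σ₂ K (enc l) with hσ₃
    have e1 : σ₁ K = enc (b :: l) := by rw [hσ₁, Function.update_of_ne (by omega), hl]
    have e2 : σ₁ (K + 1) = enc acc := by rw [hσ₁, Function.update_of_ne (by omega), hacc]
    have e3 : σ₂ K = enc (b :: l) := by rw [hσ₂, Function.update_of_ne (by omega), e1]
    have v1 : (WExpr.hd (.hd (.var K))).eval σ = enc b.1 := by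
      simp only [WExpr.eval, hl, enc_cons, BinTree.hd]; rfl
    have v2 : (WExpr.cons (.cons (.hd (.var K)) (.var 0)) (.var (K + 1))).eval σ₁ =
        enc ((b, A b) :: acc) := by
      simp only [WExpr.eval, e1, e2, enc_cons, BinTree.hd, enc_pair]
      simp [hσ₁]
    have v3 : (WExpr.tl (.var K)).eval σ₂ = enc l := by
      simp only [WExpr.eval, e3, enc_cons, BinTree.tl]
    have s1 := Exec.query (O := O) 0 (.hd (.hd (.var K))) σ
    rw [v1, hOb, ← hσ₁] at s1
    have s2 := Exec.assign (O := O) (K + 1) (.cons (.cons (.hd (.var K)) (.var 0))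
      (.var (K + 1))) σ₁
    rw [v2, ← hσ₂] at s2
    have s3 := Exec.assign (O := O) K (.tl (.var K)) σ₂
    rw [v3, ← hσ₃] at s3
    rw [List.length_cons, add_mul, one_mul] at hB
    rw [encLen_cons] at hS
    have hacc' : encLen ((b, A b) :: acc) ≤ encLen acc + (2 + 2 * S) := by
      rw [encLen_cons, encLen_pair]; omega
    obtain ⟨τ, t, s4, ht, hτ, hfr⟩ := ih ((b, A b) :: acc) (by omega) (by omega)
      (fun x hx => hA x (List.mem_cons_of_mem _ hx)) σ₃ (by simp [hσ₃]) (by simp [hσ₃, hσ₂])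
    refine ⟨τ, _, .loop_step ?_ (.seq s1 (.seq s2 s3)) s4, ?_, ?_, fun x h0 h1 h2 => ?_⟩
    · simp [WExpr.eval, hl, enc_cons]
    · simp only [WExpr.cost, WExpr.eval, hl, e1, e2, e3]
      simp only [encLen, enc_cons, enc_pair, BinTree.hd, BinTree.tl, BinTree.size] at *
      have e4 : σ₁ 0 = enc (A b) := by simp [hσ₁]
      have e5 : enc b = .cons (enc b₁) (enc b₂) := rfl
      simp only [List.length_cons, add_mul, one_mul, e4, e5, BinTree.size] at *
      omega
    · simpa using hτ
    · rw [hfr x h0 h1 h2, hσ₃, Function.update_of_ne h1, hσ₂, Function.update_of_ne h2, hσ₁,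
        Function.update_of_ne h0]

/-- A program that computes queries in polynomial time, asks them, and computes the output from the
answers in polynomial time. -/
theorem exists_queryProgram {prep : α → List (β × γ)} {post : α × List ((β × γ) × δ) → ε}
    (hprep : PT prep) (hpost : PT post) : ∃ P T, IsNatPoly T ∧
    ∀ (O : BinTree → BinTree) (a : α) (A : β × γ → δ),
      -- Without a bound on the length of the answers, reading them would not take polynomial time.
      (∀ x ∈ prep a, O (enc x.1) = enc (A x) ∧ encLen (A x) ≤ encLen x) →
      ∃ τ t, Exec O P (initStore (enc a)) τ t ((prep a).map fun x => enc x.1) ∧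
        t ≤ T (encLen a) ∧ τ 0 = enc (post (a, ((prep a).map fun x => (x, A x)).reverse)) := by
  obtain ⟨P, k, S, hS, hk, hP⟩ := hprep
  obtain ⟨Q, _, U, hU, _, hQ⟩ := hpost
  refine ⟨.seq (.assign (k + 2) (.var 0)) (.seq P (.seq (.assign k (.var 0))
    (.seq (.assign (k + 1) .nil) (.seq (.loop (.var k) (queryBody k))
    (.seq (.assign 0 (.cons (.var (k + 2)) (.var (k + 1)))) Q))))),
    fun n => 4 * n + 4 * S n + (S n + 1) * (40 + 20 * S n + 20 * (1 + S n * (2 + 2 * S n))) + 50 +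
      4 * (1 + S n * (2 + 2 * S n)) + U (1 + n + (1 + S n * (2 + 2 * S n))),
    by fun_prop, fun O a A hA => ?_⟩
  set σ := initStore (enc a) with hσ
  have hσ0 : σ 0 = enc a := by simp [hσ, initStore]
  obtain ⟨t₁, s1, ht₁⟩ := Runs.assign (O := O) (σ := σ) (k + 2) (e := .var 0) hσ0 le_rfl
  obtain ⟨τ, ⟨t₂, s2, ht₂⟩, h2, h3, h4⟩ := hP a O (Function.update σ (k + 2) (enc a)) (by
    rwa [Function.update_of_ne (by omega)])
  obtain ⟨t₃, s3, ht₃⟩ := Runs.assign (O := O) k (e := .var 0) h2 le_rfl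
  obtain ⟨t₄, s4, ht₄⟩ := Runs.assign (O := O) (σ := Function.update τ k (enc (prep a))) (k + 1)
    (e := .nil) (d := .nil) rfl le_rfl
  have hlen : (prep a).length ≤ S (encLen a) := (length_le_encLen _).trans h4
  have hS2 : ∀ x ∈ prep a, O (enc x.1) = enc (A x) ∧ encLen (A x) ≤ S (encLen a) := fun x hx =>
    ⟨(hA x hx).1, (hA x hx).2.trans ((encLen_le_of_mem hx).trans h4)⟩
  obtain ⟨υ, t₅, s5, ht₅, h5, h6⟩ := exec_queryLoop (O := O) (A := A) hk (prep a) []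
    (B := 1 + S (encLen a) * (2 + 2 * S (encLen a))) h4
    (by rw [encLen_nil]; gcongr) hS2 (Function.update (Function.update τ k (enc (prep a))) (k + 1)
    .nil) (by simp) (by simp [enc_nil])
  have hk2 : υ (k + 2) = enc a := by
    rw [h6 _ (by omega) (by omega) (by omega), Function.update_of_ne (by omega),
      Function.update_of_ne (by omega), h3 _ (by omega), Function.update_self]
  rw [List.append_nil] at h5
  set ans := ((prep a).map fun x => (x, A x)).reverse with hans
  obtain ⟨t₆, s6, ht₆⟩ := Runs.assign (O := O) (σ := υ) 0 (e := .cons (.var (k + 2)) (.var (k + 1)))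
    (d := enc (a, ans)) (by simp only [WExpr.eval, hk2, h5, enc_pair]) le_rfl
  obtain ⟨ω, ⟨t₇, s7, ht₇⟩, h7, -, -⟩ := hQ (a, ans) O (Function.update υ 0 (enc (a, ans)))
    (Function.update_self ..)
  have hans' : encLen ans ≤ 1 + S (encLen a) * (2 + 2 * S (encLen a)) := by
    rw [hans, encLen_reverse]
    refine (encLen_list_le' (B := 1 + 2 * S (encLen a)) (fun y hy => ?_) (by simpa using hlen)).trans
      (by rw [show 1 + 2 * S (encLen a) + 1 = 2 + 2 * S (encLen a) by ring])
    obtain ⟨x, hx, rfl⟩ := List.mem_map.1 hy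
    have := (hS2 x hx).2
    have := (encLen_le_of_mem hx).trans h4
    rw [encLen_pair]; omega
  have ht₇' : t₇ ≤ U (1 + encLen a + (1 + S (encLen a) * (2 + 2 * S (encLen a)))) :=
    ht₇.trans (hU.mono (by rw [encLen_pair]; omega))
  have ht₅' : t₅ ≤ (S (encLen a) + 1) * (40 + 20 * S (encLen a) +
      20 * (1 + S (encLen a) * (2 + 2 * S (encLen a)))) := ht₅.trans (by gcongr)
  refine ⟨ω, _, by simpa using s1.seq (s2.seq (s3.seq (s4.seq (s5.seq (s6.seq s7))))), ?_, h7⟩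
  simp only [WExpr.cost, WExpr.eval, hσ0, h2, hk2, h5, BinTree.size] at *
  simp only [encLen] at *
  omega

end

/-! ### Correctness of the crown reduction -/

/-- The set `S` meets all edges between vertices that satisfy `U`. -/
def CoversPart (adj : ℕ → ℕ → Prop) (U : ℕ → Prop) (S : Finset ℕ) : Prop :=
  ∀ u v, U u → U v → adj u v → u ∈ S ∨ v ∈ S

/-- What an auction leaves behind if `h` is not a price: an assignment in which the vertices that
hold an expensive vertex, or nothing, have expensive neighbours only. -/
structure IsCrown (n : ℕ) (adj H : ℕ → ℕ → Prop) (A B : ℕ → Prop) : Prop where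
  symm : ∀ u v, adj u v → adj v u
  lt : ∀ u v, adj u v → u < n
  adj_of_holds : ∀ u v, H u v → adj u v
  holds_left : ∀ u v w, H u v → H u w → v = w
  holds_right : ∀ u v w, H u w → H v w → u = v
  head_held : ∀ v, A v → ∃ u, H u v
  crown_iff : ∀ u, B u ↔ (∀ v, ¬H u v) ∨ ∃ v, H u v ∧ A v
  adj_crown : ∀ u v, B u → adj u v → A v

namespace IsCrown

variable {n : ℕ} {adj H : ℕ → ℕ → Prop} {A B : ℕ → Prop}

theorem head_of_adj (h : IsCrown n adj H A B) {u v : ℕ} (hu : B u) (hu' : ¬A u) (huv : adj u v) :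
    A v ∧ ¬B v :=
  ⟨h.adj_crown u v hu huv, fun hv => hu' (h.adj_crown v u hv (h.symm u v huv))⟩

theorem lt_of_head (h : IsCrown n adj H A B) {v : ℕ} (hv : A v) : v < n := by
  obtain ⟨u, hu⟩ := h.head_held v hv
  exact h.lt v u (h.symm u v (h.adj_of_holds u v hu))

/-- The holder of an expensive vertex outside of the crown is in the crown, and not expensive. -/
theorem holder_of_head (h : IsCrown n adj H A B) {u v : ℕ} (hv : A v) (hv' : ¬B v) (huv : H u v) :
    B u ∧ ¬A u := by
  classical
  have hB : ∀ u v, A v → H u v → B u := fun u v hv huv => (h.crown_iff u).2 (.inr ⟨v, huv, hv⟩)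
  refine ⟨hB u v hv huv, fun hu => hv' ?_⟩
  choose! m hm using h.head_held
  -- The holder map `m` sends the finite set `A ∩ B` injectively into itself, hence onto itself. If
  -- `u` were in `A`, it would hold some vertex of `A ∩ B`, and this vertex would have to be `v`.
  set X := (Finset.range n).filter fun v => A v ∧ B v with hX
  have hmX : ∀ w ∈ X, m w ∈ X := by
    intro w hw
    simp only [hX, Finset.mem_filter, Finset.mem_range] at hw ⊢
    have hmw := hm w hw.2.1
    have hBm := hB _ _ hw.2.1 hmw
    refine ⟨h.lt _ _ (h.adj_of_holds _ _ hmw), ?_, hBm⟩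
    by_contra hA
    exact (h.head_of_adj hBm hA (h.adj_of_holds _ _ hmw)).2 hw.2.2
  have hinj : ∀ w₁ ∈ X, ∀ w₂ ∈ X, m w₁ = m w₂ → w₁ = w₂ := by
    intro w₁ h₁ w₂ h₂ he
    simp only [hX, Finset.mem_filter] at h₁ h₂
    have e₁ := hm w₁ h₁.2.1
    have e₂ := hm w₂ h₂.2.1
    rw [he] at e₁
    exact h.holds_left _ _ _ e₁ e₂
  have huX : u ∈ X := by
    simp only [hX, Finset.mem_filter, Finset.mem_range]
    exact ⟨h.lt_of_head hu, hu, hB u v hv huv⟩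
  obtain ⟨w, hw, he⟩ := Finset.surj_on_of_inj_on_of_card_le (fun w _ => m w) (fun w hw => hmX w hw)
    (fun w₁ w₂ h₁ h₂ he => hinj w₁ h₁ w₂ h₂ he) le_rfl u huX
  simp only [hX, Finset.mem_filter] at hw
  have := hm w hw.2.1
  rw [← he] at this
  rw [h.holds_left _ _ _ huv this]
  exact hw.2.2

/-- The vertices that are left have a fixed-point free injection along edges. -/
theorem exists_rest_injection (h : IsCrown n adj H A B) : ∃ m : ℕ → ℕ,
    (∀ v < n, (A v ↔ B v) → m v < n ∧ (A (m v) ↔ B (m v)) ∧ adj v (m v)) ∧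
    ∀ v < n, ∀ w < n, (A v ↔ B v) → (A w ↔ B w) → m v = m w → v = w := by
  classical
  -- A vertex of `A ∩ B` is sent to its holder and a vertex outside of `A ∪ B` to the vertex that it
  -- holds. Both classes are preserved, and on each of them injectivity is one of the two matching
  -- properties.
  have key : ∀ v, v < n → (A v ↔ B v) → ∃ w, w < n ∧ (A w ↔ B w) ∧ adj v w ∧
      (A v ↔ A w) ∧ (A v → H w v) ∧ (¬A v → H v w) := by
    intro v hv hAB
    by_cases hA : A v
    · obtain ⟨w, hw⟩ := h.head_held v hA
      have hadj := h.adj_of_holds _ _ hw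
      have hBw : B w := (h.crown_iff w).2 (.inr ⟨v, hw, hA⟩)
      have hAw : A w := by
        by_contra hAw
        exact (h.head_of_adj hBw hAw hadj).2 (hAB.1 hA)
      exact ⟨w, h.lt _ _ hadj, by simp [hAw, hBw], h.symm _ _ hadj, by simp [hA, hAw],
        fun _ => hw, fun hA' => absurd hA hA'⟩
    · have hB : ¬B v := fun hB => hA (hAB.2 hB)
      have hB' := hB
      rw [h.crown_iff] at hB
      push Not at hB
      obtain ⟨⟨w, hw⟩, hB⟩ := hB
      have hAw := hB w hw
      have hadj := h.adj_of_holds _ _ hw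
      have hBw : ¬B w := fun hBw => hA (h.head_of_adj hBw hAw (h.symm _ _ hadj)).1
      exact ⟨w, h.lt _ _ (h.symm _ _ hadj), by simp [hAw, hBw], hadj, by simp [hA, hAw],
        fun hA' => absurd hA' hA, fun _ => hw⟩
  choose! m hm using key
  refine ⟨m, fun v hv hAB => ⟨(hm v hv hAB).1, (hm v hv hAB).2.1, (hm v hv hAB).2.2.1⟩,
    fun v hv w hw hv' hw' he => ?_⟩
  obtain ⟨-, -, -, h1, h2, h3⟩ := hm v hv hv'
  obtain ⟨-, -, -, k1, k2, k3⟩ := hm w hw hw'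
  rw [he] at h1 h2 h3
  by_cases hA : A v
  · exact h.holds_left _ _ _ (h2 hA) (k2 (k1.2 (h1.1 hA)))
  · exact h.holds_right _ _ _ (h3 hA) (k3 fun hw => hA (h1.2 (k1.1 hw)))

variable [DecidablePred A] [DecidablePred B]

/-- An uncovered vertex is sent along an edge by the rest injection, so its image is covered: the
uncovered rest vertices inject into the covered ones. -/
theorem card_rest_le (h : IsCrown n adj H A B) {S : Finset ℕ}
    (hS : CoversPart adj (fun v => v < n ∧ (A v ↔ B v)) S) :
    ((Finset.range n).filter fun v => A v ↔ B v).card ≤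
      2 * (((Finset.range n).filter fun v => A v ↔ B v) ∩ S).card := by
  obtain ⟨m, hm, hinj⟩ := h.exists_rest_injection
  set R := (Finset.range n).filter fun v => A v ↔ B v with hR
  have hR' : ∀ v, v ∈ R ↔ v < n ∧ (A v ↔ B v) := by simp [hR]
  have : (R \ S).card ≤ (R ∩ S).card := by
    refine Finset.card_le_card_of_injOn m (fun v hv => ?_) fun v hv w hw he => ?_
    · simp only [Finset.coe_sdiff, Set.mem_sdiff, Finset.mem_coe, hR'] at hv
      obtain ⟨h1, h2, h3⟩ := hm v hv.1.1 hv.1.2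
      have := (hS v (m v) hv.1 ⟨h1, h2⟩ h3).resolve_left hv.2
      simp only [Finset.coe_inter, Set.mem_inter_iff, Finset.mem_coe, hR']
      exact ⟨⟨h1, h2⟩, this⟩
    · simp only [Finset.coe_sdiff, Set.mem_sdiff, Finset.mem_coe, hR'] at hv hw
      exact hinj v hv.1.1 w hw.1.1 hv.1.2 hw.1.2 he
  have := Finset.card_sdiff_add_card_inter R S
  omega

/-- If `S` omits a taken vertex, it contains the holder, which lies in `B \ A` and so is neither
taken nor in the rest. Distinct taken vertices have distinct holders, so the exchange loses nothing.
-/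
theorem card_taken_add_le (h : IsCrown n adj H A B) {U : ℕ → Prop} [DecidablePred U]
    (hU : ∀ u v, adj u v → U u) {S : Finset ℕ} (hS : ∀ u v, adj u v → u ∈ S ∨ v ∈ S) :
    ((Finset.range n).filter fun v => A v ∧ ¬B v).card +
      (((Finset.range n).filter fun v => A v ↔ B v) ∩ S).card ≤
      (S.filter U).card := by
  obtain ⟨m', hm', -⟩ := h.exists_rest_injection
  choose! m hm using h.head_held
  set R := (Finset.range n).filter fun v => A v ↔ B v with hR
  set V := (Finset.range n).filter fun v => A v ∧ ¬B v with hV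
  set X := (S.filter U).filter fun v => B v ∧ ¬A v with hX
  have h1 : (V \ S).card ≤ X.card := by
    refine Finset.card_le_card_of_injOn m (fun v hv => ?_) fun v hv w hw he => ?_
    · simp only [hV, Finset.coe_sdiff, Set.mem_sdiff, Finset.mem_coe, Finset.mem_filter] at hv
      have hmv := hm v hv.1.2.1
      have hadj := h.adj_of_holds _ _ hmv
      simp only [hX, Finset.mem_coe, Finset.mem_filter]
      exact ⟨⟨(hS _ _ hadj).resolve_right hv.2, hU _ _ hadj⟩,
        h.holder_of_head hv.1.2.1 hv.1.2.2 hmv⟩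
    · simp only [hV, Finset.coe_sdiff, Set.mem_sdiff, Finset.mem_coe, Finset.mem_filter] at hv hw
      have e1 := hm v hv.1.2.1
      rw [he] at e1
      exact h.holds_left _ _ _ e1 (hm w hw.1.2.1)
  have h2 := Finset.card_sdiff_add_card_inter V S
  have hd1 : Disjoint X (V ∩ S) := by
    rw [Finset.disjoint_left]
    intro v hv hv'
    simp only [hX, hV, Finset.mem_filter, Finset.mem_inter] at hv hv'
    exact hv.2.2 hv'.1.2.1
  have hd2 : Disjoint (X ∪ V ∩ S) (R ∩ S) := by
    rw [Finset.disjoint_left]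
    intro v hv hv'
    simp only [hX, hV, hR, Finset.mem_filter, Finset.mem_inter, Finset.mem_union] at hv hv'
    tauto
  have h3 : X ∪ V ∩ S ∪ R ∩ S ⊆ S.filter U := by
    intro v hv
    simp only [hX, hV, hR, Finset.mem_filter, Finset.mem_inter, Finset.mem_union,
      Finset.mem_range] at hv ⊢
    rcases hv with (hv | hv) | hv
    · exact hv.1
    · exact ⟨hv.2, hU _ _ (h.symm _ _ (h.adj_of_holds _ _ (hm v hv.1.2.1)))⟩
    · exact ⟨hv.2, hU _ _ (hm' v hv.1.1 hv.1.2).2.2⟩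
  have h4 := Finset.card_le_card h3
  rw [Finset.card_union_of_disjoint hd2, Finset.card_union_of_disjoint hd1] at h4
  omega

end IsCrown

/-! ### Correctness of the auction -/

/-- The logs of auctions. -/
inductive ValidLog (M : BoolMatrix) (W : List Bool) : List (ℕ × ℕ) → Prop where
  | nil : ValidLog M W []
  | cons {u v : ℕ} {log : List (ℕ × ℕ)} : ValidLog M W log → v < M.length →
      canBid M W log u v → ValidLog M W ((u, v) :: log)

theorem holds_nil (u v : ℕ) : holds [] u v = false := by simp [holds, bidsFor]

theorem holds_cons (a b : ℕ) (log : List (ℕ × ℕ)) (u v : ℕ) :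
    holds ((a, b) :: log) u v = if b = v then decide (a = u) else holds log u v := by
  by_cases h : b = v <;> simp [holds, bidsFor, h]

theorem price_cons (a b : ℕ) (log : List (ℕ × ℕ)) (v : ℕ) :
    price ((a, b) :: log) v = price log v + if b = v then 1 else 0 := by
  by_cases h : b = v <;> simp [price, bidsFor, h]

theorem canBid_iff {M : BoolMatrix} {W : List Bool} {log : List (ℕ × ℕ)} {u v : ℕ} :
    canBid M W log u v ↔ adjIn M W u v ∧ isFree M.length log u ∧ price log v < M.length + 2 ∧
      ∀ w < M.length, adjIn M W u w → price log v ≤ price log w := by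
  simp only [canBid, Bool.and_eq_true, decide_eq_true_eq, List.all_eq_true, List.mem_range,
    Bool.or_eq_true, Bool.not_eq_true']
  refine and_congr_right' (and_congr_right' (and_congr_right' (forall₂_congr fun w _ => ?_)))
  cases adjIn M W u w <;> simp

namespace ValidLog

variable {M : BoolMatrix} {W : List Bool} {log : List (ℕ × ℕ)}

theorem holds_right (h : ValidLog M W log) {u v w : ℕ} (huw : holds log u w) (hvw : holds log v w) :
    u = v := by
  induction h with
  | nil => simp [holds_nil] at huw
  | cons _ _ _ ih =>
    rw [holds_cons] at huw hvw
    split_ifs at huw hvw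
    · simp_all
    · exact ih huw hvw

theorem adj_of_holds (h : ValidLog M W log) {u v : ℕ} (huv : holds log u v) :
    adjIn M W u v ∧ v < M.length := by
  induction h with
  | nil => simp [holds_nil] at huv
  | cons _ hv hc ih =>
    rw [holds_cons] at huv
    split_ifs at huv with hb
    · subst hb
      rw [decide_eq_true_eq] at huv
      subst huv
      exact ⟨(canBid_iff.1 hc).1, hv⟩
    · exact ih huv

theorem isFree_iff (h : ValidLog M W log) {u : ℕ} :
    isFree M.length log u ↔ ∀ v, ¬holds log u v := by
  simp only [isFree, List.all_eq_true, List.mem_range, Bool.not_eq_true', Bool.not_eq_true]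
  refine ⟨fun hf v => ?_, fun hf v _ => hf v⟩
  by_contra hv
  rw [Bool.not_eq_false] at hv
  rw [hf v (h.adj_of_holds hv).2] at hv
  simp at hv

/-- Only a free vertex may bid, so it never acquires a second item. -/
theorem holds_left (h : ValidLog M W log) {u v w : ℕ} (huv : holds log u v) (huw : holds log u w) :
    v = w := by
  induction h with
  | nil => simp [holds_nil] at huv
  | @cons a b log hl hv hc ih =>
    have hf := hl.isFree_iff.1 (canBid_iff.1 hc).2.1
    rw [holds_cons] at huv huw
    split_ifs at huv huw with h1 h2 h2
    · exact h1.symm.trans h2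
    · rw [decide_eq_true_eq] at huv
      exact absurd (huv ▸ huw) (hf w)
    · rw [decide_eq_true_eq] at huw
      exact absurd (huw ▸ huv) (hf v)
    · exact ih huv huw

/-- An item passes from holder to holder but never becomes vacant again. -/
theorem exists_holds (h : ValidLog M W log) {v : ℕ} (hv : 1 ≤ price log v) :
    ∃ u, holds log u v := by
  induction h with
  | nil => simp [price, bidsFor] at hv
  | @cons a b log hl _ hc ih =>
    rw [price_cons] at hv
    simp only [holds_cons]
    split_ifs at hv ⊢ with hb
    · exact ⟨a, by simp⟩
    · exact ih hv

/-- Approximate complementary slackness: when `u` bid for `v`, no neighbour was cheaper. Since then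
the price of `v` is unchanged, as another bid would have replaced the holder, and other prices only
rise. -/
theorem price_le_add_one (h : ValidLog M W log) {u v w : ℕ} (huv : holds log u v)
    (huw : adjIn M W u w) (hw : w < M.length) : price log v ≤ price log w + 1 := by
  induction h with
  | nil => simp [holds_nil] at huv
  | @cons a b log hl _ hc ih =>
    rw [holds_cons] at huv
    rw [price_cons, price_cons]
    split_ifs at huv with hb
    · rw [decide_eq_true_eq] at huv
      subst huv hb
      have := (canBid_iff.1 hc).2.2.2 w hw huw
      rw [if_pos rfl]; omega
    · have := ih huv
      rw [if_neg hb]; omega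

theorem price_le (h : ValidLog M W log) (v : ℕ) : price log v ≤ M.length + 2 := by
  induction h with
  | nil => simp [price, bidsFor]
  | @cons a b log hl _ hc ih =>
    rw [price_cons]
    split_ifs with hb
    · subst hb; have := (canBid_iff.1 hc).2.2.1; omega
    · exact ih

/-- Each bid raises exactly one price by one; with the bound on the prices this forces the auction
to stop. -/
theorem length_eq_sum (h : ValidLog M W log) :
    log.length = ∑ v ∈ Finset.range M.length, price log v := by
  induction h with
  | nil => simp [price, bidsFor]
  | @cons a b log hl hb hc ih =>
    simp only [price_cons, Finset.sum_add_distrib, List.length_cons, ih]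
    simp [hb]

theorem length_le (h : ValidLog M W log) : log.length ≤ M.length * (M.length + 2) := by
  rw [h.length_eq_sum]
  refine (Finset.sum_le_card_nsmul _ _ (M.length + 2) fun v _ => h.price_le v).trans ?_
  simp

end ValidLog

theorem validLog_auction (M : BoolMatrix) (W : List Bool) : ValidLog M W (auction M W) ∧
    ∀ u < M.length, ∀ v < M.length, canBid M W (auction M W) u v = false := by
  have key : ∀ i, ValidLog M W ((bidStep M W)^[i] []) ∧ (((bidStep M W)^[i] []).length = i ∨
      ∀ u < M.length, ∀ v < M.length, canBid M W ((bidStep M W)^[i] []) u v = false) := by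
    intro i
    induction i with
    | zero => exact ⟨.nil, .inl rfl⟩
    | succ i ih =>
      rw [Function.iterate_succ_apply']
      rcases bidStep_cases M W ((bidStep M W)^[i] []) with ⟨h1, h2⟩ | ⟨u, v, hu, hv, h1, h2⟩
      · rw [h1]; exact ⟨ih.1, .inr h2⟩
      · rw [h2]
        refine ⟨.cons ih.1 hv h1, .inl ?_⟩
        rcases ih.2 with h | h
        · rw [List.length_cons, h]
        · rw [h u hu v hv] at h1; simp at h1
  obtain ⟨h1, h2⟩ := key (M.length * (M.length + 2) + 1)
  refine ⟨h1, h2.resolve_left fun h => ?_⟩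
  have := h1.length_le
  omega

/-- Pigeonhole: `n` vertices cannot realize all of the `n + 1` prices in `[1, n + 1]`. -/
theorem priceGap_spec (n : ℕ) (log : List (ℕ × ℕ)) :
    1 ≤ priceGap n log ∧ priceGap n log ≤ n + 1 ∧ ∀ v < n, price log v ≠ priceGap n log := by
  set l := (List.range (n + 2)).filter fun h => decide (1 ≤ h) &&
    (List.range n).all fun v => !decide (price log v = h) with hl
  have hmem : ∀ h, h ∈ l ↔ h < n + 2 ∧ 1 ≤ h ∧ ∀ v < n, price log v ≠ h := by
    intro h
    simp [hl]
  obtain ⟨h, hh⟩ : ∃ h, h ∈ l := by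
    obtain ⟨h, h1, h2⟩ := Finset.exists_mem_notMem_of_card_lt_card
      (s := (Finset.range n).image (price log)) (t := Finset.Icc 1 (n + 1))
      (Finset.card_image_le.trans_lt (by simp))
    rw [Finset.mem_Icc] at h1
    refine ⟨h, (hmem h).2 ⟨by omega, h1.1, fun v hv he => h2 ?_⟩⟩
    exact Finset.mem_image.2 ⟨v, Finset.mem_range.2 hv, he⟩
  have : priceGap n log ∈ l := by
    rw [priceGap, ← hl]
    cases hl' : l with
    | nil => simp [hl'] at hh
    | cons a l => simp
  obtain ⟨h1, h2, h3⟩ := (hmem _).1 this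
  exact ⟨h2, by omega, h3⟩

/-! ### Correctness of the reduction of a part of the graph -/

section

variable {M : BoolMatrix} {W : List Bool}

theorem entry_lt_left {u v : ℕ} (h : entry M u v) : u < M.length := by
  by_contra hu
  rw [entry, List.getD_eq_default _ _ (by omega)] at h
  simp [bit] at h

theorem adjIn_iff {u v : ℕ} : adjIn M W u v ↔ bit W u ∧ bit W v ∧ entry M u v := by
  simp [adjIn]

/-- A stuck free vertex sees only prices of at least `n + 2`. If `u` holds an item dearer than the
gap `h`, its neighbours cost at least `h` by `ValidLog.price_le_add_one`, hence more than `h`, as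
`h` is not a price. Numbers beyond the matrix hold nothing and are counted as crown, as
`IsCrown.crown_iff` demands. -/
theorem isCrown_auction (hM : ∀ u v, entry M u v → entry M v u) :
    IsCrown M.length (fun u v => adjIn M W u v) (fun u v => holds (auction M W) u v)
      (fun v => inHead M.length (auction M W) v ∧ v < M.length)
      (fun v => v < M.length → inCrown M.length (auction M W) v) := by
  obtain ⟨hl, hstuck⟩ := validLog_auction M W
  obtain ⟨hg1, hg2, hg3⟩ := priceGap_spec M.length (auction M W)
  have hsymm : ∀ u v, adjIn M W u v → adjIn M W v u := fun u v h => by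
    rw [adjIn_iff] at *
    exact ⟨h.2.1, h.1, hM _ _ h.2.2⟩
  have hlt : ∀ u v, adjIn M W u v → u < M.length := fun u v h => entry_lt_left (adjIn_iff.1 h).2.2
  have hB : ∀ u, (u < M.length → inCrown M.length (auction M W) u) ↔
      (∀ v, ¬holds (auction M W) u v) ∨
      ∃ v, holds (auction M W) u v ∧ (inHead M.length (auction M W) v ∧ v < M.length) := by
    intro u
    rcases lt_or_ge u M.length with hu | hu
    · simp only [hu, true_imp_iff, inCrown, Bool.or_eq_true, hl.isFree_iff, List.any_eq_true,
        List.mem_range, Bool.and_eq_true]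
      refine or_congr_right (exists_congr fun v => ?_)
      tauto
    · refine ⟨fun _ => .inl fun v hv => ?_, fun _ h => absurd h (by omega)⟩
      have := hlt u v (hl.adj_of_holds hv).1
      omega
  refine ⟨hsymm, hlt, fun u v h => (hl.adj_of_holds h).1, fun u v w => hl.holds_left,
    fun u v w => hl.holds_right, fun v hv => ?_, hB, fun u v hu huv => ?_⟩
  · have := hv.1
    simp only [inHead, decide_eq_true_eq] at this
    exact hl.exists_holds (by omega)
  · have hv := hlt v u (hsymm u v huv)
    refine ⟨?_, hv⟩
    simp only [inHead, decide_eq_true_eq]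
    rcases (hB u).1 hu with h | ⟨w, h1, h2, h3⟩
    · by_contra hp
      obtain ⟨w, hw, hmin⟩ := Finset.exists_min_image ((Finset.range M.length).filter
        fun w => adjIn M W u w) (price (auction M W)) ⟨v, by simp [hv, huv]⟩
      simp only [Finset.mem_filter, Finset.mem_range] at hw hmin
      have hs := hstuck u (hlt u v huv) w hw.1
      have := hmin v ⟨hv, huv⟩
      rw [canBid_iff.2 ⟨hw.2, hl.isFree_iff.2 h, by omega, fun w' h1 h2 => hmin w' ⟨h1, h2⟩⟩] at hs
      simp at hs
    · simp only [inHead, decide_eq_true_eq] at h2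
      have := hl.price_le_add_one h1 huv hv
      have := hg3 v hv
      omega

theorem mem_takenVertices {v : ℕ} : v ∈ takenVertices M W ↔ v < M.length ∧
    inHead M.length (auction M W) v ∧ ¬inCrown M.length (auction M W) v := by
  simp [takenVertices]

theorem mem_restVertices {v : ℕ} : v ∈ restVertices M W ↔ v < M.length ∧
    (inHead M.length (auction M W) v ↔ inCrown M.length (auction M W) v) := by
  simp [restVertices]

theorem nodup_takenVertices : (takenVertices M W).Nodup := List.nodup_range.filter _

theorem nodup_restVertices : (restVertices M W).Nodup := List.nodup_range.filter _

theorem length_taken_add_le (hM : ∀ u v, entry M u v → entry M v u) {S : Finset ℕ}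
    (hS : CoversPart (fun u v => entry M u v) (fun v => bit W v) S) :
    (takenVertices M W).length + ((restVertices M W).toFinset ∩ S).card ≤
      (S.filter fun v => bit W v).card := by
  classical
  have := (isCrown_auction (W := W) hM).card_taken_add_le (U := fun v => bit W v)
    (fun u v h => (adjIn_iff.1 h).1) (S := S) fun u v h =>
      have h := adjIn_iff.1 h
      hS u v h.1 h.2.1 h.2.2
  rw [← List.toFinset_card_of_nodup nodup_takenVertices]
  convert this using 4
  · ext v
    simp only [List.mem_toFinset, mem_takenVertices, Finset.mem_filter, Finset.mem_range]
    tauto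
  · ext v
    simp only [List.mem_toFinset, mem_restVertices, Finset.mem_filter, Finset.mem_range]
    tauto

theorem length_rest_le (hM : ∀ u v, entry M u v → entry M v u) {S : Finset ℕ}
    (hS : CoversPart (fun u v => entry M u v) (fun v => v ∈ restVertices M W) S) :
    (restVertices M W).length ≤ 2 * ((restVertices M W).toFinset ∩ S).card := by
  classical
  have e : (restVertices M W).toFinset = (Finset.range M.length).filter fun v =>
      (inHead M.length (auction M W) v ∧ v < M.length) ↔
      (v < M.length → inCrown M.length (auction M W) v) := by
    ext v
    simp only [List.mem_toFinset, mem_restVertices, Finset.mem_filter, Finset.mem_range]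
    tauto
  rw [← List.toFinset_card_of_nodup nodup_restVertices, e]
  refine (isCrown_auction (W := W) hM).card_rest_le fun u v hu hv huv => ?_
  refine hS u v ?_ ?_ (adjIn_iff.1 huv).2.2
  · exact mem_restVertices.2 (by tauto)
  · exact mem_restVertices.2 (by tauto)

/-- Vertices outside of `W` and isolated ones do not survive the reduction, because the rest
injection moves along edges. -/
theorem exists_adj_of_mem_rest (hM : ∀ u v, entry M u v → entry M v u) {v : ℕ}
    (hv : v ∈ restVertices M W) : ∃ w, adjIn M W v w := by
  obtain ⟨m, hm, -⟩ := (isCrown_auction (W := W) hM).exists_rest_injection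
  rw [mem_restVertices] at hv
  exact ⟨m v, (hm v hv.1 (by tauto)).2.2⟩

/-- Feasibility of the half-integral solution: the neighbours of the crown are in the head, applied
to the edge in both directions. -/
theorem taken_or_rest_of_adj (hM : ∀ u v, entry M u v → entry M v u) {u v : ℕ}
    (hu : bit W u) (hv : bit W v) (huv : entry M u v) :
    u ∈ takenVertices M W ∨ v ∈ takenVertices M W ∨
      (u ∈ restVertices M W ∧ v ∈ restVertices M W) := by
  have h := isCrown_auction (W := W) hM
  have huv' : adjIn M W u v := adjIn_iff.2 ⟨hu, hv, huv⟩
  have hvu' := h.symm _ _ huv'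
  have hu := h.lt _ _ huv'
  have hv := h.lt _ _ hvu'
  have h1 := h.adj_crown u v
  have h2 := h.adj_crown v u
  simp only [mem_takenVertices, mem_restVertices]
  simp only [hu, hv, huv', hvu', true_imp_iff, and_true, true_and] at *
  tauto

end

/-! ### Correctness of the splitting along the tree -/

/-- Every splitting of the nodes in `A` into two nonempty parts is crossed by an edge of `T`. -/
def CutConnected (T : ℕ → ℕ → Prop) (A : ℕ → Prop) : Prop :=
  ∀ X : ℕ → Prop, (∃ t, A t ∧ X t) → (∃ t, A t ∧ ¬X t) → ∃ t r, A t ∧ A r ∧ X t ∧ ¬X r ∧ T t r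

/-- Put `t` on the side of `s`. Then no edge at `t` crosses the cut, so the crossing edge survives
the removal of `t`. -/
theorem CutConnected.remove {T : ℕ → ℕ → Prop} {A : ℕ → Prop} (h : CutConnected T A)
    (hT : ∀ t s, T t s → T s t) {t s : ℕ} (hts : ∀ r, A r → T t r → r = s) :
    CutConnected T fun r => A r ∧ r ≠ t := by
  rintro X ⟨a, ⟨ha, hat⟩, hXa⟩ ⟨b, ⟨hb, hbt⟩, hXb⟩
  obtain ⟨x, y, hx, hy, hXx, hXy, hxy⟩ := h (fun r => (r ≠ t ∧ X r) ∨ (r = t ∧ X s))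
    ⟨a, ha, .inl ⟨hat, hXa⟩⟩ ⟨b, hb, by simp [hbt, hXb]⟩
  have h1 : x = t → y = s := fun e => hts y hy (e ▸ hxy)
  have h2 : y = t → x = s := fun e => hts x hx (e ▸ hT _ _ hxy)
  by_cases hxt : x = t
  · obtain rfl := h1 hxt
    rcases hXx with ⟨h, -⟩ | ⟨-, hs⟩
    · exact absurd hxt h
    · exact absurd ((em (y = t)).symm.imp (fun h => ⟨h, hs⟩) fun h => ⟨h, hs⟩) hXy
  · by_cases hyt : y = t
    · obtain rfl := h2 hyt
      exact absurd (.inr ⟨hyt, (hXx.resolve_right fun h => hxt h.1).2⟩) hXy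
    · exact ⟨x, y, ⟨hx, hxt⟩, ⟨hy, hyt⟩, by simpa [hxt] using hXx, by simpa [hyt] using hXy, hxy⟩

theorem CoversPart.mono {adj : ℕ → ℕ → Prop} {U U' : ℕ → Prop} {S : Finset ℕ}
    (h : CoversPart adj U S) (hU : ∀ v, U' v → U v) : CoversPart adj U' S :=
  fun u v hu hv => h u v (hU u hu) (hU v hv)

theorem bit_tabulate {n : ℕ} {f : ℕ → Bool} {i : ℕ} : bit (tabulate n f) i ↔ i < n ∧ f i := by
  rcases lt_or_ge i n with h | h
  · simp [bit, tabulate, List.getD_eq_getElem?_getD, h]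
  · simp [bit, tabulate, List.getD_eq_getElem?_getD, h]

theorem entry_tabulate {m n : ℕ} {f : ℕ → ℕ → Bool} {i j : ℕ} :
    entry (tabulate m fun i => tabulate n (f i)) i j ↔ i < m ∧ j < n ∧ f i j := by
  rcases lt_or_ge i m with h | h
  · have : (tabulate m fun i => tabulate n (f i)).getD i [] = tabulate n (f i) := by
      simp [tabulate, List.getD_eq_getElem?_getD, h]
    rw [entry, this, bit_tabulate]
    simp [h]
  · have : (tabulate m fun i => tabulate n (f i)).getD i [] = [] := by
      simp [tabulate, List.getD_eq_getElem?_getD, h]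
    rw [entry, this]
    simp [bit, h]

/-- The matrices describe a graph, a tree and the bags of a tree decomposition with at most `b`
vertices in every bag. -/
structure IsDecomposition (M T B : BoolMatrix) (b : ℕ) : Prop where
  symm : ∀ u v, entry M u v → entry M v u
  tree_symm : ∀ t s, entry T t s → entry T s t
  edge_mem : ∀ u v, entry M u v → ∃ t < T.length, entry B t u ∧ entry B t v
  tree_connected : CutConnected (fun t s => entry T t s) fun t => t < T.length
  bag_connected : ∀ v, CutConnected (fun t s => entry T t s) fun t => t < T.length ∧ entry B t v
  exists_leaf : ∀ A : ℕ → Prop, (∀ t, A t → t < T.length) →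
    CutConnected (fun t s => entry T t s) A → (∃ t s, A t ∧ A s ∧ t ≠ s) →
    ∃ t s, A t ∧ A s ∧ t ≠ s ∧ ∀ r, A r → entry T t r → r = s
  bagSize_le : ∀ t, bagSize M.length B t ≤ b

/-- The invariant of the splitting. -/
structure SplitInvariant (K : ℕ) (M T B : BoolMatrix) (b : ℕ) (st : SplitState) : Prop where
  alive_lt : ∀ t, bit st.1 t → t < T.length
  alive_connected : CutConnected (fun t s => entry T t s) fun t => bit st.1 t
  bag_connected : ∀ v, CutConnected (fun t s => entry T t s) fun t => bit st.1 t ∧ entry B t v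
  edge : ∀ u v, entry M u v →
    (∃ x ∈ st.2.2, bit x.1 u ∨ bit x.1 v ∨ (bit x.2 u ∧ bit x.2 v)) ∨
    ∃ t, bit st.1 t ∧ entry st.2.1 t u ∧ entry st.2.1 t v
  -- By symmetry the common vertices of two live parts lie in both bags.
  inter : ∀ t r v, bit st.1 t → bit st.1 r → t ≠ r → entry st.2.1 t v → entry st.2.1 r v →
    entry B t v
  disjoint : ∀ x ∈ st.2.2, ∀ t v, bit st.1 t → entry st.2.1 t v → ¬bit x.1 v ∧ ¬bit x.2 v
  pairwise : st.2.2.Pairwise fun x y => ∀ v, ¬(bit x.2 v ∧ bit y.2 v)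
  -- Initially the bag itself is such a cover; after a merge it consists of the taken and the rest
  -- vertices.
  small : ∀ t, bit st.1 t → ∃ S : Finset ℕ,
    CoversPart (fun u v => entry M u v) (fun v => entry st.2.1 t v) S ∧ S.card ≤ 2 * b * K
  large : ∀ x ∈ st.2.2, 2 * K * ((List.range M.length).filter fun v => bit x.1 v).length ≤
    reductionWeight M x.2
  -- Two parts with covers of size `2 * b * K`, and one bag.
  bounded : ∀ x ∈ st.2.2, ∃ S : Finset ℕ,
    CoversPart (fun u v => entry M u v) (fun v => bit x.2 v) S ∧ S.card ≤ 5 * b * K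

theorem isEar_iff {T : BoolMatrix} {alive : List Bool} {t s : ℕ} (hT : ∀ t s, entry T t s →
    entry T s t) : isEar T alive t s ↔ bit alive t ∧ bit alive s ∧ t ≠ s ∧
      ∀ r, bit alive r → entry T t r → r = s := by
  simp only [isEar, Bool.and_eq_true, Bool.not_eq_true', decide_eq_false_iff_not, List.all_eq_true,
    List.mem_range, Bool.or_eq_true, decide_eq_true_eq, Bool.and_eq_false_iff]
  refine and_congr_right' (and_congr_right' (and_congr_right' ⟨fun h r hr htr => ?_,
    fun h r _ => ?_⟩))
  · rcases h r (entry_lt_left (hT _ _ htr)) with (h | h) | h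
    · simp [h] at hr
    · simp [h] at htr
    · exact h
  · by_cases hr : bit alive r = true
    · by_cases htr : entry T t r = true
      · exact .inr (h r hr htr)
      · exact .inl (.inr (by simpa using htr))
    · exact .inl (.inl (by simpa using hr))

theorem bit_getD {B : BoolMatrix} {s v : ℕ} : bit (B.getD s []) v = entry B s v := rfl

namespace SplitInvariant

variable {K : ℕ} {M T B : BoolMatrix} {b : ℕ} {st : SplitState}

theorem init (hD : IsDecomposition M T B b) (hK : 1 ≤ K) :
    SplitInvariant K M T B b (splitInit M T B) := by
  have h1 : ∀ t, bit (splitInit M T B).1 t ↔ t < T.length := fun t => by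
    simp [splitInit, bit_tabulate]
  have h2 : ∀ t v, entry (splitInit M T B).2.1 t v ↔
      t < T.length ∧ v < M.length ∧ entry B t v := fun t v => by
    simp [splitInit, entry_tabulate]
  have h3 : (splitInit M T B).2.2 = [] := rfl
  refine ⟨fun t => (h1 t).1, ?_, ?_, fun u v huv => ?_, fun t r v _ _ _ h _ => ((h2 t v).1 h).2.2,
    by simp [h3], by simp [h3], fun t ht => ?_, by simp [h3], by simp [h3]⟩
  · simpa only [h1] using hD.tree_connected
  · simpa only [h1] using hD.bag_connected
  · obtain ⟨t, ht, hu, hv⟩ := hD.edge_mem u v huv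
    have hu' := entry_lt_left huv
    have hv' := entry_lt_left (hD.symm u v huv)
    simp only [h1, h2]
    exact .inr ⟨t, ht, ⟨ht, hu', hu⟩, ht, hv', hv⟩
  · refine ⟨((List.range M.length).filter fun v => entry B t v).toFinset, fun u v hu _ _ => ?_, ?_⟩
    · left
      have hu := (h2 t u).1 hu
      simp [hu.2.1, hu.2.2]
    · refine (List.toFinset_card_le _).trans ((hD.bagSize_le t).trans ?_)
      nlinarith

variable {t s : ℕ}

/-- The live nodes with `v` in their bag are connected, and the only way out of `t` leads to `s`. -/
theorem bag_of_ear {r v : ℕ} (hear : ∀ r, bit st.1 r → entry T t r → r = s)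
    (h : SplitInvariant K M T B b st) (ht : bit st.1 t) (hr : bit st.1 r) (htr : t ≠ r)
    (htv : entry B t v) (hrv : entry B r v) : entry B s v := by
  obtain ⟨x, y, hx, hy, hxt, hyt, hxy⟩ := h.bag_connected v (fun r => r = t) ⟨t, ⟨ht, htv⟩, rfl⟩
    ⟨r, ⟨hr, hrv⟩, htr.symm⟩
  subst hxt
  rw [← hear y hy.1 hxy]
  exact hy.2

theorem bag_of_join {r v : ℕ} (hear : ∀ r, bit st.1 r → entry T t r → r = s)
    (h : SplitInvariant K M T B b st) (ht : bit st.1 t) (hs : bit st.1 s) (hr : bit st.1 r)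
    (htr : r ≠ t) (hsr : r ≠ s) (hrv : entry st.2.1 r v)
    (hv : entry st.2.1 t v ∨ entry st.2.1 s v) : entry B s v := by
  rcases hv with hv | hv
  · exact bag_of_ear hear h ht hr htr.symm (h.inter t r v ht hr htr.symm hv hrv)
      (h.inter r t v hr ht htr hrv hv)
  · exact h.inter s r v hs hr hsr.symm hv hrv

/-- An edge between the two parts is not covered by an earlier piece, as live parts avoid the
pieces. So it lies in a live part: that of `t`, that of `s`, or a third one, and then its end in the
part of `s` is in the bag of `s`. -/
theorem cover_join (hear : ∀ r, bit st.1 r → entry T t r → r = s)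
    (h : SplitInvariant K M T B b st) (hD : IsDecomposition M T B b) (hK : 1 ≤ K)
    (ht : bit st.1 t) (hs : bit st.1 s) : ∃ S : Finset ℕ,
    CoversPart (fun u v => entry M u v) (fun v => entry st.2.1 t v ∨ entry st.2.1 s v) S ∧
      S.card ≤ 5 * b * K := by
  obtain ⟨S₁, h1, c1⟩ := h.small t ht
  obtain ⟨S₂, h2, c2⟩ := h.small s hs
  set X := ((List.range M.length).filter fun v => entry B s v).toFinset with hX
  have hXc : X.card ≤ b := (List.toFinset_card_le _).trans (hD.bagSize_le s)
  have key : ∀ u v, entry M u v → entry st.2.1 t u → entry st.2.1 s v →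
      u ∈ S₁ ∪ S₂ ∪ X ∨ v ∈ S₁ ∪ S₂ ∪ X := by
    intro u v huv hu hv
    have hv' := entry_lt_left (hD.symm u v huv)
    simp only [Finset.mem_union]
    rcases h.edge u v huv with ⟨x, hx, hc⟩ | ⟨r, hr, hru, hrv⟩
    · have := h.disjoint x hx t u ht hu
      have := h.disjoint x hx s v hs hv
      tauto
    · by_cases hrt : r = t
      · subst hrt
        have := h1 u v hru hrv huv
        tauto
      · by_cases hrs : r = s
        · subst hrs
          have := h2 u v hru hrv huv
          tauto
        · have : v ∈ X := by
            simp [hX, hv', bag_of_join hear h ht hs hr hrt hrs hrv (.inr hv)]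
          tauto
  refine ⟨S₁ ∪ S₂ ∪ X, fun u v hu hv huv => ?_, ?_⟩
  · rcases hu with hu | hu <;> rcases hv with hv | hv
    · have := h1 u v hu hv huv
      simp only [Finset.mem_union]; tauto
    · exact key u v huv hu hv
    · exact (key v u (hD.symm _ _ huv) hv hu).symm
    · have := h2 u v hu hv huv
      simp only [Finset.mem_union]; tauto
  · have e1 := Finset.card_union_le (S₁ ∪ S₂) X
    have e2 := Finset.card_union_le S₁ S₂
    nlinarith

theorem absorb (hear : ∀ r, bit st.1 r → entry T t r → r = s)
    (h : SplitInvariant K M T B b st) (hD : IsDecomposition M T B b) (hK : 1 ≤ K)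
    (ht : bit st.1 t) (hs : bit st.1 s) (hts : t ≠ s) :
    SplitInvariant K M T B b (absorb K M T B st t s) := by
  have hU : ∀ v, bit (joinParts M.length st.2.1 t s) v ↔
      v < M.length ∧ (entry st.2.1 t v ∨ entry st.2.1 s v) := fun v => by
    simp [joinParts, bit_tabulate]
  obtain ⟨S, hS, hSc⟩ := cover_join hear h hD hK ht hs
  set U := joinParts M.length st.2.1 t s with hUdef
  have halive : ∀ r, bit (removeNode T.length st.1 t) r ↔ bit st.1 r ∧ r ≠ t := fun r => by
    simp only [removeNode, bit_tabulate, Bool.and_eq_true, Bool.not_eq_true',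
      decide_eq_false_iff_not]
    exact ⟨fun h => h.2, fun h' => ⟨h.alive_lt r h'.1, h'⟩⟩
  have hconn : CutConnected (fun t s => entry T t s)
      fun r => bit (removeNode T.length st.1 t) r := by
    simpa only [halive] using h.alive_connected.remove hD.tree_symm hear
  have hbag : ∀ v, CutConnected (fun t s => entry T t s)
      fun r => bit (removeNode T.length st.1 t) r ∧ entry B r v := by
    intro v
    have := (h.bag_connected v).remove hD.tree_symm (t := t) (s := s) fun r hr => hear r hr.1
    simpa only [halive, and_right_comm] using this
  rw [_root_.absorb, ← hUdef]
  by_cases hw : 2 * K * bagSize M.length B s < reductionWeight M U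
  · rw [decide_eq_true hw, cond_true]
    have hpart : ∀ r v, entry (tabulate T.length fun r => tabulate M.length fun v =>
        entry st.2.1 r v && !(bit U v || entry B s v)) r v ↔
        r < T.length ∧ v < M.length ∧ entry st.2.1 r v ∧ ¬bit U v ∧ ¬entry B s v := fun r v => by
      simp [entry_tabulate]
    refine ⟨fun r hr => h.alive_lt r ((halive r).1 hr).1, hconn, hbag, fun u v huv => ?_,
      fun r r' v hr hr' hne hv hv' => ?_, fun x hx r v hr hv => ?_, ?_, fun r hr => ?_, ?_, ?_⟩
    · have hu' := entry_lt_left huv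
      have hv' := entry_lt_left (hD.symm u v huv)
      simp only [halive, hpart, List.mem_cons, exists_eq_or_imp, bit_getD]
      rcases h.edge u v huv with ⟨x, hx, hc⟩ | ⟨r, hr, hru, hrv⟩
      · exact .inl (.inr ⟨x, hx, hc⟩)
      · by_cases hr' : r = t ∨ r = s
        · refine .inl (.inl (.inr (.inr ?_)))
          rw [hU, hU]
          rcases hr' with rfl | rfl <;> tauto
        -- An edge in another part either meets the bag of `s` or avoids the joined part as well,
        -- since by `bag_of_join` the joined part meets other parts only in that bag; in the latter
        -- case it stays in its part.
        · push Not at hr'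
          have e1 := fun hx => bag_of_join hear h ht hs hr hr'.1 hr'.2 hru hx
          have e2 := fun hx => bag_of_join hear h ht hs hr hr'.1 hr'.2 hrv hx
          by_cases hsu : entry B s u = true
          · exact .inl (.inl (.inl hsu))
          · by_cases hsv : entry B s v = true
            · exact .inl (.inl (.inr (.inl hsv)))
            · refine .inr ⟨r, ⟨hr, hr'.1⟩, ⟨h.alive_lt r hr, hu', hru, ?_, hsu⟩,
                h.alive_lt r hr, hv', hrv, ?_, hsv⟩
              · rw [hU]; tauto
              · rw [hU]; tauto
    · exact h.inter r r' v ((halive r).1 hr).1 ((halive r').1 hr').1 hne ((hpart _ _).1 hv).2.2.1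
        ((hpart _ _).1 hv').2.2.1
    · have hv' := (hpart _ _).1 hv
      rcases List.mem_cons.1 hx with rfl | hx
      · exact ⟨hv'.2.2.2.2, hv'.2.2.2.1⟩
      · exact h.disjoint x hx r v ((halive r).1 hr).1 hv'.2.2.1
    · refine List.pairwise_cons.2 ⟨fun y hy v hv => ?_, h.pairwise⟩
      rcases ((hU v).1 hv.1).2 with h' | h'
      · exact (h.disjoint y hy t v ht h').2 hv.2
      · exact (h.disjoint y hy s v hs h').2 hv.2
    · obtain ⟨S, hS, hSc⟩ := h.small r ((halive r).1 hr).1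
      exact ⟨S, hS.mono fun v hv => ((hpart _ _).1 hv).2.2.1, hSc⟩
    · intro x hx
      rcases List.mem_cons.1 hx with rfl | hx
      · exact hw.le
      · exact h.large x hx
    · intro x hx
      rcases List.mem_cons.1 hx with rfl | hx
      · exact ⟨S, hS.mono fun v hv => ((hU v).1 hv).2, hSc⟩
      · exact h.bounded x hx
  · rw [decide_eq_false hw, cond_false]
    have hpart : ∀ r v, entry (tabulate T.length fun r => tabulate M.length fun v =>
        bif decide (r = s) then bit U v else entry st.2.1 r v) r v ↔
        r < T.length ∧ v < M.length ∧ ((r = s ∧ (entry st.2.1 t v ∨ entry st.2.1 s v)) ∨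
          (r ≠ s ∧ entry st.2.1 r v)) := fun r v => by
      rw [entry_tabulate]
      refine and_congr_right' (and_congr_right fun hv => ?_)
      by_cases hr : r = s
      · simp [hr, hU, hv]
      · simp [hr]
    refine ⟨fun r hr => h.alive_lt r ((halive r).1 hr).1, hconn, hbag, fun u v huv => ?_,
      fun r r' v hr hr' hne hv hv' => ?_, fun x hx r v hr hv => ?_, h.pairwise, fun r hr => ?_,
      h.large, h.bounded⟩
    · have hu' := entry_lt_left huv
      have hv' := entry_lt_left (hD.symm u v huv)
      simp only [halive, hpart]
      rcases h.edge u v huv with hx | ⟨r, hr, hru, hrv⟩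
      · exact .inl hx
      · by_cases hr' : r = t ∨ r = s
        · refine .inr ⟨s, ⟨hs, hts.symm⟩, ⟨h.alive_lt s hs, hu', .inl ⟨rfl, ?_⟩⟩,
            h.alive_lt s hs, hv', .inl ⟨rfl, ?_⟩⟩
          · rcases hr' with rfl | rfl <;> tauto
          · rcases hr' with rfl | rfl <;> tauto
        · push Not at hr'
          exact .inr ⟨r, ⟨hr, hr'.1⟩, ⟨h.alive_lt r hr, hu', .inr ⟨hr'.2, hru⟩⟩,
            h.alive_lt r hr, hv', .inr ⟨hr'.2, hrv⟩⟩
    · obtain ⟨har, hrt⟩ := (halive r).1 hr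
      obtain ⟨har', hrt'⟩ := (halive r').1 hr'
      rcases ((hpart _ _).1 hv).2.2 with ⟨rfl, h1⟩ | ⟨h0, h1⟩ <;>
        rcases ((hpart _ _).1 hv').2.2 with ⟨rfl, h2⟩ | ⟨h0', h2⟩
      · exact absurd rfl hne
      · exact bag_of_join hear h ht hs har' hrt' h0' h2 h1
      · rcases h2 with h2 | h2
        · exact h.inter r t v har ht hrt h1 h2
        · exact h.inter r r' v har hs hne h1 h2
      · exact h.inter r r' v har har' hne h1 h2
    · rcases ((hpart _ _).1 hv).2.2 with ⟨rfl, h1 | h1⟩ | ⟨h0, h1⟩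
      · exact h.disjoint x hx t v ht h1
      · exact h.disjoint x hx r v hs h1
      · exact h.disjoint x hx r v ((halive r).1 hr).1 h1
    · by_cases hrs : r = s
      -- The taken and the rest vertices cover the joined part, and they number at most its weight,
      -- which the failed test bounds by `2 * K * b`.
      · refine ⟨(takenVertices M U ++ restVertices M U).toFinset, fun u v hu hv huv => ?_, ?_⟩
        · have e : ∀ v, entry (tabulate T.length fun r => tabulate M.length fun v =>
              bif decide (r = s) then bit U v else entry st.2.1 r v) r v → bit U v := fun v hv => by
            rw [hpart] at hv
            rw [hU]
            tauto
          have := taken_or_rest_of_adj hD.symm (e u hu) (e v hv) huv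
          simp only [List.mem_toFinset, List.mem_append]
          tauto
        · refine (List.toFinset_card_le _).trans ?_
          have := hD.bagSize_le s
          rw [reductionWeight] at hw
          rw [List.length_append]
          nlinarith
      · obtain ⟨S, hS, hSc⟩ := h.small r ((halive r).1 hr).1
        refine ⟨S, hS.mono fun v hv => ?_, hSc⟩
        rw [hpart] at hv
        tauto

end SplitInvariant

theorem card_alive_absorb {K : ℕ} {M T B : BoolMatrix} {st : SplitState} {t s : ℕ}
    (ht : bit st.1 t) (htN : t < T.length) :
    ((Finset.range T.length).filter fun r => bit (absorb K M T B st t s).1 r).card + 1 =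
      ((Finset.range T.length).filter fun r => bit st.1 r).card := by
  have e : (absorb K M T B st t s).1 = removeNode T.length st.1 t := by
    rw [absorb]
    cases decide (2 * K * bagSize M.length B s <
      reductionWeight M (joinParts M.length st.2.1 t s)) <;> rfl
  have : ((Finset.range T.length).filter fun r => bit (absorb K M T B st t s).1 r) =
      ((Finset.range T.length).filter fun r => bit st.1 r).erase t := by
    ext r
    simp only [e, removeNode, Finset.mem_filter, Finset.mem_range, bit_tabulate, Finset.mem_erase,
      Bool.and_eq_true, Bool.not_eq_true', decide_eq_false_iff_not]
    tauto
  rw [this, Finset.card_erase_add_one (by simp [ht, htN])]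

/-- Every effective step removes a live node, and a step without effect means that there is no leaf,
hence at most one live node. -/
theorem splitInvariant_splitState {K : ℕ} {M T B : BoolMatrix} {b : ℕ}
    (hD : IsDecomposition M T B b) (hK : 1 ≤ K) :
    SplitInvariant K M T B b (splitState K M T B) ∧
      ((Finset.range T.length).filter fun r => bit (splitState K M T B).1 r).card ≤ 1 := by
  have key : ∀ i, SplitInvariant K M T B b ((splitStep K M T B)^[i] (splitInit M T B)) ∧
      (((Finset.range T.length).filter fun r =>
        bit ((splitStep K M T B)^[i] (splitInit M T B)).1 r).card ≤ 1 ∨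
      ((Finset.range T.length).filter fun r =>
        bit ((splitStep K M T B)^[i] (splitInit M T B)).1 r).card + i ≤ T.length) := by
    intro i
    induction i with
    | zero =>
      exact ⟨.init hD hK, .inr ((Finset.card_filter_le _ _).trans (Finset.card_range _).le)⟩
    | succ i ih =>
      rw [Function.iterate_succ_apply']
      obtain ⟨h, hc⟩ := ih
      rcases splitStep_cases K M T B ((splitStep K M T B)^[i] (splitInit M T B)) with
        ⟨e, hno⟩ | ⟨t, s, ht, hs, he, e⟩
      · rw [e]
        refine ⟨h, .inl ?_⟩
        by_contra hlt
        obtain ⟨t, s, ht, hs, hne⟩ := Finset.one_lt_card_iff.1 (not_le.1 hlt)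
        simp only [Finset.mem_filter] at ht hs
        obtain ⟨t, s, ht, hs, hne, hts⟩ := hD.exists_leaf _ h.alive_lt h.alive_connected
          ⟨t, s, ht.2, hs.2, hne⟩
        have := hno t (h.alive_lt t ht) s (h.alive_lt s hs)
        rw [(isEar_iff hD.tree_symm).2 ⟨ht, hs, hne, hts⟩] at this
        simp at this
      · rw [e]
        obtain ⟨hat, has, hne, hts⟩ := (isEar_iff hD.tree_symm).1 he
        refine ⟨.absorb hts h hD hK hat has hne, ?_⟩
        have := card_alive_absorb (K := K) (M := M) (B := B) (s := s) hat ht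
        omega
  obtain ⟨h, hc⟩ := key T.length
  refine ⟨h, ?_⟩
  rw [splitState]
  omega

/-- What the splitting achieves. -/
structure IsSplitting (K : ℕ) (M : BoolMatrix) (b : ℕ) (l : List (List Bool × List Bool)) :
    Prop where
  edge : ∀ u v, entry M u v → ∃ x ∈ l, bit x.1 u ∨ bit x.1 v ∨ (bit x.2 u ∧ bit x.2 v)
  pairwise : l.Pairwise fun x y => ∀ v, ¬(bit x.2 v ∧ bit y.2 v)
  large : ∀ x ∈ l, 2 * K * ((List.range M.length).filter fun v => bit x.1 v).length ≤
    reductionWeight M x.2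
  bounded : ∀ x ∈ l, ∃ S : Finset ℕ,
    CoversPart (fun u v => entry M u v) (fun v => bit x.2 v) S ∧ S.card ≤ 5 * b * K

/-- At most one part is left over. It becomes a piece with an empty separator, for which nothing has
to be paid, and its small cover gives the size bound. -/
theorem isSplitting_pieces {K : ℕ} {M T B : BoolMatrix} {b : ℕ} (hD : IsDecomposition M T B b)
    (hK : 1 ≤ K) : IsSplitting K M b (pieces K M T B) := by
  obtain ⟨h, hc⟩ := splitInvariant_splitState hD hK
  have hnil : ∀ v, bit [] v = false := fun v => by simp [bit]
  set st := splitState K M T B with hst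
  have hmem : ∀ x, x ∈ pieces K M T B ↔ x ∈ st.2.2 ∨
      ∃ t, bit st.1 t ∧ x = ([], st.2.1.getD t []) := by
    intro x
    simp only [pieces, ← hst, List.mem_append, List.mem_map, List.mem_filter, List.mem_range]
    refine or_congr_right (exists_congr fun t => ⟨fun h' => ⟨h'.1.2, h'.2.symm⟩,
      fun h' => ⟨⟨h.alive_lt t h'.1, h'.1⟩, h'.2.symm⟩⟩)
  refine ⟨fun u v huv => ?_, ?_, fun x hx => ?_, fun x hx => ?_⟩
  · rcases h.edge u v huv with ⟨x, hx, hc⟩ | ⟨t, ht, hu, hv⟩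
    · exact ⟨x, (hmem x).2 (.inl hx), hc⟩
    · exact ⟨_, (hmem _).2 (.inr ⟨t, ht, rfl⟩), .inr (.inr ⟨hu, hv⟩)⟩
  · rw [pieces, ← hst, List.pairwise_append]
    refine ⟨h.pairwise, ?_, fun x hx y hy v hv => ?_⟩
    · rw [List.pairwise_map]
      have hl : ((List.range T.length).filter fun t => bit st.1 t).length ≤ 1 := by
        rw [← List.toFinset_card_of_nodup (List.nodup_range.filter _)]
        convert hc using 2
        ext t
        simp
      generalize (List.range T.length).filter (fun t => bit st.1 t) = l at hl
      match l, hl with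
      | [], _ => simp
      | [a], _ => simp
    · obtain ⟨t, ht, rfl⟩ := List.mem_map.1 hy
      exact (h.disjoint x hx t v (List.mem_filter.1 ht).2 hv.2).2 hv.1
  · rcases (hmem x).1 hx with hx | ⟨t, ht, rfl⟩
    · exact h.large x hx
    · simp [hnil]
  · rcases (hmem x).1 hx with hx | ⟨t, ht, rfl⟩
    · exact h.bounded x hx
    · obtain ⟨S, hS, hSc⟩ := h.small t ht
      exact ⟨S, hS, hSc.trans (by nlinarith [Nat.zero_le (b * K)])⟩

/-! ### Encodings of vectors and matrices -/

section

open Classical in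
/-- The characteristic vector of a predicate. -/
noncomputable def boolVector {n : ℕ} (P : Fin n → Prop) : List Bool :=
  List.ofFn fun i => decide (P i)

/-- The characteristic matrix of a relation. -/
noncomputable def boolMatrix {m n : ℕ} (R : Fin m → Fin n → Prop) : BoolMatrix :=
  List.ofFn fun i => boolVector (R i)

theorem enc_boolVector {n : ℕ} (P : Fin n → Prop) : enc (boolVector P) = .ofVector P := by
  simp only [boolVector, BinTree.ofVector, enc, List.map_ofFn]
  rfl

theorem enc_boolMatrix {m n : ℕ} (R : Fin m → Fin n → Prop) : enc (boolMatrix R) = .ofMatrix R := by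
  simp only [boolMatrix, BinTree.ofMatrix, ← enc_boolVector]
  simp only [enc, List.map_ofFn]
  rfl

theorem bit_boolVector {n : ℕ} {P : Fin n → Prop} {i : ℕ} :
    bit (boolVector P) i ↔ ∃ h : i < n, P ⟨i, h⟩ := by
  rcases lt_or_ge i n with h | h
  · simp [bit, boolVector, List.getD_eq_getElem?_getD, h]
  · simp [bit, boolVector, List.getD_eq_getElem?_getD, h]

theorem entry_boolMatrix {m n : ℕ} {R : Fin m → Fin n → Prop} {i j : ℕ} :
    entry (boolMatrix R) i j ↔ ∃ (hi : i < m) (hj : j < n), R ⟨i, hi⟩ ⟨j, hj⟩ := by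
  rcases lt_or_ge i m with h | h
  · have : (boolMatrix R).getD i [] = boolVector (R ⟨i, h⟩) := by
      simp [boolMatrix, List.getD_eq_getElem?_getD, h]
    rw [entry, this, bit_boolVector]
    simp [h]
  · have : (boolMatrix R).getD i [] = [] := by
      simp [boolMatrix, List.getD_eq_getElem?_getD, h]
    rw [entry, this]
    simp [bit, h]

theorem length_boolVector {n : ℕ} (P : Fin n → Prop) : (boolVector P).length = n := by
  simp [boolVector]

theorem length_boolMatrix {m n : ℕ} (R : Fin m → Fin n → Prop) : (boolMatrix R).length = m := by
  simp [boolMatrix]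

theorem boolVector_eq_iff {n : ℕ} {P : Fin n → Prop} {l : List Bool} (hl : l.length = n)
    (h : ∀ i, bit l i ↔ ∃ h : i < n, P ⟨i, h⟩) : l = boolVector P := by
  refine List.ext_getElem (by rw [hl, length_boolVector]) fun i h1 h2 => ?_
  have e : ∀ (l : List Bool) (h : i < l.length), l[i] = bit l i := fun l h => by
    rw [bit, List.getD_eq_getElem _ _ h]
  rw [e, e, Bool.eq_iff_iff, h, bit_boolVector]

end

/-! ### Instances as decompositions -/

theorem cutConnected_of_preconnected {V : Type} {G : SimpleGraph V} (hG : G.Preconnected)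
    {T : ℕ → ℕ → Prop} (f : V → ℕ) (hf : ∀ a b, G.Adj a b → T (f a) (f b)) :
    CutConnected T fun t => ∃ a, f a = t := by
  rintro X ⟨-, ⟨a, rfl⟩, ha⟩ ⟨-, ⟨b, rfl⟩, hb⟩
  obtain ⟨p⟩ := hG a b
  obtain ⟨d, -, h1, h2⟩ := p.exists_boundary_dart {c | X (f c)} ha hb
  exact ⟨f d.fst, f d.snd, ⟨_, rfl⟩, ⟨_, rfl⟩, h1, h2, hf _ _ d.adj⟩

/-- A cut-connected set of nodes induces a tree, and a nontrivial finite tree has a vertex of degree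
one. Connectedness comes from cutting at the set of nodes reachable from `x`. -/
theorem exists_leaf_of_isAcyclic {N : ℕ} {G : SimpleGraph (Fin N)} (hG : G.IsAcyclic)
    {A : ℕ → Prop} (hA : ∀ t, A t → t < N)
    (hconn : CutConnected (fun t s => entry (boolMatrix G.Adj) t s) A)
    (h2 : ∃ t s, A t ∧ A s ∧ t ≠ s) :
    ∃ t s, A t ∧ A s ∧ t ≠ s ∧ ∀ r, A r → entry (boolMatrix G.Adj) t r → r = s := by
  classical
  obtain ⟨a, b, ha, hb, hab⟩ := h2
  set S : Set (Fin N) := {t | A t} with hS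
  have hmem : ∀ t (ht : A t), (⟨t, hA t ht⟩ : Fin N) ∈ S := fun t ht => ht
  have : Nontrivial S := ⟨⟨⟨a, hA a ha⟩, hmem a ha⟩, ⟨⟨b, hA b hb⟩, hmem b hb⟩, by simpa using hab⟩
  have hpre : (G.induce S).Preconnected := by
    intro x y
    by_contra hxy
    obtain ⟨t, s, ht, hs, ⟨ht', hXt⟩, hXs, hts⟩ := hconn
      (fun t => ∃ h : A t, (G.induce S).Reachable x ⟨⟨t, hA t h⟩, hmem t h⟩)
      ⟨x.1, x.2, x.2, .refl _⟩ ⟨y.1, y.2, fun h => hxy h.2⟩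
    obtain ⟨h1, h2, hadj⟩ := entry_boolMatrix.1 hts
    refine hXs ⟨hs, hXt.trans (SimpleGraph.Adj.reachable ?_)⟩
    simpa using hadj
  have htree : (G.induce S).IsTree := ⟨⟨hpre⟩, hG.induce S⟩
  obtain ⟨t, ht⟩ := htree.exists_vert_degree_one_of_nontrivial
  obtain ⟨s, hs, huniq⟩ := SimpleGraph.degree_eq_one_iff_existsUnique_adj.1 ht
  refine ⟨t.1, s.1, t.2, s.2, fun h => hs.ne (Subtype.ext (Fin.ext h)), fun r hr htr => ?_⟩
  obtain ⟨h1, h2, hadj⟩ := entry_boolMatrix.1 htr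
  have := huniq ⟨⟨r, h2⟩, hr⟩ (by simpa using hadj)
  rw [← this]

namespace GraphWithTD

variable (I : GraphWithTD)

/-- The matrices that describe the instance. -/
noncomputable def matrices : BoolMatrix × BoolMatrix × BoolMatrix :=
  (boolMatrix I.graph.Adj, boolMatrix I.dec.tree.Adj, boolMatrix fun t v => v ∈ I.dec.bag t)

theorem enc_matrices : enc I.matrices = I.encode := by
  simp only [matrices, encode, enc_pair, enc_boolMatrix]

/-- The size of the largest bag. -/
def maxBag : ℕ := Finset.univ.sup fun t => (I.dec.bag t).card

theorem isDecomposition :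
    IsDecomposition I.matrices.1 I.matrices.2.1 I.matrices.2.2 I.maxBag := by
  have hsymm : ∀ {n : ℕ} (G : SimpleGraph (Fin n)) u v, entry (boolMatrix G.Adj) u v →
      entry (boolMatrix G.Adj) v u := fun G u v h => by
    obtain ⟨hu, hv, h⟩ := entry_boolMatrix.1 h
    exact entry_boolMatrix.2 ⟨hv, hu, h.symm⟩
  have hN : I.matrices.2.1.length = I.numNodes := length_boolMatrix _
  refine ⟨hsymm _, hsymm _, fun u v huv => ?_, ?_, fun v => ?_, fun A hA h h2 => ?_, fun t => ?_⟩
  · obtain ⟨hu, hv, huv⟩ := entry_boolMatrix.1 huv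
    obtain ⟨t, h1, h2⟩ := I.dec.edge_mem _ _ huv
    refine ⟨t, t.2.trans_eq hN.symm, ?_, ?_⟩
    · exact entry_boolMatrix.2 ⟨t.2, hu, h1⟩
    · exact entry_boolMatrix.2 ⟨t.2, hv, h2⟩
  · have := cutConnected_of_preconnected (T := fun t s => entry I.matrices.2.1 t s)
      I.dec.isTree.connected.preconnected Fin.val
      fun a b hab => entry_boolMatrix.2 ⟨a.2, b.2, hab⟩
    convert this using 2 with t
    rw [hN]
    exact ⟨fun h => ⟨⟨t, h⟩, rfl⟩, fun ⟨a, ha⟩ => ha ▸ a.2⟩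
  · rcases lt_or_ge v I.n with hv | hv
    · have := cutConnected_of_preconnected (T := fun t s => entry I.matrices.2.1 t s)
        (I.dec.connected ⟨v, hv⟩).preconnected (fun a => a.1.1)
        fun a b hab => entry_boolMatrix.2 ⟨a.1.2, b.1.2, by simpa using hab⟩
      convert this using 2 with t
      rw [hN]
      constructor
      · rintro ⟨-, h⟩
        obtain ⟨h1, h2, h⟩ := entry_boolMatrix.1 h
        exact ⟨⟨⟨t, h1⟩, h⟩, rfl⟩
      · rintro ⟨a, rfl⟩
        exact ⟨a.1.2, entry_boolMatrix.2 ⟨a.1.2, hv, a.2⟩⟩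
    · rintro X ⟨t, ⟨-, ht⟩, -⟩
      obtain ⟨-, h, -⟩ := entry_boolMatrix.1 ht
      omega
  · exact exists_leaf_of_isAcyclic I.dec.isTree.isAcyclic (fun t ht => (hA t ht).trans_eq hN) h h2
  · rw [bagSize, ← List.toFinset_card_of_nodup (List.nodup_range.filter _)]
    by_cases ht : t < I.numNodes
    · refine le_trans ?_ (Finset.le_sup (f := fun t => (I.dec.bag t).card)
        (Finset.mem_univ ⟨t, ht⟩))
      rw [← Finset.card_map Fin.valEmbedding]
      refine Finset.card_le_card fun v hv => ?_
      simp only [List.mem_toFinset, List.mem_filter] at hv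
      obtain ⟨h1, h2, h⟩ := entry_boolMatrix.1 hv.2
      exact Finset.mem_map.2 ⟨⟨v, h2⟩, h, rfl⟩
    · have : ∀ v, entry I.matrices.2.2 t v = false := fun v => by
        rw [← Bool.not_eq_true]
        intro h
        exact ht (entry_boolMatrix.1 h).1
      simp [this]

/-- Width 0 is special because `f 0 = 0` although a bag may contain a vertex; without edges the
reduction leaves nothing to ask. -/
theorem not_entry_of_width_eq_zero (h : I.dec.width = 0) (u v : ℕ) :
    ¬entry I.matrices.1 u v := by
  intro huv
  obtain ⟨hu, hv, huv⟩ := entry_boolMatrix.1 huv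
  obtain ⟨t, h1, h2⟩ := I.dec.edge_mem _ _ huv
  have : 1 < (I.dec.bag t).card := Finset.one_lt_card.2 ⟨_, h1, _, h2, huv.ne⟩
  have : (I.dec.bag t).card ≤ Finset.univ.sup fun t => (I.dec.bag t).card :=
    Finset.le_sup (f := fun t => (I.dec.bag t).card) (Finset.mem_univ t)
  rw [TreeDecomposition.width] at h
  omega

theorem maxBag_le (h : I.dec.width ≠ 0) : I.maxBag ≤ 2 * I.dec.width := by
  rw [TreeDecomposition.width] at *
  rw [maxBag]
  omega

end GraphWithTD

/-! ### The queries -/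

section

variable {M : BoolMatrix}

/-- The subgraph induced by a list of vertices, with the tree decomposition of one bag. -/
def queryInstance (hM : ∀ u v, entry M u v → entry M v u) (hM' : ∀ u, ¬entry M u u)
    (R : List ℕ) : GraphWithTD where
  n := R.length
  graph :=
    { Adj := fun i j => entry M R[i] R[j]
      symm := ⟨fun i j h => hM _ _ h⟩
      loopless := ⟨fun i h => hM' _ h⟩ }
  numNodes := 1
  dec :=
    { tree := ⊥
      isTree := .of_subsingleton
      bag := fun _ => Finset.univ
      vertex_mem := fun v => ⟨0, Finset.mem_univ v⟩
      edge_mem := fun u v _ => ⟨0, Finset.mem_univ u, Finset.mem_univ v⟩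
      connected := fun v =>
        haveI : Nonempty {t : Fin 1 | v ∈ Finset.univ} := ⟨⟨0, Finset.mem_univ v⟩⟩
        ⟨.of_subsingleton⟩ }

variable (hM : ∀ u v, entry M u v → entry M v u) (hM' : ∀ u, ¬entry M u u) (R : List ℕ)

theorem boolVector_eq_map (P : Fin R.length → Prop) (f : ℕ → Bool)
    (h : ∀ i : Fin R.length, P i ↔ f R[i]) : boolVector P = R.map f := by
  refine List.ext_getElem (by simp [boolVector]) fun i h1 h2 => ?_
  simp [boolVector, h]

theorem boolMatrix_eq_map (P : Fin R.length → Fin R.length → Prop) (f : ℕ → ℕ → Bool)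
    (h : ∀ i j : Fin R.length, P i j ↔ f R[i] R[j]) :
    boolMatrix P = R.map fun u => R.map (f u) := by
  refine List.ext_getElem (by simp [boolMatrix]) fun i h1 h2 => ?_
  simp only [boolMatrix, List.getElem_ofFn, List.getElem_map]
  exact boolVector_eq_map R _ _ fun j => h _ j

theorem matrices_queryInstance : (queryInstance hM hM' R).matrices = makeQuery M R := by
  have e1 : boolMatrix (queryInstance hM hM' R).graph.Adj =
      R.map fun u => R.map fun v => entry M u v := boolMatrix_eq_map R _ _ fun i j => Iff.rfl
  have e2 : boolMatrix (queryInstance hM hM' R).dec.tree.Adj = [[false]] := by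
    change boolMatrix (⊥ : SimpleGraph (Fin 1)).Adj = _
    simp [boolMatrix, boolVector]
  have e3 : (boolMatrix fun t v => v ∈ (queryInstance hM hM' R).dec.bag t) =
      [R.map fun _ => true] := by
    change boolMatrix (fun (_ : Fin 1) (v : Fin R.length) => v ∈ Finset.univ) = _
    rw [← boolVector_eq_map R (fun v => v ∈ Finset.univ) (fun _ => true) fun v => by simp]
    simp [boolMatrix]
  rw [GraphWithTD.matrices, makeQuery, e1, e2, e3]

theorem enc_makeQuery : enc (makeQuery M R) = (queryInstance hM hM' R).encode := by
  rw [← matrices_queryInstance hM hM', GraphWithTD.enc_matrices]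

theorem encLen_makeQuery_le : encLen (makeQuery M R) ≤ 4 * R.length ^ 2 + 6 * R.length + 20 := by
  have h1 : encLen (R.map fun u => R.map fun v => entry M u v) ≤
      1 + R.length * (1 + R.length * 4 + 1) := by
    refine encLen_list_le' (fun l hl => ?_) (by simp)
    obtain ⟨u, -, rfl⟩ := List.mem_map.1 hl
    exact encLen_list_le' (fun _ _ => encLen_bool_le _) (by simp)
  have h2 : encLen (R.map fun _ => true) ≤ 1 + R.length * 4 :=
    encLen_list_le' (fun _ _ => encLen_bool_le _) (by simp)
  have h3 : encLen false = 1 := rfl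
  simp only [makeQuery, encLen_pair, encLen_cons, encLen_nil, h3]
  nlinarith

/-- The single bag is written as a vector of ones, and no characteristic vector of a solution is
longer. This bounds the answers by the queries. -/
theorem le_encLen_makeQuery : 1 + 4 * R.length ≤ encLen (makeQuery M R) := by
  have h : encLen (R.map fun _ => true) = 1 + 4 * R.length := by
    induction R with
    | nil => rfl
    | cons a l ih =>
      have : encLen true = 3 := rfl
      rw [List.map_cons, encLen_cons, ih, List.length_cons, this]; ring
  simp only [makeQuery, encLen_pair, encLen_cons, h]
  omega

/-- The properties of the answers to the queries. -/
structure IsAnswer (M : BoolMatrix) (c : ℝ) (O : BinTree → BinTree) (R : List ℕ)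
    (ans : List Bool) (S : Finset ℕ) : Prop where
  answer : O (enc (makeQuery M R)) = enc ans
  length : ans.length = R.length
  mem_iff : ∀ v, v ∈ S ↔ ∃ j < R.length, R.getD j 0 = v ∧ bit ans j
  covers : CoversPart (fun u v => entry M u v) (fun v => v ∈ R) S
  card_le : ∀ S' : Finset ℕ, CoversPart (fun u v => entry M u v) (fun v => v ∈ R) S' →
    (S.card : ℝ) ≤ c * (R.toFinset ∩ S').card

theorem exists_answer (hM : ∀ u v, entry M u v → entry M v u) (hM' : ∀ u, ¬entry M u u)
    {R : List ℕ} {c : ℝ} (hc : 1 ≤ c) {O : BinTree → BinTree}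
    (hO : vertexCoverTW.IsApproxOracle c O) (hR : R.Nodup) :
    ∃ ans S, IsAnswer M c O R ans S := by
  classical
  obtain ⟨s, hs, hsc⟩ := hO (queryInstance hM hM' R)
  obtain ⟨s, hcov⟩ := s
  change Finset (Fin R.length) at s
  change (s.card : ℝ) ≤ _ at hsc
  have hget : ∀ j (h : j < R.length), R.getD j 0 = R[j] := fun j h => List.getD_eq_getElem _ _ h
  refine ⟨boolVector fun v => v ∈ s, s.image fun i => R[i], ?_, length_boolVector _, fun v => ?_,
    fun u v hu hv huv => ?_, fun S' hS' => ?_⟩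
  · rw [enc_makeQuery hM hM', enc_boolVector]
    exact hs
  · simp only [Finset.mem_image, bit_boolVector]
    constructor
    · rintro ⟨i, hi, rfl⟩
      exact ⟨i, i.2, hget i i.2, i.2, hi⟩
    · rintro ⟨j, hj, rfl, _, h⟩
      exact ⟨⟨j, hj⟩, h, (hget j hj).symm⟩
  · obtain ⟨i, hi, rfl⟩ := List.mem_iff_getElem.1 hu
    obtain ⟨j, hj, rfl⟩ := List.mem_iff_getElem.1 hv
    rcases hcov (v := ⟨i, hi⟩) (w := ⟨j, hj⟩) huv with h | h
    · exact .inl (Finset.mem_image.2 ⟨_, h, rfl⟩)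
    · exact .inr (Finset.mem_image.2 ⟨_, h, rfl⟩)
  · refine (Nat.cast_le.2 Finset.card_image_le).trans (hsc.trans ?_)
    gcongr
    -- Any cover restricts to a solution of the query, which bounds the optimum of the query from
    -- above.
    set s' : Finset (Fin R.length) := Finset.univ.filter fun i => R[i] ∈ S' with hs'
    have hs'c : (queryInstance hM hM' R).graph.IsVertexCover (s' : Set (Fin R.length)) := by
      intro i j hij
      rcases hS' R[i] R[j] (List.getElem_mem _) (List.getElem_mem _) hij with h | h
      · exact .inl (Finset.mem_filter.2 ⟨Finset.mem_univ _, h⟩)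
      · exact .inr (Finset.mem_filter.2 ⟨Finset.mem_univ _, h⟩)
    refine le_trans (Nat.sInf_le ⟨⟨s', hs'c⟩, rfl⟩) ?_
    change s'.card ≤ _
    refine Finset.card_le_card_of_injOn (fun i : Fin R.length => R[i]) (fun i hi => ?_) fun i _ j _ hij => ?_
    · have hi : i ∈ s' := hi
      simp only [Finset.coe_inter, Set.mem_inter_iff, Finset.mem_coe, List.mem_toFinset]
      exact ⟨List.getElem_mem _, (Finset.mem_filter.1 hi).2⟩
    · exact Fin.ext (hR.getElem_inj_iff.1 hij)

end

/-! ### The output -/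

theorem Finset.card_le_sum_of_forall_mem {α : Type} (l : List α) (Φ : α → Finset ℕ) (F : Finset ℕ)
    (h : ∀ v ∈ F, ∃ x ∈ l, v ∈ Φ x) : F.card ≤ (l.map fun x => (Φ x).card).sum := by
  classical
  induction l generalizing F with
  | nil =>
    have : F = ∅ := Finset.eq_empty_of_forall_notMem fun v hv => by simpa using h v hv
    simp [this]
  | cons a l ih =>
    have h1 := ih (F \ Φ a) fun v hv => by
      obtain ⟨h1, h2⟩ := Finset.mem_sdiff.1 hv
      obtain ⟨x, hx, hvx⟩ := h v h1
      rcases List.mem_cons.1 hx with rfl | hx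
      · exact absurd hvx h2
      · exact ⟨x, hx, hvx⟩
    have h2 := Finset.card_le_card_sdiff_add_card (s := F) (t := Φ a)
    rw [List.map_cons, List.sum_cons]
    omega

theorem List.sum_card_filter_le (l : List (List Bool × List Bool))
    (h : l.Pairwise fun x y => ∀ v, ¬(bit x.2 v ∧ bit y.2 v)) (S : Finset ℕ) :
    (l.map fun x => (S.filter fun v => bit x.2 v).card).sum ≤ S.card := by
  induction l generalizing S with
  | nil => simp
  | cons a l ih =>
    rw [List.pairwise_cons] at h
    have h1 := ih h.2 (S.filter fun v => ¬bit a.2 v)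
    have h2 := Finset.card_filter_add_card_filter_not (s := S) (fun v => bit a.2 v = true)
    have h3 : (l.map fun x => ((S.filter fun v => ¬bit a.2 v).filter fun v => bit x.2 v).card) =
        l.map fun x => (S.filter fun v => bit x.2 v).card := by
      refine List.map_congr_left fun x hx => ?_
      congr 1
      ext v
      have := h.1 x hx v
      simp only [Finset.mem_filter]
      tauto
    rw [h3] at h1
    rw [List.map_cons, List.sum_cons]
    omega

/-- The weight is twice an LP optimum on the piece, hence at most twice what `S` spends there. -/
theorem card_filter_separator_le {K : ℕ} {M : BoolMatrix}
    (hM : ∀ u v, entry M u v → entry M v u) {x : List Bool × List Bool}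
    (hx : 2 * K * ((List.range M.length).filter fun v => bit x.1 v).length ≤
      reductionWeight M x.2) {S : Finset ℕ} (hS : CoversPart (fun u v => entry M u v) ⊤ S) :
    K * ((List.range M.length).filter fun v => bit x.1 v).length ≤
      (S.filter fun v => bit x.2 v).card := by
  have h1 := length_taken_add_le (W := x.2) hM (hS.mono fun _ _ => trivial)
  have h2 := length_rest_le (W := x.2) hM (hS.mono fun _ _ => trivial)
  rw [reductionWeight, mul_assoc] at hx
  omega

/-- The vertices that the cover gets from one piece. -/
def pieceCover (M : BoolMatrix) (x : List Bool × List Bool) (S : Finset ℕ) : Finset ℕ :=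
  ((List.range M.length).filter fun v => bit x.1 v).toFinset ∪ (takenVertices M x.2).toFinset ∪ S

/-- With `w` the share of `S'` in the piece, the separator costs at most `ε * w`, and the taken
vertices together with the answer at most `c * (t + r) ≤ c * w`. The error of the oracle is thus not
compounded. -/
theorem card_pieceCover_le {K : ℕ} {M : BoolMatrix} {c ε : ℝ} (hc : 1 ≤ c) (hε : 0 < ε)
    (hK : 1 ≤ ε * K) (hM : ∀ u v, entry M u v → entry M v u) {x : List Bool × List Bool}
    (hx : 2 * K * ((List.range M.length).filter fun v => bit x.1 v).length ≤
      reductionWeight M x.2) {O : BinTree → BinTree} {ans : List Bool} {S S' : Finset ℕ}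
    (hS : IsAnswer M c O (restVertices M x.2) ans S)
    (hS' : CoversPart (fun u v => entry M u v) ⊤ S') :
    ((pieceCover M x S).card : ℝ) ≤ (1 + ε) * c * (S'.filter fun v => bit x.2 v).card := by
  have h1 := card_filter_separator_le hM hx hS'
  have h2 := length_taken_add_le (W := x.2) hM (hS'.mono fun _ _ => trivial)
  have h3 := hS.card_le S' (hS'.mono fun _ _ => trivial)
  have h4 : (pieceCover M x S).card ≤
      ((List.range M.length).filter fun v => bit x.1 v).length +
        (takenVertices M x.2).length + S.card :=
    (Finset.card_union_le _ _).trans (add_le_add_left ((Finset.card_union_le _ _).trans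
      (add_le_add (List.toFinset_card_le _) (List.toFinset_card_le _))) _)
  set m := ((List.range M.length).filter fun v => bit x.1 v).length
  set t := (takenVertices M x.2).length
  set r := ((restVertices M x.2).toFinset ∩ S').card
  set w := (S'.filter fun v => bit x.2 v).card
  have h1' : (K : ℝ) * m ≤ w := by exact_mod_cast h1
  have h2' : (t : ℝ) + r ≤ w := by exact_mod_cast h2
  have h4' : ((pieceCover M x S).card : ℝ) ≤ m + t + S.card := by exact_mod_cast h4
  have hm : (m : ℝ) ≤ ε * w := by
    calc (m : ℝ) ≤ ε * K * m := le_mul_of_one_le_left (Nat.cast_nonneg m) hK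
      _ = ε * (K * m) := by ring
      _ ≤ ε * w := by gcongr
  have hw : (0 : ℝ) ≤ w := Nat.cast_nonneg w
  have ht : (t : ℝ) ≤ c * t := le_mul_of_one_le_left (Nat.cast_nonneg t) hc
  have h5 : c * (t + r) ≤ c * w := by gcongr
  have h6 : ε * w ≤ c * (ε * w) := le_mul_of_one_le_left (by positivity) hc
  nlinarith

theorem coveredBy_iff {M : BoolMatrix} {c : ℝ} {O : BinTree → BinTree} {x : List Bool × List Bool}
    {ans : List Bool} {S : Finset ℕ} (h : IsAnswer M c O (restVertices M x.2) ans S) (v : ℕ) :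
    coveredBy (makeItem M x, ans) v ↔ v ∈ pieceCover M x S := by
  simp only [coveredBy, Bool.or_eq_true, List.any_eq_true, decide_eq_true_eq, Bool.and_eq_true,
    List.mem_range, exists_eq_right]
  simp only [makeItem, pieceCover, Finset.mem_union, List.mem_toFinset, h.mem_iff,
    List.mem_append]

theorem List.sum_map_le_mul {α : Type} (l : List α) (f g : α → ℕ) {a : ℝ}
    (h : ∀ x ∈ l, (f x : ℝ) ≤ a * g x) : ((l.map f).sum : ℝ) ≤ a * (l.map g).sum := by
  induction l with
  | nil => simp
  | cons b l ih =>
    have h1 := h b List.mem_cons_self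
    have h2 := ih fun x hx => h x (List.mem_cons_of_mem _ hx)
    simp only [List.map_cons, List.sum_cons, Nat.cast_add, mul_add]
    linarith

namespace GraphWithTD

variable (I : GraphWithTD)

theorem length_matrices : I.matrices.1.length = I.n := length_boolMatrix _

theorem not_entry_self (u : ℕ) : ¬entry I.matrices.1 u u := by
  intro h
  obtain ⟨_, _, h⟩ := entry_boolMatrix.1 h
  exact h.ne rfl

/-- The constant is `20 = 2 * 5 * 2`: rest against cover, cover against `b * K`, and `b` against the
width. -/
theorem length_rest_le {K : ℕ} (hK : 1 ≤ K) {x : List Bool × List Bool}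
    (hx : x ∈ pieces K I.matrices.1 I.matrices.2.1 I.matrices.2.2) :
    (restVertices I.matrices.1 x.2).length ≤ 20 * K * I.dec.width := by
  have hD := I.isDecomposition
  by_cases hw : I.dec.width = 0
  · have : restVertices I.matrices.1 x.2 = [] := by
      refine List.eq_nil_iff_forall_not_mem.2 fun v hv => ?_
      obtain ⟨w, hw'⟩ := exists_adj_of_mem_rest hD.symm hv
      exact I.not_entry_of_width_eq_zero hw _ _ (adjIn_iff.1 hw').2.2
    simp [this]
  · obtain ⟨S, hS, hSc⟩ := (isSplitting_pieces hD hK).bounded x hx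
    have h1 := _root_.length_rest_le (W := x.2) hD.symm (hS.mono fun v hv => by
      obtain ⟨w, hw'⟩ := exists_adj_of_mem_rest hD.symm hv
      exact (adjIn_iff.1 hw').1)
    have h2 := Finset.card_le_card (Finset.inter_subset_right
      (s₁ := (restVertices I.matrices.1 x.2).toFinset) (s₂ := S))
    have h3 := Nat.mul_le_mul_right K (I.maxBag_le hw)
    nlinarith

theorem isApproxSolution_compose {K : ℕ} {c ε : ℝ} (hK : 1 ≤ K) (hc : 1 ≤ c) (hε : 0 < ε)
    (hεK : 1 ≤ ε * K) {O : BinTree → BinTree} {A : List ℕ → List Bool} {S : List ℕ → Finset ℕ}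
    (hA : ∀ R : List ℕ, R.Nodup → IsAnswer I.matrices.1 c O R (A R) (S R)) :
    vertexCoverTW.IsApproxSolution ((1 + ε) * c) I (enc (composeCover I.matrices
      ((queryItems K I.matrices).map fun x => (x, A x.2.2)).reverse)) := by
  classical
  have hD := I.isDecomposition
  have hn := I.length_matrices
  set M := I.matrices.1 with hM
  set l := pieces K M I.matrices.2.1 I.matrices.2.2 with hl
  have hspl : IsSplitting K M I.maxBag l := isSplitting_pieces hD hK
  set Φ : List Bool × List Bool → Finset ℕ := fun x => pieceCover M x (S (restVertices M x.2))
  have hAx : ∀ x : List Bool × List Bool, IsAnswer M c O (restVertices M x.2)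
      (A (restVertices M x.2)) (S (restVertices M x.2)) := fun x => hA _ nodup_restVertices
  set F : Finset ℕ := (Finset.range I.n).filter fun v => ∃ x ∈ l, v ∈ Φ x with hF
  have hmem : ∀ v, bit (composeCover I.matrices
      ((queryItems K I.matrices).map fun x => (x, A x.2.2)).reverse) v ↔ v ∈ F := by
    intro v
    rw [composeCover, bit_tabulate, hF, Finset.mem_filter, Finset.mem_range, ← hn, ← hM]
    refine and_congr_right fun _ => ?_
    simp only [List.any_eq_true, List.mem_reverse, List.mem_map, queryItems, ← hM, ← hl]
    constructor
    · rintro ⟨-, ⟨-, ⟨x, hx, rfl⟩, rfl⟩, hv⟩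
      exact ⟨x, hx, (coveredBy_iff (hAx x) v).1 hv⟩
    · rintro ⟨x, hx, hv⟩
      exact ⟨_, ⟨_, ⟨x, hx, rfl⟩, rfl⟩, (coveredBy_iff (hAx x) v).2 hv⟩
  have hlt : ∀ u v, entry M u v → u < I.n := fun u v h => hn ▸ entry_lt_left h
  have hFcov : ∀ u v, entry M u v → u ∈ F ∨ v ∈ F := by
    intro u v huv
    have hu := hlt u v huv
    have hv := hlt v u (hD.symm _ _ huv)
    have hin : ∀ w, w < I.n → ∀ x ∈ l, (bit x.1 w ∨ w ∈ takenVertices M x.2 ∨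
        w ∈ S (restVertices M x.2)) → w ∈ F := by
      intro w hw x hx h
      rw [hF, Finset.mem_filter, Finset.mem_range]
      refine ⟨hw, x, hx, ?_⟩
      simp only [Φ, pieceCover, Finset.mem_union, List.mem_toFinset, List.mem_filter,
        List.mem_range, hn, hw, true_and]
      tauto
    obtain ⟨x, hx, h | h | ⟨h1, h2⟩⟩ := hspl.edge u v huv
    · exact .inl (hin u hu x hx (.inl h))
    · exact .inr (hin v hv x hx (.inl h))
    · rcases taken_or_rest_of_adj hD.symm h1 h2 huv with h | h | ⟨h1, h2⟩
      · exact .inl (hin u hu x hx (.inr (.inl h)))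
      · exact .inr (hin v hv x hx (.inr (.inl h)))
      · exact ((hAx x).covers u v h1 h2 huv).imp (fun h => hin u hu x hx (.inr (.inr h)))
          fun h => hin v hv x hx (.inr (.inr h))
  set s : Finset (Fin I.n) := Finset.univ.filter fun v => v.1 ∈ F with hs
  have hentry : ∀ u v : Fin I.n, I.graph.Adj u v → entry M u v := fun u v h =>
    entry_boolMatrix.2 ⟨u.2, v.2, h⟩
  have hscov : I.graph.IsVertexCover (s : Set (Fin I.n)) := by
    intro u v huv
    exact (hFcov u v (hentry u v huv)).imp
      (fun h => Finset.mem_filter.2 ⟨Finset.mem_univ _, h⟩)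
      fun h => Finset.mem_filter.2 ⟨Finset.mem_univ _, h⟩
  refine ⟨⟨s, hscov⟩, ?_, ?_⟩
  · change _ = BinTree.ofVector fun v => v ∈ s
    rw [← enc_boolVector]
    congr 1
    refine boolVector_eq_iff ?_ fun i => ?_
    · simp [composeCover, tabulate, ← hM, hn]
    · rw [hmem]
      simp only [hs, Finset.mem_filter, Finset.mem_univ, true_and]
      exact ⟨fun h => ⟨Finset.mem_range.1 (Finset.mem_filter.1 h).1, h⟩, fun h => h.2⟩
  · obtain ⟨⟨s₀, hs₀⟩, hopt⟩ : ∃ s₀, vertexCoverTW.value I s₀ = vertexCoverTW.opt I :=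
      Nat.sInf_mem (s := Set.range fun s => vertexCoverTW.value I s)
        (@Set.range_nonempty _ _ (vertexCoverTW.sol_nonempty I) _)
    change Finset (Fin I.n) at s₀
    change s₀.card = _ at hopt
    change (s.card : ℝ) ≤ _
    rw [← hopt]
    have hs₀cov : CoversPart (fun u v => entry M u v) ⊤ (s₀.map Fin.valEmbedding) := by
      intro u v _ _ huv
      obtain ⟨hu, hv, huv⟩ := entry_boolMatrix.1 huv
      exact (hs₀ huv).imp (fun h => Finset.mem_map.2 ⟨_, h, rfl⟩)
        fun h => Finset.mem_map.2 ⟨_, h, rfl⟩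
    have h1 : s.card ≤ F.card := by
      rw [← Finset.card_map Fin.valEmbedding]
      refine Finset.card_le_card fun v hv => ?_
      obtain ⟨w, hw, rfl⟩ := Finset.mem_map.1 hv
      exact (Finset.mem_filter.1 hw).2
    -- Each piece is charged to the share of the optimal cover in it; the pieces are disjoint, so
    -- the shares add up to at most the optimum.
    have h2 := Finset.card_le_sum_of_forall_mem l Φ F fun v hv => (Finset.mem_filter.1 hv).2
    have h3 := List.sum_map_le_mul l (fun x => (Φ x).card) _ fun x hx =>
      card_pieceCover_le hc hε hεK hD.symm (hspl.large x hx) (hAx x) hs₀cov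
    have h4 := List.sum_card_filter_le l hspl.pairwise (s₀.map Fin.valEmbedding)
    rw [Finset.card_map] at h4
    calc (s.card : ℝ) ≤ ((l.map fun x => (Φ x).card).sum : ℕ) := by exact_mod_cast h1.trans h2
      _ ≤ _ := h3
      _ ≤ (1 + ε) * c * s₀.card := by gcongr

end GraphWithTD

/-- The Turing kernel, with both measures of the size of its queries. -/
theorem exists_turingKernel {K : ℕ} {ε : ℝ} (hK : 1 ≤ K) (hε : 0 < ε) (hεK : 1 ≤ ε * K) :
    ∃ (P : WProg) (p : Polynomial ℕ), ∀ c : ℝ, 1 ≤ c → ∀ O : BinTree → BinTree,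
      vertexCoverTW.IsApproxOracle c O → ∀ I : GraphWithTD, ∃ (τ : Store) (t : ℕ)
        (qs : List BinTree), Exec O P (initStore I.encode) τ t qs ∧
        t ≤ p.eval (I.encode.size + I.dec.width) ∧
        vertexCoverTW.IsApproxSolution ((1 + ε) * c) I (τ 0) ∧
        ∀ q ∈ qs, ∃ J : GraphWithTD, q = J.encode ∧ J.n ≤ 20 * K * I.dec.width ∧
          J.encode.size ≤ 4 * J.n ^ 2 + 6 * J.n + 20 := by
  obtain ⟨P, T, hT, hP⟩ := exists_queryProgram (PT.queryItems K) PT.composeCover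
  obtain ⟨p, hp⟩ := hT
  refine ⟨P, p, fun c hc O hO I => ?_⟩
  have hD := I.isDecomposition
  have hans := fun (R : List ℕ) (hR : R.Nodup) =>
    exists_answer hD.symm I.not_entry_self hc hO hR
  choose! A S hA using hans
  obtain ⟨τ, t, hexec, ht, hτ⟩ := hP O I.matrices (fun x => A x.2.2) fun x hx => by
    obtain ⟨y, -, rfl⟩ := List.mem_map.1 hx
    have h := hA (restVertices I.matrices.1 y.2) nodup_restVertices
    refine ⟨h.answer, ?_⟩
    refine (encLen_list_le (l := A _) (B := 3) fun _ _ => encLen_bool_le _).trans ?_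
    have h1 := le_encLen_makeQuery (M := I.matrices.1) (restVertices I.matrices.1 y.2)
    have h2 := h.length
    simp only [makeItem, encLen_pair]
    omega
  rw [I.enc_matrices] at hexec
  refine ⟨τ, t, _, hexec, ht.trans ?_, ?_, fun q hq => ?_⟩
  · rw [hp, encLen, I.enc_matrices]
    exact IsNatPoly.mono ⟨p, fun _ => rfl⟩ (Nat.le_add_right _ _)
  · rw [hτ]
    exact I.isApproxSolution_compose hK hc hε hεK hA
  · obtain ⟨x, hx, rfl⟩ := List.mem_map.1 hq
    obtain ⟨y, hy, rfl⟩ := List.mem_map.1 hx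
    refine ⟨queryInstance hD.symm I.not_entry_self (restVertices I.matrices.1 y.2),
      enc_makeQuery _ _ _, I.length_rest_le hK hy, ?_⟩
    rw [← enc_makeQuery]
    exact encLen_makeQuery_le _

theorem mainTheorem2 :
    ∃ C : ℝ, 0 < C ∧ ∀ ε : ℝ, 0 < ε → ε ≤ 1 →
      ∃ (P : WProg) (f : ℕ → ℕ) (g : Polynomial ℕ),
        (∀ l : ℕ, (f l : ℝ) ≤ C * l / ε) ∧
        vertexCoverTW.IsApproxTuringKernel (1 + ε) (fun I : GraphWithTD => I.n) f P ∧
        vertexCoverTW.IsApproxTuringKernel (1 + ε) vertexCoverTW.encSize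
          (fun l => g.eval l) P := by
  -- A query has at most `20 * K * ℓ` vertices, and `K ≤ 2 / ε` because `ε ≤ 1`.
  refine ⟨40, by norm_num, fun ε hε hε1 => ?_⟩
  set K := ⌈1 / ε⌉₊ with hKdef
  have hK1 : 1 / ε ≤ K := Nat.le_ceil _
  have hK2 : (K : ℝ) ≤ 2 / ε := by
    have h1 : (K : ℝ) < 1 / ε + 1 := Nat.ceil_lt_add_one (by positivity)
    have h2 : 1 ≤ 1 / ε := (one_le_div hε).2 hε1
    have h3 : 2 / ε = 1 / ε + 1 / ε := by ring
    linarith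
  have hεK : 1 ≤ ε * K := by
    rw [div_le_iff₀ hε] at hK1
    linarith
  have hK : 1 ≤ K := Nat.ceil_pos.2 (by positivity)
  obtain ⟨P, p, hP⟩ := exists_turingKernel hK hε hεK
  -- The encoding bound `4 * n ^ 2 + 6 * n + 20` for a query, at `n = 20 * K * ℓ`.
  set g : Polynomial ℕ := .C 4 * (.C (20 * K) * .X) ^ 2 + .C 6 * (.C (20 * K) * .X) + .C 20 with hg
  have hgeval : ∀ l, g.eval l = 4 * ((20 * K * l) * (20 * K * l)) + 6 * (20 * K * l) + 20 := by
    intro l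
    simp [hg, sq]
  have hf : Primrec fun l : ℕ => 20 * K * l := Primrec.nat_mul.comp (.const _) .id
  refine ⟨P, fun l => 20 * K * l, g, fun l => ?_, ⟨by linarith, hf.to_comp, p, ?_⟩,
    ⟨by linarith, ?_, p, ?_⟩⟩
  · have : (0 : ℝ) ≤ 20 * l := by positivity
    calc ((20 * K * l : ℕ) : ℝ) = 20 * l * K := by push_cast; ring
      _ ≤ 20 * l * (2 / ε) := by gcongr
      _ = 40 * l / ε := by ring
  · intro c hc O hO I
    obtain ⟨τ, t, qs, h1, h2, h3, h4⟩ := hP c hc O hO I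
    refine ⟨τ, t, qs, h1, h2, h3, fun q hq => ?_⟩
    obtain ⟨J, hJ, hn, -⟩ := h4 q hq
    exact ⟨J, hJ, hn⟩
  · have : Primrec fun l : ℕ => g.eval l := by
      simp only [hgeval]
      exact Primrec.nat_add.comp (Primrec.nat_add.comp
        (Primrec.nat_mul.comp (.const _) (Primrec.nat_mul.comp hf hf))
        (Primrec.nat_mul.comp (.const _) hf)) (.const _)
    exact this.to_comp
  · intro c hc O hO I
    obtain ⟨τ, t, qs, h1, h2, h3, h4⟩ := hP c hc O hO I
    refine ⟨τ, t, qs, h1, h2, h3, fun q hq => ?_⟩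
    obtain ⟨J, hJ, hn, hs⟩ := h4 q hq
    refine ⟨J, hJ, hs.trans ?_⟩
    change _ ≤ g.eval I.dec.width
    rw [hgeval, ← sq]
    gcongr
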